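/- Let $p(y|x)$ be a discrete memoryless channel with finite ordered input alphabet and finite output alphabet, without redundant input symbols (no two distinct $x_1,x_2$ have $p(y|x_1)=p(y|x_2)$ for all $y$), and let $p(x)$ be an input pmf with $I(X;Y)>0$. All logarithms are natural, and $p(y)=\sum_x p(x)p(y|x)$. For a rate $R$ and a blocklength $n$, consider the maximal information gain feedback scheme with $N=\lceil e^{nR}\rceil$ equiprobable messages $m\in\{1,\dots,N\}$. Put $s_0(m)=1/N$ and $t_i(m)=\sum_{m'<m}s_i(m')$. Let $U_1,\dots,U_n$ be i.i.d. uniform on $[0,1]$, independent of the message and known to encoder and decoder. At time $i$, with past outputs $y^{i-1}$ and shifts $u^i$, the encoder of message $m$ sends $X_i=F_X^{-1}(w)$, where $w=w(v)=\bigl(v\,s_{i-1}(m)+t_{i-1}(m)+u_i\bigr)\bmod 1$, $F_X^{-1}(w)$ is the symbol $x$ with $F_X(x-1)<w\le F_X(x)$ (the first symbol of positive probability if $w=0$), and $v\in[0,1]$ maximizes $\mathbb E[\ln s_i(m)\mid W_i=w(v)]$ over $[0,1]$ (with $\ln 0=-\infty$). After $Y_i=y_i$ has been received, $s_i(m)=\int_{A}p(y_i|F_X^{-1}(w))\,dw\big/\int_0^1p(y_i|F_X^{-1}(w))\,dw$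 with $A=[t_{i-1}(m),t_{i-1}(m)+s_{i-1}(m)]+u_i\bmod 1$. The decoder outputs a message that maximizes $s_n(m)$. Ties in both maximizations are broken in any measurable way. Let $P_e^{(n)}(R)$ be the probability of decoding error and $E(R)=\limsup_{n\to\infty}-\frac1n\ln P_e^{(n)}(R)\in[0,\infty]$. Then, as $R$ tends to $I(X;Y)$ from below, $$\liminf_{R\uparrow I(X;Y)}\frac{E(R)}{(I(X;Y)-R)^2}=\frac{1}{2\,\mathrm{Var}[\ln(p(Y|X)/p(Y))]},$$ and the quotient in fact converges to the right-hand side, i.e. $E(R)$ approaches $(I(X;Y)-R)^2/(2\,\mathrm{Var}[\ln(p(Y|X)/p(Y))])$ in this sense. Here $(X,Y)\sim p(x)p(y|x)$, and the right-hand side is $+\infty$ if the variance is $0$. -/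

import Mathlib

open Filter Topology MeasureTheory
open scoped ENNReal

noncomputable section

namespace FeedbackScheme

variable {𝒳 𝒴 : Type*} [Fintype 𝒳] [LinearOrder 𝒳] [Nonempty 𝒳] [Fintype 𝒴]

/-! ### Information quantities

`p x` is the input pmf `p(x)` and `W x y` is the channel `p(y|x)`; logarithms are natural. -/

/-- The output pmf `p(y) = ∑ₓ p(x) p(y|x)`. -/
def outputPMF (p : 𝒳 → ℝ) (W : 𝒳 → 𝒴 → ℝ) (y : 𝒴) : ℝ := ∑ x, p x * W x y

/-- The information density `ln (p(y|x) / p(y))`. -/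
def infoDensity (p : 𝒳 → ℝ) (W : 𝒳 → 𝒴 → ℝ) (x : 𝒳) (y : 𝒴) : ℝ :=
  Real.log (W x y / outputPMF p W y)

/-- `I(X;Y)`, the mean of the information density under `p(x) p(y|x)`. -/
def mutualInfo (p : 𝒳 → ℝ) (W : 𝒳 → 𝒴 → ℝ) : ℝ :=
  ∑ x, ∑ y, p x * W x y * infoDensity p W x y

/-- `Var[ln (p(Y|X) / p(Y))]`, the variance of the information density under `p(x) p(y|x)`. -/
def dispersion (p : 𝒳 → ℝ) (W : 𝒳 → 𝒴 → ℝ) : ℝ :=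
  ∑ x, ∑ y, p x * W x y * (infoDensity p W x y - mutualInfo p W) ^ 2

/-- No two distinct input symbols have the same row of transition probabilities. -/
def NoRedundantInputs (W : 𝒳 → 𝒴 → ℝ) : Prop :=
  ∀ x₁ x₂ : 𝒳, x₁ ≠ x₂ → ∃ y, W x₁ y ≠ W x₂ y

/-! ### The partition of the unit interval by the input distribution -/

/-- The cdf `F_X(x)` of the input pmf. -/
def inputCdf (p : 𝒳 → ℝ) (x : 𝒳) : ℝ := ∑ x' ∈ Finset.univ.filter (fun x' => x' ≤ x), p x'

open Classical in
/-- `F_X⁻¹(w)`: the least symbol `x` in the support of `p` with `w ≤ F_X(x)`. For `0 < w ≤ 1` this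
is the symbol with `F_X(x-1) < w ≤ F_X(x)`; at `w = 0` it is the first symbol of the support. -/
def inputQuantile (p : 𝒳 → ℝ) (w : ℝ) : 𝒳 :=
  if h : (Finset.univ.filter (fun x => 0 < p x ∧ w ≤ inputCdf p x)).Nonempty then
    Finset.min' _ h
  else Classical.arbitrary 𝒳

/-- The set `[t, t + s] + u mod 1 = {x + u mod 1 : x ∈ [t, t + s]}`. -/
def shiftedArc (t s u : ℝ) : Set ℝ := (fun x => Int.fract (x + u)) '' Set.Icc t (t + s)

/-- `∫_A dF_{W|Y}(w|y)`, where `F_{W|Y}(·|y)` has the density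
`p_{Y|W}(y|w) / ∫₀¹ p_{Y|W}(y|w') dw'` on `[0,1]` and `p_{Y|W}(y|w) = p(y|F_X⁻¹(w))`. -/
def posteriorMass (p : 𝒳 → ℝ) (W : 𝒳 → 𝒴 → ℝ) (y : 𝒴) (A : Set ℝ) : ℝ :=
  (∫ w in A, W (inputQuantile p w) y) / ∫ w in (0 : ℝ)..1, W (inputQuantile p w) y

/-! ### The pseudo posterior probabilities

There are `N` messages, indexed by `Fin N`. After `i` channel uses, `y : Fin i → 𝒴` are the outputs
received and `u : Fin i → ℝ` the cyclic shifts used so far. -/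

/-- The left edges `t(m) = ∑_{m' < m} s(m')` of consecutive intervals of lengths `s(m)`. -/
def leftEdge {N : ℕ} (s : Fin N → ℝ) (m : Fin N) : ℝ :=
  ∑ m' ∈ Finset.univ.filter (fun m' => m' < m), s m'

/-- The interval lengths `s_i(m, y^i, u^i)`. -/
def pseudoPost (p : 𝒳 → ℝ) (W : 𝒳 → 𝒴 → ℝ) (N : ℕ) :
    (i : ℕ) → (Fin i → 𝒴) → (Fin i → ℝ) → Fin N → ℝ
  | 0, _, _ => fun _ => (N : ℝ)⁻¹
  | i + 1, y, u => fun m =>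
      let s := pseudoPost p W N i (fun j => y j.castSucc) (fun j => u j.castSucc)
      posteriorMass p W (y (Fin.last i)) (shiftedArc (leftEdge s m) (s m) (u (Fin.last i)))

/-- The point `w = (v * s(m) + t(m)) + u mod 1` of the shifted interval of message `m`, after the
outputs `y`; `u` contains the previous shifts and the present one. -/
def point (p : 𝒳 → ℝ) (W : 𝒳 → 𝒴 → ℝ) {N i : ℕ} (m : Fin N) (y : Fin i → 𝒴)
    (u : Fin (i + 1) → ℝ) (v : ℝ) : ℝ :=
  let s := pseudoPost p W N i y (fun j => u j.castSucc)
  Int.fract (v * s m + leftEdge s m + u (Fin.last i))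

/-- The input symbol `F_X⁻¹(w)` sent for message `m` if the position in its interval is `v`. -/
def inputSymbol (p : 𝒳 → ℝ) (W : 𝒳 → 𝒴 → ℝ) {N i : ℕ} (m : Fin N) (y : Fin i → 𝒴)
    (u : Fin (i + 1) → ℝ) (v : ℝ) : 𝒳 :=
  inputQuantile p (point p W m y u v)

/-- `E[ln s(m, (y, Y), u) | W = w(v)]` for the next output `Y ~ p(·|F_X⁻¹(w(v)))`. It is an extended
real, with `ln 0 = -∞` and `0 * (-∞) = 0`. -/
def expectedLogPost (p : 𝒳 → ℝ) (W : 𝒳 → 𝒴 → ℝ) {N i : ℕ} (m : Fin N) (y : Fin i → 𝒴)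
    (u : Fin (i + 1) → ℝ) (v : ℝ) : EReal :=
  ∑ y' : 𝒴, (W (inputSymbol p W m y u v) y' : EReal) *
    ENNReal.log (ENNReal.ofReal (pseudoPost p W N (i + 1) (Fin.snoc (α := fun _ => 𝒴) y y') u m))

/-- The maximal information gain scheme with `N` messages and `n` channel uses. The only freedom is
how the encoder and the decoder break ties among the maximizers, which they do measurably. -/
structure MaxInfoGainScheme (p : 𝒳 → ℝ) (W : 𝒳 → 𝒴 → ℝ) (N n : ℕ) where
  /-- the position `V_i` selected by the encoder, given the message, the past outputs and the
  shifts -/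
  select : (i : ℕ) → Fin N → (Fin i → 𝒴) → (Fin (i + 1) → ℝ) → ℝ
  measurable_select : ∀ i m y, Measurable (select i m y)
  select_mem : ∀ i m y u, select i m y u ∈ Set.Icc (0 : ℝ) 1
  select_max : ∀ i m y u, ∀ v ∈ Set.Icc (0 : ℝ) 1,
    expectedLogPost p W m y u v ≤ expectedLogPost p W m y u (select i m y u)
  /-- the decoder's output, given all outputs and shifts -/
  decode : (Fin n → 𝒴) → (Fin n → ℝ) → Fin N
  measurable_decode : ∀ y, Measurable (decode y)
  decode_max : ∀ y u m, pseudoPost p W N n y u m ≤ pseudoPost p W N n y u (decode y u)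

/-! ### Error probability and error exponent -/

/-- The input `X_i` of the `i`-th channel use when message `m` is sent, the outputs are `y` (of which
only the past ones matter) and the shifts are `u`. -/
def MaxInfoGainScheme.input {p : 𝒳 → ℝ} {W : 𝒳 → 𝒴 → ℝ} {N n : ℕ} (S : MaxInfoGainScheme p W N n)
    (m : Fin N) (y : Fin n → 𝒴) (u : Fin n → ℝ) (i : Fin n) : 𝒳 :=
  let y' : Fin i → 𝒴 := fun j => y (Fin.castLE i.isLt.le j)
  let u' : Fin (i + 1) → ℝ := fun j => u (Fin.castLE i.isLt j)
  inputSymbol p W m y' u' (S.select i m y' u')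

open Classical in
/-- `P{M ≠ M̂}` for `M` uniform on the messages, `U₁, …, Uₙ` i.i.d. uniform on `[0,1]` and independent
of `M`, and `Y_i ~ p(·|X_i)` given the past. -/
def MaxInfoGainScheme.errorProb {p : 𝒳 → ℝ} {W : 𝒳 → 𝒴 → ℝ} {N n : ℕ}
    (S : MaxInfoGainScheme p W N n) : ℝ≥0∞ :=
  (N : ℝ≥0∞)⁻¹ * ∑ m : Fin N, ∫⁻ u in Set.Icc (0 : Fin n → ℝ) 1,
    ∑ y : Fin n → 𝒴, if S.decode y u = m then 0 else
      ∏ i : Fin n, ENNReal.ofReal (W (S.input m y u i) (y i))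

/-- The number of messages `⌈e^{nR}⌉` at rate `R` and blocklength `n`. -/
def numMessages (R : ℝ) (n : ℕ) : ℕ := ⌈Real.exp (n * R)⌉₊

/-- The error exponent `E = limsup_n -(1/n) ln P_e⁽ⁿ⁾ ∈ [0, ∞]` of a sequence of error
probabilities. -/
def errorExponent (Pe : ℕ → ℝ≥0∞) : EReal :=
  limsup (fun n : ℕ => -((((n : ℝ)⁻¹ : ℝ) : EReal) * ENNReal.log (Pe n))) atTop

end FeedbackScheme

end

open FeedbackScheme

/-! Write i(x;y) = ln(p(y|x)/p(y)), I for its mean, V for its variance and M(β) = E exp(β i(X;Y)).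
If the shifted interval of a message lies inside one cell of F_X, the encoder has no choice: it
sends the symbol of that cell, and ln s grows by exactly i(x;y). Since the shift is uniform, the
left end of the interval falls into the cell of x with probability p(x) whatever the past, and an
interval of length s straddles a cell boundary with probability at most |𝒳| s
(`integral_straddle_le`). So while s is small, ln s is nearly a random walk with increments i(X;Y),
started at -ln N. The exponent is the large-deviation exponent of this walk failing to climb to 0,
and near R = I it is quadratic with coefficient 1/(2V).

Achievability. For small l > 0 the expectation of s^(-l) - 1 contracts by the factor M(-l) in every
step (`exists_one_step_bound`). For small s the straddling error, even after multiplication by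
s^(-l), is absorbed by the "-1". For s bounded away from 0 the random walk picture fails, and the
maximal gain rule takes over: averaged over the shift, the expected growth of ln s is at least
κ(1-s) (`exists_drift_lower_bound`). In the middle range this is compactness together with a
relative entropy bound, strict because no input is redundant; near s = 1 it needs a first-order
expansion in 1-s (`gain_ge_of_complement_in_cell`). An error forces s_n ≤ 1/2, so Markov's
inequality gives P_e ≤ M(-l)^n N^l / (2^l - 1) (`exists_errorProb_le`).

Converse. On paths all of whose arcs lie inside cells, s is a genuine likelihood ratio: the path
weight over N is s times the product of the p(y_i). Hence a correct decision together with s_n ≤ b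
has probability at most b on such paths, and P_e + b is at least the weight of the paths with s_n ≤
b (`sum_pathInt_le_errorProb_add`). That weight is bounded below by a Cramér tilting argument in
terms of moments: the moment of order -l is nearly M(-l)^n N^l, and moments of orders -l ± θ show
that it is carried by a window of values of s_n (`rpow_le_window`, `le_errorProb`).

Both bounds are evaluated with ln M(β) = βI + β²V/2 + O(|β|³) and l close to (I-R)/V. This l tends
to 0 as R ↑ I, so it is enough that both bounds hold for small l. -/

noncomputable section

set_option linter.unusedSectionVars false

namespace FeedbackScheme

variable {𝒳 𝒴 : Type*} [Fintype 𝒳] [LinearOrder 𝒳] [Nonempty 𝒳] [Fintype 𝒴]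

section

/-! ### The cells of the input quantile function -/

/-- The left limit `F_X(x-1)` of the input cdf. -/
def cellLeft (p : 𝒳 → ℝ) (x : 𝒳) : ℝ := inputCdf p x - p x

lemma cellLeft_eq_sum (p : 𝒳 → ℝ) (x : 𝒳) :
    cellLeft p x = ∑ x' ∈ Finset.univ.filter (fun x' => x' < x), p x' := by
  have : Finset.univ.filter (fun x' => x' ≤ x)
      = insert x (Finset.univ.filter (fun x' => x' < x)) := by
    ext a; simp [le_iff_eq_or_lt]
  rw [cellLeft, inputCdf, this, Finset.sum_insert (by simp)]
  ring

lemma cellLeft_nonneg {p : 𝒳 → ℝ} (hp : p ∈ stdSimplex ℝ 𝒳) (x : 𝒳) : 0 ≤ cellLeft p x := by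
  rw [cellLeft_eq_sum]; exact Finset.sum_nonneg fun i _ => hp.1 i

lemma inputCdf_le_one {p : 𝒳 → ℝ} (hp : p ∈ stdSimplex ℝ 𝒳) (x : 𝒳) : inputCdf p x ≤ 1 := by
  rw [← hp.2]
  exact Finset.sum_le_sum_of_subset_of_nonneg (Finset.filter_subset _ _) fun i _ _ => hp.1 i

lemma inputCdf_le_cellLeft {p : 𝒳 → ℝ} (hp : p ∈ stdSimplex ℝ 𝒳) {x x' : 𝒳} (h : x < x') :
    inputCdf p x ≤ cellLeft p x' := by
  rw [cellLeft_eq_sum]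
  refine Finset.sum_le_sum_of_subset_of_nonneg (fun a ha => ?_) fun i _ _ => hp.1 i
  simp only [Finset.mem_filter, Finset.mem_univ, true_and] at ha ⊢
  exact ha.trans_lt h

/-- Every point of `[0,1]` has a support symbol whose cdf value is at least the point. -/
lemma exists_le_inputCdf {p : 𝒳 → ℝ} (hp : p ∈ stdSimplex ℝ 𝒳) {w : ℝ} (hw : w ≤ 1) :
    (Finset.univ.filter (fun x => 0 < p x ∧ w ≤ inputCdf p x)).Nonempty := by
  classical
  have hne : (Finset.univ.filter (fun x => 0 < p x)).Nonempty := by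
    by_contra h
    rw [Finset.not_nonempty_iff_eq_empty] at h
    have : ∑ x, p x = 0 := Finset.sum_eq_zero fun x _ => by
      have h1 := Finset.filter_eq_empty_iff.1 h (Finset.mem_univ x)
      exact le_antisymm (not_lt.1 h1) (hp.1 x)
    rw [hp.2] at this; norm_num at this
  -- The cdf at the last symbol of the support is 1.
  set M := Finset.max' _ hne
  have hM := Finset.max'_mem _ hne
  refine ⟨M, ?_⟩
  simp only [Finset.mem_filter, Finset.mem_univ, true_and] at hM ⊢
  refine ⟨hM, hw.trans ?_⟩
  rw [← hp.2, inputCdf]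
  refine le_of_eq (Finset.sum_subset (Finset.filter_subset _ _) fun x _ hx => ?_).symm
  simp only [Finset.mem_filter, Finset.mem_univ, true_and] at hx
  by_contra h0
  exact hx (Finset.le_max' _ _ (by simpa using lt_of_le_of_ne (hp.1 x) (Ne.symm h0)))

lemma inputQuantile_spec {p : 𝒳 → ℝ} (hp : p ∈ stdSimplex ℝ 𝒳) {w : ℝ} (hw : w ≤ 1) :
    0 < p (inputQuantile p w) ∧ w ≤ inputCdf p (inputQuantile p w) := by
  classical
  have h := exists_le_inputCdf hp hw
  have h1 := Finset.min'_mem _ h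
  unfold inputQuantile
  rw [dif_pos h]
  simpa using h1

lemma inputQuantile_eq_of_mem {p : 𝒳 → ℝ} (hp : p ∈ stdSimplex ℝ 𝒳) {w : ℝ} {x : 𝒳}
    (h1 : cellLeft p x < w) (h2 : w ≤ inputCdf p x) : inputQuantile p w = x := by
  classical
  have hpx : 0 < p x := by unfold cellLeft at h1; linarith
  have h := exists_le_inputCdf hp (h2.trans (inputCdf_le_one hp x))
  unfold inputQuantile
  rw [dif_pos h]
  refine le_antisymm (Finset.min'_le _ _ (by simp [hpx, h2])) ?_
  refine Finset.le_min' _ _ _ fun x' hx' => ?_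
  simp only [Finset.mem_filter, Finset.mem_univ, true_and] at hx'
  by_contra hlt
  have := inputCdf_le_cellLeft hp (not_le.1 hlt)
  linarith [hx'.2]

/-- Otherwise the largest support symbol `M` below the quantile, whose cdf equals the left limit
there, would already be a candidate for the minimum. -/
lemma cellLeft_lt_of_inputQuantile {p : 𝒳 → ℝ} (hp : p ∈ stdSimplex ℝ 𝒳) {w : ℝ} (h0 : 0 < w)
    (hw : w ≤ 1) : cellLeft p (inputQuantile p w) < w := by
  classical
  set x := inputQuantile p w with hx
  by_contra hle
  rw [not_lt] at hle
  have hne : (Finset.univ.filter (fun x' => x' < x ∧ 0 < p x')).Nonempty := by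
    by_contra h
    rw [Finset.not_nonempty_iff_eq_empty] at h
    have : cellLeft p x = 0 := by
      rw [cellLeft_eq_sum]
      refine Finset.sum_eq_zero fun x' hx' => ?_
      have h1 := Finset.filter_eq_empty_iff.1 h (Finset.mem_univ x')
      simp only [Finset.mem_filter, Finset.mem_univ, true_and] at hx'
      by_contra h2
      exact h1 ⟨hx', lt_of_le_of_ne (hp.1 x') (Ne.symm h2)⟩
    linarith
  have hM := Finset.max'_mem _ hne
  set M := Finset.max' _ hne with hMdef
  simp only [Finset.mem_filter, Finset.mem_univ, true_and] at hM
  have hcdf : cellLeft p x = inputCdf p M := by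
    rw [cellLeft_eq_sum, inputCdf]
    symm
    refine Finset.sum_subset (fun a ha => ?_) fun a ha hna => ?_
    · simp only [Finset.mem_filter, Finset.mem_univ, true_and] at ha ⊢
      exact ha.trans_lt hM.1
    · simp only [Finset.mem_filter, Finset.mem_univ, true_and] at ha hna
      by_contra h0
      exact hna (Finset.le_max' _ _ (by
        simpa using ⟨ha, lt_of_le_of_ne (hp.1 a) (Ne.symm h0)⟩))
  have hle' : x ≤ M := by
    have h := exists_le_inputCdf hp hw
    rw [hx]
    unfold inputQuantile
    rw [dif_pos h]
    exact Finset.min'_le _ _ (by simpa using ⟨hM.2, hcdf ▸ hle⟩)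
  exact absurd hM.1 (not_lt.2 hle')

lemma inputQuantile_eq_iff {p : 𝒳 → ℝ} (hp : p ∈ stdSimplex ℝ 𝒳) {w : ℝ} (h0 : 0 < w)
    (hw : w ≤ 1) (x : 𝒳) : inputQuantile p w = x ↔ w ∈ Set.Ioc (cellLeft p x) (inputCdf p x) := by
  refine ⟨?_, fun h => inputQuantile_eq_of_mem hp h.1 h.2⟩
  rintro rfl
  exact ⟨cellLeft_lt_of_inputQuantile hp h0 hw, (inputQuantile_spec hp hw).2⟩

/-- The quantile depends on `w` only through the finitely many truth values of `w ≤ inputCdf p x`,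
and every function of these is measurable. No σ-algebra on 𝒳 is involved. -/
lemma measurable_comp_inputQuantile {β : Type*} [MeasurableSpace β] (p : 𝒳 → ℝ) (G : 𝒳 → β) :
    Measurable (fun w => G (inputQuantile p w)) := by
  classical
  let H : (𝒳 → Prop) → β := fun S =>
    if h : (Finset.univ.filter (fun x => 0 < p x ∧ S x)).Nonempty then G (Finset.min' _ h)
    else G (Classical.arbitrary 𝒳)
  have hH : Measurable H := measurable_of_finite H
  have hS : Measurable (fun w : ℝ => fun x : 𝒳 => (w ≤ inputCdf p x : Prop)) :=
    measurable_pi_lambda _ fun x => measurableSet_setOfPred.1 measurableSet_Iic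
  convert hH.comp hS using 1
  funext w
  simp only [Function.comp, H, inputQuantile]
  split_ifs <;> rfl

/-! ### Functions of the input symbol on the circle -/

/-- The 1-periodic function `z ↦ G (F_X⁻¹(z mod 1))`. -/
def circ (p : 𝒳 → ℝ) (G : 𝒳 → ℝ) (z : ℝ) : ℝ := G (inputQuantile p (Int.fract z))

lemma measurable_circ (p : 𝒳 → ℝ) (G : 𝒳 → ℝ) : Measurable (circ p G) :=
  (measurable_comp_inputQuantile p G).comp measurable_fract

lemma periodic_circ (p : 𝒳 → ℝ) (G : 𝒳 → ℝ) : Function.Periodic (circ p G) 1 := fun z => by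
  simp [circ]

lemma abs_circ_le (p : 𝒳 → ℝ) (G : 𝒳 → ℝ) (z : ℝ) : |circ p G z| ≤ ∑ x, |G x| :=
  Finset.single_le_sum (f := fun x => |G x|) (fun _ _ => abs_nonneg _) (Finset.mem_univ _)

lemma intervalIntegrable_of_bounded {f : ℝ → ℝ} (hf : Measurable f) {C : ℝ}
    (hC : ∀ z, |f z| ≤ C) (a b : ℝ) : IntervalIntegrable f volume a b := by
  refine (intervalIntegrable_const (c := C)).mono_fun hf.aestronglyMeasurable ?_
  refine Eventually.of_forall fun z => ?_
  simpa using (hC z).trans (le_abs_self C)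

lemma intervalIntegrable_circ (p : 𝒳 → ℝ) (G : 𝒳 → ℝ) (a b : ℝ) :
    IntervalIntegrable (circ p G) volume a b :=
  intervalIntegrable_of_bounded (measurable_circ p G) (abs_circ_le p G) a b

/-- Inverse transform sampling: the half-open cells, of lengths `p x`, partition (0,1]. -/
lemma integral_comp_inputQuantile {p : 𝒳 → ℝ} (hp : p ∈ stdSimplex ℝ 𝒳) (G : 𝒳 → ℝ) :
    ∫ w in (0 : ℝ)..1, G (inputQuantile p w) = ∑ x, p x * G x := by
  classical
  have h1 : ∫ w in (0 : ℝ)..1, G (inputQuantile p w)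
      = ∫ w in Set.Ioc (0 : ℝ) 1,
        ∑ x, (Set.Ioc (cellLeft p x) (inputCdf p x)).indicator (fun _ => G x) w := by
    rw [intervalIntegral.integral_of_le zero_le_one]
    refine setIntegral_congr_fun measurableSet_Ioc fun w hw => ?_
    rw [Finset.sum_eq_single (inputQuantile p w)]
    · rw [Set.indicator_of_mem ((inputQuantile_eq_iff hp hw.1 hw.2 _).1 rfl)]
    · intro x _ hx
      refine Set.indicator_of_notMem (fun hm => hx ?_) _
      exact ((inputQuantile_eq_iff hp hw.1 hw.2 x).2 hm).symm
    · simp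
  have hsub : ∀ x, Set.Ioc (cellLeft p x) (inputCdf p x) ⊆ Set.Ioc 0 1 := fun x =>
    Set.Ioc_subset_Ioc (cellLeft_nonneg hp x) (inputCdf_le_one hp x)
  rw [h1, integral_finsetSum]
  · refine Finset.sum_congr rfl fun x _ => ?_
    rw [integral_indicator measurableSet_Ioc, Measure.restrict_restrict measurableSet_Ioc,
      Set.inter_eq_left.2 (hsub x)]
    simp [cellLeft, hp.1 x]
  · intro x _
    exact (integrable_const _).indicator measurableSet_Ioc

lemma integral_circ_period {p : 𝒳 → ℝ} (hp : p ∈ stdSimplex ℝ 𝒳) (G : 𝒳 → ℝ) (c : ℝ) :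
    ∫ z in c..c + 1, circ p G z = ∑ x, p x * G x := by
  rw [(periodic_circ p G).intervalIntegral_add_eq c 0, zero_add, ← integral_comp_inputQuantile hp G,
    intervalIntegral.integral_of_le zero_le_one, intervalIntegral.integral_of_le zero_le_one,
    integral_Ioc_eq_integral_Ioo, integral_Ioc_eq_integral_Ioo]
  refine setIntegral_congr_fun measurableSet_Ioo fun w hw => ?_
  simp only [circ]
  rw [Int.fract_eq_self.2 ⟨hw.1.le, hw.2⟩]

/-- The integral of a periodic function over shifts of a point. -/
lemma integral_shift_of_periodic {f : ℝ → ℝ} (hf : Function.Periodic f 1) (t : ℝ) :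
    ∫ u in (0 : ℝ)..1, f (t + u) = ∫ w in (0 : ℝ)..1, f w := by
  rw [intervalIntegral.integral_comp_add_left, add_zero, hf.intervalIntegral_add_eq t 0, zero_add]

/-! ### Arcs inside a single cell -/

/-- The arc `[c, c + s]` on the circle lies in the interior of a single cell. -/
def ArcInCell (p : 𝒳 → ℝ) (c s : ℝ) : Prop :=
  ∃ x, cellLeft p x < Int.fract c ∧ Int.fract c + s < inputCdf p x

lemma arcInCell_add_one (p : 𝒳 → ℝ) (c s : ℝ) : ArcInCell p (c + 1) s ↔ ArcInCell p c s := by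
  simp [ArcInCell]

lemma ArcInCell.quantile_eq {p : 𝒳 → ℝ} (hp : p ∈ stdSimplex ℝ 𝒳) {c s z : ℝ}
    (h : ArcInCell p c s) (hz : z ∈ Set.Icc c (c + s)) :
    inputQuantile p (Int.fract z) = inputQuantile p (Int.fract c) := by
  obtain ⟨x, h1, h2⟩ := h
  have hs : 0 ≤ s := by linarith [hz.1.trans hz.2]
  have h1' := inputCdf_le_one hp x
  have hz' : Int.fract z = Int.fract c + (z - c) := by
    rw [Int.fract_eq_iff]
    refine ⟨by linarith [Int.fract_nonneg c, hz.1], by linarith [hz.2], ⌊c⌋, ?_⟩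
    have := Int.fract_add_floor c
    linarith
  rw [inputQuantile_eq_of_mem hp h1 (by linarith),
    inputQuantile_eq_of_mem hp (x := x) (by linarith [hz.1]) (by linarith [hz.2])]

lemma measurableSet_arcInCell (p : 𝒳 → ℝ) {α : Type*} [MeasurableSpace α] {c s : α → ℝ}
    (hc : Measurable c) (hs : Measurable s) : MeasurableSet {a | ArcInCell p (c a) (s a)} := by
  have : {a | ArcInCell p (c a) (s a)}
      = ⋃ x, {a | cellLeft p x < Int.fract (c a)} ∩ {a | Int.fract (c a) + s a < inputCdf p x} := by
    ext a; simp [ArcInCell]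
  rw [this]
  exact MeasurableSet.iUnion fun x =>
    (measurableSet_lt measurable_const (measurable_fract.comp hc)).inter
      (measurableSet_lt ((measurable_fract.comp hc).add hs) measurable_const)

open Classical in
/-- The indicator of the arcs that are not inside a single cell. -/
def straddle (p : 𝒳 → ℝ) (s c : ℝ) : ℝ := if ArcInCell p c s then 0 else 1

lemma straddle_nonneg (p : 𝒳 → ℝ) (s c : ℝ) : 0 ≤ straddle p s c := by
  unfold straddle; split_ifs <;> norm_num

lemma straddle_le_one (p : 𝒳 → ℝ) (s c : ℝ) : straddle p s c ≤ 1 := by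
  unfold straddle; split_ifs <;> norm_num

lemma periodic_straddle (p : 𝒳 → ℝ) (s : ℝ) : Function.Periodic (straddle p s) 1 := fun c => by
  unfold straddle
  by_cases h : ArcInCell p c s
  · rw [if_pos h, if_pos ((arcInCell_add_one p c s).2 h)]
  · rw [if_neg h, if_neg (mt (arcInCell_add_one p c s).1 h)]

lemma measurable_straddle (p : 𝒳 → ℝ) (s : ℝ) : Measurable (straddle p s) := by
  classical
  exact Measurable.ite (measurableSet_arcInCell p measurable_id measurable_const)
    measurable_const measurable_const

lemma abs_straddle_le (p : 𝒳 → ℝ) (s c : ℝ) : |straddle p s c| ≤ 1 := by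
  rw [abs_of_nonneg (straddle_nonneg p s c)]; exact straddle_le_one p s c

/-- At most a fraction `|𝒳| s` of all arcs of length `s` straddles a cell boundary. -/
lemma integral_straddle_le {p : 𝒳 → ℝ} (hp : p ∈ stdSimplex ℝ 𝒳) {s : ℝ} (hs : 0 ≤ s) (t : ℝ) :
    ∫ u in (0 : ℝ)..1, straddle p s (t + u) ≤ Fintype.card 𝒳 * s := by
  classical
  rw [integral_shift_of_periodic (periodic_straddle p s)]
  have hint : ∀ x, IntervalIntegrable
      ((Set.Icc (inputCdf p x - s) (inputCdf p x)).indicator fun _ => (1 : ℝ)) volume 0 1 := fun x =>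
    intervalIntegrable_of_bounded (C := 1) (measurable_const.indicator measurableSet_Icc) (fun z => by
      unfold Set.indicator; split_ifs <;> simp) _ _
  calc ∫ w in (0 : ℝ)..1, straddle p s w
      ≤ ∫ w in (0 : ℝ)..1, ∑ x, (Set.Icc (inputCdf p x - s) (inputCdf p x)).indicator
          (fun _ => (1 : ℝ)) w := by
        refine intervalIntegral.integral_mono_on_of_le_Ioo zero_le_one
          (intervalIntegrable_of_bounded (measurable_straddle p s) (abs_straddle_le p s) _ _)
          ?_ fun w hw => ?_
        · rw [show (fun w => ∑ x, (Set.Icc (inputCdf p x - s) (inputCdf p x)).indicator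
            (fun _ => (1 : ℝ)) w) = ∑ x, (Set.Icc (inputCdf p x - s) (inputCdf p x)).indicator
            (fun _ => (1 : ℝ)) by ext; simp]
          exact IntervalIntegrable.sum _ fun x _ => hint x
        · unfold straddle
          have hnn : ∀ x, 0 ≤ (Set.Icc (inputCdf p x - s) (inputCdf p x)).indicator
            (fun _ => (1 : ℝ)) w := fun x => Set.indicator_nonneg (fun _ _ => zero_le_one) _
          split_ifs with h
          · exact Finset.sum_nonneg fun x _ => hnn x
          -- A straddling arc starts within distance `s` of the right end of the cell that contains
          -- its left end.
          · refine le_trans ?_ (Finset.single_le_sum (fun x _ => hnn x)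
              (Finset.mem_univ (inputQuantile p w)))
            have hc := (inputQuantile_eq_iff hp hw.1 hw.2.le _).1 rfl
            rw [Set.indicator_of_mem]
            refine ⟨?_, hc.2⟩
            by_contra hlt
            rw [not_le] at hlt
            refine h ⟨inputQuantile p w, ?_, ?_⟩
            · rw [Int.fract_eq_self.2 ⟨hw.1.le, hw.2⟩]; exact hc.1
            · rw [Int.fract_eq_self.2 ⟨hw.1.le, hw.2⟩]; linarith
    _ = ∑ x, ∫ w in (0 : ℝ)..1, (Set.Icc (inputCdf p x - s) (inputCdf p x)).indicator
          (fun _ => (1 : ℝ)) w := intervalIntegral.integral_finsetSum fun x _ => hint x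
    _ ≤ ∑ x : 𝒳, s := by
        refine Finset.sum_le_sum fun x _ => ?_
        rw [intervalIntegral.integral_of_le zero_le_one, integral_indicator measurableSet_Icc,
          Measure.restrict_restrict measurableSet_Icc, integral_const, smul_eq_mul, mul_one,
          Measure.real, Measure.restrict_apply_univ]
        refine ENNReal.toReal_le_of_le_ofReal hs ((measure_mono Set.inter_subset_left).trans ?_)
        rw [Real.volume_Icc]; simp
    _ = Fintype.card 𝒳 * s := by simp

end

section

/-! ### Integrals over shifted arcs -/

lemma image_fract_Icc_of_lt {a s : ℝ} (h : Int.fract a + s < 1) :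
    Int.fract '' Set.Icc a (a + s) = Set.Icc (Int.fract a) (Int.fract a + s) := by
  have ha := Int.fract_add_floor a
  have h0 := Int.fract_nonneg a
  ext w
  constructor
  · rintro ⟨z, hz, rfl⟩
    have : Int.fract z = z - ⌊a⌋ := by
      rw [Int.fract_eq_iff]
      exact ⟨by linarith [hz.1], by linarith [hz.2], ⌊a⌋, by ring⟩
    rw [this]
    exact ⟨by linarith [hz.1], by linarith [hz.2]⟩
  · intro hw
    refine ⟨w + ⌊a⌋, ⟨by linarith [hw.1], by linarith [hw.2]⟩, ?_⟩
    rw [Int.fract_add_intCast, Int.fract_eq_self]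
    exact ⟨h0.trans hw.1, hw.2.trans_lt h⟩

lemma image_fract_Icc_of_ge {a s : ℝ} (hs : s ≤ 1) (h : 1 ≤ Int.fract a + s) :
    Int.fract '' Set.Icc a (a + s) = Set.Ico (Int.fract a) 1 ∪ Set.Icc 0 (Int.fract a + s - 1) := by
  have ha := Int.fract_add_floor a
  have h0 := Int.fract_nonneg a
  have h1 := Int.fract_lt_one a
  ext w
  constructor
  · rintro ⟨z, hz, rfl⟩
    by_cases hlt : z < ⌊a⌋ + 1
    · have : Int.fract z = z - ⌊a⌋ := by
        rw [Int.fract_eq_iff]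
        exact ⟨by linarith [hz.1], by linarith [hz.2], ⌊a⌋, by ring⟩
      rw [this]
      exact Or.inl ⟨by linarith [hz.1], by linarith [hz.2]⟩
    · have : Int.fract z = z - ⌊a⌋ - 1 := by
        rw [Int.fract_eq_iff]
        exact ⟨by linarith [hz.1], by linarith [hz.2], ⌊a⌋ + 1, by push_cast; ring⟩
      rw [this]
      exact Or.inr ⟨by linarith [hz.1], by linarith [hz.2]⟩
  · rintro (hw | hw)
    · refine ⟨w + ⌊a⌋, ⟨by linarith [hw.1], by linarith [hw.2]⟩, ?_⟩
      rw [Int.fract_add_intCast, Int.fract_eq_self]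
      exact ⟨h0.trans hw.1, hw.2⟩
    · refine ⟨w + (⌊a⌋ + 1 : ℤ), ⟨by push_cast; linarith [hw.1], by push_cast; linarith [hw.2]⟩, ?_⟩
      rw [Int.fract_add_intCast, Int.fract_eq_self]
      exact ⟨hw.1, by linarith [hw.2]⟩

/-- This trades subsets of [0,1), which may wrap around, for intervals on the line and periodic
integrands, where additivity and telescoping are immediate. -/
lemma setIntegral_image_fract {g : ℝ → ℝ} (hg : Measurable g) {C : ℝ} (hC : ∀ z, |g z| ≤ C)
    {a s : ℝ} (h0 : 0 ≤ s) (hs : s ≤ 1) :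
    ∫ w in Int.fract '' Set.Icc a (a + s), g w = ∫ z in a..a + s, g (Int.fract z) := by
  have ha := Int.fract_add_floor a
  have hf0 := Int.fract_nonneg a
  have hf1 := Int.fract_lt_one a
  have hii : ∀ a b, IntervalIntegrable g volume a b := intervalIntegrable_of_bounded hg hC
  have hii' : ∀ a b, IntervalIntegrable (fun z => g (Int.fract z)) volume a b :=
    intervalIntegrable_of_bounded (hg.comp measurable_fract) fun z => hC _
  have hper : ∫ z in a..a + s, g (Int.fract z)
      = ∫ z in Int.fract a..Int.fract a + s, g (Int.fract z) := by
    have := intervalIntegral.integral_comp_add_right (fun z => g (Int.fract z)) (⌊a⌋ : ℝ)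
      (a := Int.fract a) (b := Int.fract a + s)
    simp only [Int.fract_add_intCast] at this
    rw [this]
    congr 1
    · linarith
    · linarith
  have hunit : ∀ b c : ℝ, 0 ≤ b → b ≤ c → c ≤ 1 →
      ∫ z in b..c, g (Int.fract z) = ∫ z in b..c, g z := by
    intro b c hb hbc hc
    rw [intervalIntegral.integral_of_le hbc, intervalIntegral.integral_of_le hbc,
      integral_Ioc_eq_integral_Ioo, integral_Ioc_eq_integral_Ioo]
    refine setIntegral_congr_fun measurableSet_Ioo fun w hw => ?_
    rw [Int.fract_eq_self.2 ⟨(hb.trans_lt hw.1).le, hw.2.trans_le hc⟩]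
  rw [hper]
  by_cases h : Int.fract a + s < 1
  · rw [image_fract_Icc_of_lt h, hunit _ _ hf0 (by linarith) h.le, integral_Icc_eq_integral_Ioc,
      intervalIntegral.integral_of_le (by linarith)]
  · rw [not_lt] at h
    rw [image_fract_Icc_of_ge hs h]
    -- For `s = 1` the two pieces of the wrapped arc share the point `Int.fract a`.
    have hdis : AEDisjoint volume (Set.Ico (Int.fract a) 1) (Set.Icc 0 (Int.fract a + s - 1)) := by
      refine measure_mono_null (t := {Int.fract a}) ?_ (by simp)
      rintro w ⟨hw1, hw2⟩
      exact le_antisymm (by linarith [hw2.2]) hw1.1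
    have hint : ∀ {b c : ℝ}, IntegrableOn g (Set.Icc b c) := fun {b c} => by
      by_cases hbc : b ≤ c
      · exact (intervalIntegrable_iff_integrableOn_Icc_of_le hbc).1 (hii b c)
      · rw [Set.Icc_eq_empty hbc]; exact integrableOn_empty
    rw [setIntegral_union₀ hdis measurableSet_Icc.nullMeasurableSet
      (hint.mono_set Set.Ico_subset_Icc_self) hint, integral_Ico_eq_integral_Ioo,
      ← integral_Ioc_eq_integral_Ioo, integral_Icc_eq_integral_Ioc,
      ← intervalIntegral.integral_of_le hf1.le, ← intervalIntegral.integral_of_le (by linarith),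
      ← hunit _ _ hf0 hf1.le le_rfl, ← hunit _ _ le_rfl (by linarith) (by linarith),
      ← intervalIntegral.integral_add_adjacent_intervals (hii' (Int.fract a) 1)
        (hii' 1 (Int.fract a + s))]
    congr 1
    have := intervalIntegral.integral_comp_add_right (fun z => g (Int.fract z)) 1
      (a := 0) (b := Int.fract a + s - 1)
    simp only [Int.fract_add_one] at this
    rw [this]
    congr 1 <;> ring

/-- The integral of the transition probability `p(y|·)` over the arc `[c, c + s]`. -/
def arcInt (p : 𝒳 → ℝ) (W : 𝒳 → 𝒴 → ℝ) (y : 𝒴) (c s : ℝ) : ℝ :=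
  ∫ z in c..c + s, circ p (fun x => W x y) z

lemma integral_quantile_eq_outputPMF {p : 𝒳 → ℝ} (hp : p ∈ stdSimplex ℝ 𝒳) (W : 𝒳 → 𝒴 → ℝ)
    (y : 𝒴) : ∫ w in (0 : ℝ)..1, W (inputQuantile p w) y = outputPMF p W y :=
  integral_comp_inputQuantile hp fun x => W x y

lemma posteriorMass_shiftedArc {p : 𝒳 → ℝ} (hp : p ∈ stdSimplex ℝ 𝒳) (W : 𝒳 → 𝒴 → ℝ) (y : 𝒴)
    {t s u : ℝ} (h0 : 0 ≤ s) (hs : s ≤ 1) :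
    posteriorMass p W y (shiftedArc t s u) = arcInt p W y (t + u) s / outputPMF p W y := by
  have himg : shiftedArc t s u = Int.fract '' Set.Icc (t + u) (t + u + s) := by
    unfold shiftedArc
    have : (fun x : ℝ => Int.fract (x + u)) = Int.fract ∘ (fun x => x + u) := rfl
    rw [this, Set.image_comp, Set.image_add_const_Icc]
    congr 2; ring
  rw [posteriorMass, integral_quantile_eq_outputPMF hp, himg,
    setIntegral_image_fract (g := fun w => W (inputQuantile p w) y)
      (measurable_comp_inputQuantile p fun x => W x y)
      (C := ∑ x, |W x y|) (fun z => Finset.single_le_sum (f := fun x => |W x y|)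
        (fun _ _ => abs_nonneg _) (Finset.mem_univ _)) h0 hs]
  rfl

lemma outputPMF_nonneg {p : 𝒳 → ℝ} (hp : p ∈ stdSimplex ℝ 𝒳) {W : 𝒳 → 𝒴 → ℝ}
    (hW : ∀ x, W x ∈ stdSimplex ℝ 𝒴) (y : 𝒴) : 0 ≤ outputPMF p W y :=
  Finset.sum_nonneg fun x _ => mul_nonneg (hp.1 x) ((hW x).1 y)

lemma sum_outputPMF {p : 𝒳 → ℝ} (hp : p ∈ stdSimplex ℝ 𝒳) {W : 𝒳 → 𝒴 → ℝ}
    (hW : ∀ x, W x ∈ stdSimplex ℝ 𝒴) : ∑ y, outputPMF p W y = 1 := by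
  simp only [outputPMF]
  rw [Finset.sum_comm]
  simp_rw [← Finset.mul_sum, (hW _).2, mul_one, hp.2]

lemma arcInt_nonneg (p : 𝒳 → ℝ) {W : 𝒳 → 𝒴 → ℝ} (hW : ∀ x, W x ∈ stdSimplex ℝ 𝒴) (y : 𝒴)
    {c s : ℝ} (hs : 0 ≤ s) : 0 ≤ arcInt p W y c s :=
  intervalIntegral.integral_nonneg (by linarith) fun _ _ => (hW _).1 y

lemma arcInt_one {p : 𝒳 → ℝ} (hp : p ∈ stdSimplex ℝ 𝒳) (W : 𝒳 → 𝒴 → ℝ) (y : 𝒴) (c : ℝ) :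
    arcInt p W y c 1 = outputPMF p W y := integral_circ_period hp _ c

lemma arcInt_add (p : 𝒳 → ℝ) (W : 𝒳 → 𝒴 → ℝ) (y : 𝒴) (c s s' : ℝ) :
    arcInt p W y c (s + s') = arcInt p W y c s + arcInt p W y (c + s) s' := by
  unfold arcInt
  rw [intervalIntegral.integral_add_adjacent_intervals (intervalIntegrable_circ p _ _ _)
    (intervalIntegrable_circ p _ _ _), add_assoc]

lemma arcInt_le_outputPMF {p : 𝒳 → ℝ} (hp : p ∈ stdSimplex ℝ 𝒳) {W : 𝒳 → 𝒴 → ℝ}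
    (hW : ∀ x, W x ∈ stdSimplex ℝ 𝒴) (y : 𝒴) {c s : ℝ} (hs : s ≤ 1) :
    arcInt p W y c s ≤ outputPMF p W y := by
  have h := arcInt_add p W y c s (1 - s)
  rw [add_sub_cancel, arcInt_one hp] at h
  have := arcInt_nonneg p hW y (c := c + s) (s := 1 - s) (by linarith)
  linarith

lemma continuous_arcInt (p : 𝒳 → ℝ) (W : 𝒳 → 𝒴 → ℝ) (y : 𝒴) :
    Continuous fun z : ℝ × ℝ => arcInt p W y z.1 z.2 := by
  have h : Continuous fun b => ∫ z in (0 : ℝ)..b, circ p (fun x => W x y) z :=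
    intervalIntegral.continuous_primitive (intervalIntegrable_circ p _) 0
  have : (fun z : ℝ × ℝ => arcInt p W y z.1 z.2) = fun z => 
      (∫ z in (0 : ℝ)..z.1 + z.2, circ p (fun x => W x y) z)
        - ∫ z in (0 : ℝ)..z.1, circ p (fun x => W x y) z := by
    funext z
    rw [intervalIntegral.integral_interval_sub_left (intervalIntegrable_circ p _ _ _)
      (intervalIntegrable_circ p _ _ _)]
    rfl
  rw [this]
  exact (h.comp (continuous_fst.add continuous_snd)).sub (h.comp continuous_fst)

lemma periodic_arcInt (p : 𝒳 → ℝ) (W : 𝒳 → 𝒴 → ℝ) (y : 𝒴) (s : ℝ) :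
    Function.Periodic (fun c => arcInt p W y c s) 1 := fun c => by
  simp only [arcInt]
  have := intervalIntegral.integral_comp_add_right (circ p fun x => W x y) 1
    (a := c) (b := c + s)
  rw [show c + 1 + s = c + s + 1 by ring, ← this]
  exact intervalIntegral.integral_congr fun z _ => periodic_circ p _ z

/-! ### Pseudo posterior probabilities -/

section LeftEdge

lemma leftEdge_eq_sum_range {N : ℕ} (s : Fin N → ℝ) (m : Fin N) :
    leftEdge s m = ∑ j ∈ Finset.range m, if h : j < N then s ⟨j, h⟩ else 0 := by
  unfold leftEdge
  refine Finset.sum_bij (fun a _ => (a : ℕ)) ?_ ?_ ?_ ?_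
  · intro a ha; simpa using ha
  · intro a _ b _ h; exact Fin.ext h
  · intro j hj
    have : j < m := Finset.mem_range.1 hj
    exact ⟨⟨j, this.trans m.2⟩, Finset.mem_filter.2 ⟨Finset.mem_univ _, this⟩, rfl⟩
  · intro a _; simp

/-- Telescoping over consecutive intervals. -/
lemma sum_sub_leftEdge {N : ℕ} (s : Fin N → ℝ) (F : ℝ → ℝ) :
    ∑ m, (F (leftEdge s m + s m) - F (leftEdge s m)) = F (∑ m, s m) - F 0 := by
  set s' : ℕ → ℝ := fun j => if h : j < N then s ⟨j, h⟩ else 0 with hs'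
  have h1 : ∀ m : Fin N, F (leftEdge s m + s m) - F (leftEdge s m)
      = (fun j : ℕ => F (∑ i ∈ Finset.range (j + 1), s' i) - F (∑ i ∈ Finset.range j, s' i)) m := by
    intro m
    simp only [Finset.sum_range_succ, leftEdge_eq_sum_range]
    simp [s']
  have h2 : ∑ m, s m = ∑ i ∈ Finset.range N, s' i := by
    rw [← Fin.sum_univ_eq_sum_range s' N]
    exact Finset.sum_congr rfl fun m _ => by rw [hs']; simp
  rw [Finset.sum_congr rfl fun m _ => h1 m,
    Fin.sum_univ_eq_sum_range (fun j : ℕ => F (∑ i ∈ Finset.range (j + 1), s' i)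
      - F (∑ i ∈ Finset.range j, s' i)) N, h2,
    Finset.sum_range_sub (fun j => F (∑ i ∈ Finset.range j, s' i)) N]
  simp

end LeftEdge

variable {p : 𝒳 → ℝ} {W : 𝒳 → 𝒴 → ℝ}

/-- The intervals are consecutive, so their masses telescope to that of one arc of length at most 1.
Only `≤` is available, because the sum vanishes for `N = 0` and after an output of probability 0
(division by zero). -/
lemma pseudoPost_nonneg_and_sum_le (hp : p ∈ stdSimplex ℝ 𝒳) (hW : ∀ x, W x ∈ stdSimplex ℝ 𝒴)
    (N : ℕ) : ∀ (i : ℕ) (y : Fin i → 𝒴) (u : Fin i → ℝ),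
    (∀ m, 0 ≤ pseudoPost p W N i y u m) ∧ ∑ m, pseudoPost p W N i y u m ≤ 1
  | 0, y, u => by
    refine ⟨fun m => by simp [pseudoPost], ?_⟩
    rcases Nat.eq_zero_or_pos N with h | h
    · subst h; simp
    · have : (N : ℝ) ≠ 0 := by positivity
      simp [pseudoPost, this]
  | i + 1, y, u => by
    obtain ⟨ih0, ih1⟩ := pseudoPost_nonneg_and_sum_le hp hW N i (fun j => y j.castSucc)
      (fun j => u j.castSucc)
    set s := pseudoPost p W N i (fun j => y j.castSucc) (fun j => u j.castSucc) with hs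
    have hle : ∀ m, s m ≤ 1 := fun m =>
      (Finset.single_le_sum (fun m _ => ih0 m) (Finset.mem_univ m)).trans ih1
    have hstep : ∀ m, pseudoPost p W N (i + 1) y u m
        = arcInt p W (y (Fin.last i)) (leftEdge s m + u (Fin.last i)) (s m)
          / outputPMF p W (y (Fin.last i)) := fun m => by
      rw [pseudoPost]
      exact posteriorMass_shiftedArc hp W _ (ih0 m) (hle m)
    refine ⟨fun m => ?_, ?_⟩
    · rw [hstep]
      exact div_nonneg (arcInt_nonneg p hW _ (ih0 m)) (outputPMF_nonneg hp hW _)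
    · simp_rw [hstep]
      rw [← Finset.sum_div]
      refine div_le_one_of_le₀ ?_ (outputPMF_nonneg hp hW _)
      set u' := u (Fin.last i)
      set y' := y (Fin.last i)
      have h1 : ∀ m, arcInt p W y' (leftEdge s m + u') (s m)
          = (fun b => arcInt p W y' u' b) (leftEdge s m + s m)
            - (fun b => arcInt p W y' u' b) (leftEdge s m) := fun m => by
        simp only [arcInt_add]
        rw [add_comm u']; ring
      rw [Finset.sum_congr rfl fun m _ => h1 m, sum_sub_leftEdge]
      have : arcInt p W y' u' 0 = 0 := by simp [arcInt]
      simp only [this, sub_zero]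
      exact arcInt_le_outputPMF hp hW y' ih1

variable {N : ℕ}

lemma pseudoPost_nonneg (hp : p ∈ stdSimplex ℝ 𝒳) (hW : ∀ x, W x ∈ stdSimplex ℝ 𝒴)
    {i : ℕ} (y : Fin i → 𝒴) (u : Fin i → ℝ) (m : Fin N) : 0 ≤ pseudoPost p W N i y u m :=
  (pseudoPost_nonneg_and_sum_le hp hW N i y u).1 m

lemma pseudoPost_le_one (hp : p ∈ stdSimplex ℝ 𝒳) (hW : ∀ x, W x ∈ stdSimplex ℝ 𝒴)
    {i : ℕ} (y : Fin i → 𝒴) (u : Fin i → ℝ) (m : Fin N) : pseudoPost p W N i y u m ≤ 1 :=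
  (Finset.single_le_sum (fun m _ => pseudoPost_nonneg hp hW y u m) (Finset.mem_univ m)).trans
    (pseudoPost_nonneg_and_sum_le hp hW N i y u).2

lemma pseudoPost_succ (hp : p ∈ stdSimplex ℝ 𝒳) (hW : ∀ x, W x ∈ stdSimplex ℝ 𝒴)
    {i : ℕ} (y : Fin (i + 1) → 𝒴) (u : Fin (i + 1) → ℝ) (m : Fin N) :
    pseudoPost p W N (i + 1) y u m
      = arcInt p W (y (Fin.last i))
          (leftEdge (pseudoPost p W N i (fun j => y j.castSucc) (fun j => u j.castSucc)) m
            + u (Fin.last i)) (pseudoPost p W N i (fun j => y j.castSucc) (fun j => u j.castSucc) m)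
        / outputPMF p W (y (Fin.last i)) := by
  rw [pseudoPost]
  exact posteriorMass_shiftedArc hp W _ (pseudoPost_nonneg hp hW _ _ m)
    (pseudoPost_le_one hp hW _ _ m)

lemma measurable_leftEdge {α : Type*} [MeasurableSpace α] {s : α → Fin N → ℝ}
    (h : ∀ m, Measurable fun a => s a m) (m : Fin N) : Measurable fun a => leftEdge (s a) m := by
  unfold leftEdge
  exact Finset.measurable_sum _ fun i _ => h i

lemma measurable_pseudoPost (hp : p ∈ stdSimplex ℝ 𝒳) (hW : ∀ x, W x ∈ stdSimplex ℝ 𝒴) :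
    ∀ (i : ℕ) (y : Fin i → 𝒴) (m : Fin N), Measurable fun u => pseudoPost p W N i y u m
  | 0, y, m => by simp only [pseudoPost]; exact measurable_const
  | i + 1, y, m => by
    have hr : Measurable fun (u : Fin (i + 1) → ℝ) => fun j : Fin i => u j.castSucc :=
      measurable_pi_lambda _ fun j => measurable_pi_apply _
    have ih : ∀ m', Measurable fun u : Fin (i + 1) → ℝ =>
        pseudoPost p W N i (fun j => y j.castSucc) (fun j => u j.castSucc) m' := fun m' =>
      (measurable_pseudoPost hp hW i (fun j => y j.castSucc) m').comp hr
    simp only [pseudoPost_succ hp hW]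
    refine Measurable.div_const ?_ _
    exact (continuous_arcInt p W (y (Fin.last i))).measurable.comp
      (((measurable_leftEdge ih m).add (measurable_pi_apply _)).prodMk (ih m))

end

section

/-! ### The selected input symbol -/

variable {p : 𝒳 → ℝ} {W : 𝒳 → 𝒴 → ℝ}

/-- The logarithm of the factor by which an interval placed on the arc `[c, c + s]` grows on
output `y`. -/
def logGrowth (p : 𝒳 → ℝ) (W : 𝒳 → 𝒴 → ℝ) (c s : ℝ) (y : 𝒴) : ℝ :=
  Real.log (arcInt p W y c s / (s * outputPMF p W y))

/-- The conditional expectation of `logGrowth` given the input symbol `x`. -/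
def gain (p : 𝒳 → ℝ) (W : 𝒳 → 𝒴 → ℝ) (c s : ℝ) (x : 𝒳) : ℝ :=
  ∑ y, W x y * logGrowth p W c s y

/-- All outputs that can follow `x` leave a positive mass on the arc `[c, c + s]`. -/
def Compatible (p : 𝒳 → ℝ) (W : 𝒳 → 𝒴 → ℝ) (c s : ℝ) (x : 𝒳) : Prop :=
  ∀ y, 0 < W x y → 0 < arcInt p W y c s

/-- `x` is a symbol of the arc `[c, c + s]` of maximal expected information gain. -/
structure OptimalSymbol (p : 𝒳 → ℝ) (W : 𝒳 → 𝒴 → ℝ) (c s : ℝ) (x : 𝒳) : Prop where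
  mem : ∃ z ∈ Set.Icc c (c + s), inputQuantile p (Int.fract z) = x
  compatible : Compatible p W c s x
  le : ∀ z ∈ Set.Icc c (c + s), Compatible p W c s (inputQuantile p (Int.fract z)) →
    gain p W c s (inputQuantile p (Int.fract z)) ≤ gain p W c s x

lemma EReal.coe_finsetSum {ι : Type*} (S : Finset ι) (f : ι → ℝ) :
    ((∑ i ∈ S, f i : ℝ) : EReal) = ∑ i ∈ S, (f i : EReal) := by
  classical
  induction S using Finset.induction_on with
  | empty => simp
  | insert a S ha ih => rw [Finset.sum_insert ha, Finset.sum_insert ha, EReal.coe_add, ih]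

lemma sum_mul_log_eq_coe {π a : 𝒴 → ℝ} (h : ∀ y, π y ≠ 0 → 0 < a y) :
    ∑ y, (π y : EReal) * ENNReal.log (ENNReal.ofReal (a y))
      = ((∑ y, π y * Real.log (a y) : ℝ) : EReal) := by
  rw [EReal.coe_finsetSum]
  refine Finset.sum_congr rfl fun y _ => ?_
  by_cases h0 : π y = 0
  · simp [h0]
  · rw [ENNReal.log_ofReal_of_pos (h y h0), EReal.coe_mul]

lemma sum_mul_log_eq_bot {π a : 𝒴 → ℝ} {y : 𝒴} (h : 0 < π y) (ha : a y ≤ 0) :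
    ∑ y, (π y : EReal) * ENNReal.log (ENNReal.ofReal (a y)) = ⊥ := by
  classical
  rw [← Finset.add_sum_erase _ _ (Finset.mem_univ y), ENNReal.ofReal_of_nonpos ha, ENNReal.log_zero,
    EReal.coe_mul_bot_of_pos h, EReal.bot_add]

lemma outputPMF_pos_of_arcInt_pos (hp : p ∈ stdSimplex ℝ 𝒳) (hW : ∀ x, W x ∈ stdSimplex ℝ 𝒴)
    {y : 𝒴} {c s : ℝ} (hs : s ≤ 1) (h : 0 < arcInt p W y c s) : 0 < outputPMF p W y :=
  h.trans_le (arcInt_le_outputPMF hp hW y hs)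

/-- If p(y|·) integrates to 0 over the arc, it vanishes almost everywhere on it. Compatibility is
tracked because `Real.log 0 = 0` would hide the value -∞ of the objective. -/
lemma ae_compatible (hW : ∀ x, W x ∈ stdSimplex ℝ 𝒴) {c s : ℝ} (hs : 0 ≤ s) :
    ∀ᵐ z ∂(volume.restrict (Set.Ioc c (c + s))),
      Compatible p W c s (inputQuantile p (Int.fract z)) := by
  unfold Compatible
  rw [ae_all_iff]
  intro y
  by_cases h : 0 < arcInt p W y c s
  · exact Eventually.of_forall fun z _ => h
  · have h0 : arcInt p W y c s = 0 := le_antisymm (not_lt.1 h) (arcInt_nonneg p hW y hs)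
    unfold arcInt at h0
    rw [intervalIntegral.integral_of_le (by linarith), setIntegral_eq_zero_iff_of_nonneg_ae
      (f := circ p fun x => W x y) (Eventually.of_forall fun z => (hW _).1 y)
      ((intervalIntegrable_iff_integrableOn_Ioc_of_le (by linarith)).1
        (intervalIntegrable_circ p _ _ _))] at h0
    filter_upwards [h0] with z hz hz'
    have hz1 : W (inputQuantile p (Int.fract z)) y = 0 := hz
    rw [hz1] at hz'
    exact absurd hz' (lt_irrefl _)

lemma exists_compatible (hW : ∀ x, W x ∈ stdSimplex ℝ 𝒴) {c s : ℝ} (hs : 0 < s) :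
    ∃ z ∈ Set.Icc c (c + s), Compatible p W c s (inputQuantile p (Int.fract z)) := by
  have h := ae_compatible (p := p) hW (c := c) hs.le
  rw [ae_restrict_iff' measurableSet_Ioc] at h
  by_contra hne
  push Not at hne
  have hsub : Set.Ioc c (c + s) ⊆ {z | ¬ (z ∈ Set.Ioc c (c + s) →
      Compatible p W c s (inputQuantile p (Int.fract z)))} := fun z hz hz' =>
    hne z (Set.Ioc_subset_Icc_self hz) (hz' hz)
  have := measure_mono_null hsub h
  rw [Real.volume_Ioc] at this
  simp at this
  linarith

lemma sum_mul_log_arcInt (hp : p ∈ stdSimplex ℝ 𝒳) (hW : ∀ x, W x ∈ stdSimplex ℝ 𝒴) {c s : ℝ}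
    (h0 : 0 < s) (hs : s ≤ 1) {x : 𝒳} (hx : Compatible p W c s x) :
    ∑ y, W x y * Real.log (arcInt p W y c s / outputPMF p W y)
      = Real.log s + gain p W c s x := by
  have h1 : Real.log s = ∑ y, W x y * Real.log s := by rw [← Finset.sum_mul, (hW x).2, one_mul]
  rw [h1, gain, ← Finset.sum_add_distrib]
  refine Finset.sum_congr rfl fun y _ => ?_
  rcases eq_or_lt_of_le ((hW x).1 y) with h | h
  · simp [← h]
  · have ha := hx y h
    have hpy := outputPMF_pos_of_arcInt_pos hp hW hs ha
    rw [← mul_add, logGrowth, ← Real.log_mul h0.ne' (by positivity)]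
    congr 2
    field_simp

/-- The encoder's choice is an optimal symbol. -/
lemma optimalSymbol_of_forall_le (hp : p ∈ stdSimplex ℝ 𝒳) (hW : ∀ x, W x ∈ stdSimplex ℝ 𝒴)
    {N i : ℕ} (m : Fin N) (y : Fin i → 𝒴) (u : Fin (i + 1) → ℝ) {v : ℝ}
    (hv : v ∈ Set.Icc (0 : ℝ) 1)
    (hmax : ∀ v' ∈ Set.Icc (0 : ℝ) 1,
      expectedLogPost p W m y u v' ≤ expectedLogPost p W m y u v)
    (hs : 0 < pseudoPost p W N i y (fun j => u j.castSucc) m) :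
    OptimalSymbol p W
      (leftEdge (pseudoPost p W N i y (fun j => u j.castSucc)) m + u (Fin.last i))
      (pseudoPost p W N i y (fun j => u j.castSucc) m) (inputSymbol p W m y u v) := by
  set s := pseudoPost p W N i y (fun j => u j.castSucc) m with hsdef
  set c := leftEdge (pseudoPost p W N i y (fun j => u j.castSucc)) m + u (Fin.last i) with hc
  have hs1 : s ≤ 1 := pseudoPost_le_one hp hW _ _ m
  have hpt : ∀ v', inputSymbol p W m y u v' = inputQuantile p (Int.fract (c + v' * s)) := by
    intro v'
    simp only [inputSymbol, point]
    congr 2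
    rw [hc, hsdef]; ring
  have hpost : ∀ y', pseudoPost p W N (i + 1) (Fin.snoc (α := fun _ => 𝒴) y y') u m
      = arcInt p W y' c s / outputPMF p W y' := by
    intro y'
    rw [pseudoPost_succ hp hW]
    simp only [Fin.snoc_castSucc, Fin.snoc_last]
    rfl
  have hfin : ∀ v', Compatible p W c s (inputSymbol p W m y u v') →
      expectedLogPost p W m y u v'
        = ((Real.log s + gain p W c s (inputSymbol p W m y u v') : ℝ) : EReal) := by
    intro v' hv'
    rw [← sum_mul_log_arcInt hp hW hs hs1 hv', expectedLogPost]
    simp only [hpost]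
    refine sum_mul_log_eq_coe fun y' hy' => ?_
    have h1 := hv' y' (lt_of_le_of_ne ((hW _).1 y') (Ne.symm hy'))
    exact div_pos h1 (outputPMF_pos_of_arcInt_pos hp hW hs1 h1)
  -- An incompatible symbol has objective -∞, so it never beats the compatible one that exists on
  -- every arc of positive length.
  have hbot : ∀ v', ¬ Compatible p W c s (inputSymbol p W m y u v') →
      expectedLogPost p W m y u v' = ⊥ := by
    intro v' hv'
    unfold Compatible at hv'
    push Not at hv'
    obtain ⟨y', h1, h2⟩ := hv'
    simp only [expectedLogPost, hpost]
    refine sum_mul_log_eq_bot h1 ?_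
    exact div_nonpos_of_nonpos_of_nonneg h2 (outputPMF_nonneg hp hW y')
  have hz : ∀ z ∈ Set.Icc c (c + s), ∃ v' ∈ Set.Icc (0 : ℝ) 1,
      inputSymbol p W m y u v' = inputQuantile p (Int.fract z) := by
    intro z hz
    refine ⟨(z - c) / s, ⟨div_nonneg (by linarith [hz.1]) hs.le,
      (div_le_one hs).2 (by linarith [hz.2])⟩, ?_⟩
    rw [hpt, div_mul_cancel₀ _ hs.ne']
    congr 2; ring
  have hcomp : Compatible p W c s (inputSymbol p W m y u v) := by
    obtain ⟨z, hzm, hzc⟩ := exists_compatible (p := p) hW (c := c) hs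
    obtain ⟨v', hv', hv'z⟩ := hz z hzm
    by_contra hcon
    have := hmax v' hv'
    rw [hbot v hcon, hfin v' (hv'z ▸ hzc)] at this
    exact absurd (le_bot_iff.1 this) (EReal.coe_ne_bot _)
  refine ⟨⟨c + v * s, ⟨?_, ?_⟩, (hpt v).symm⟩, hcomp, fun z hzm hzc => ?_⟩
  · have := mul_nonneg hv.1 hs.le; linarith
  · have := mul_le_mul_of_nonneg_right hv.2 hs.le; linarith
  · obtain ⟨v', hv', hv'z⟩ := hz z hzm
    have := hmax v' hv'
    rw [hfin v hcomp, hfin v' (hv'z ▸ hzc), EReal.coe_le_coe_iff, hv'z] at this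
    linarith

/-! ### Relative entropy bounds on the maximal gain -/

lemma arcInt_le_length (hW : ∀ x, W x ∈ stdSimplex ℝ 𝒴) (y : 𝒴) {c s : ℝ} (hs : 0 ≤ s) :
    arcInt p W y c s ≤ s := by
  unfold arcInt
  calc _ ≤ ∫ _z in c..c + s, (1 : ℝ) := by
        refine intervalIntegral.integral_mono_on (by linarith) (intervalIntegrable_circ p _ _ _)
          intervalIntegrable_const fun z _ => ?_
        have := (hW (inputQuantile p (Int.fract z)))
        exact (Finset.single_le_sum (fun y _ => this.1 y) (Finset.mem_univ y)).trans this.2.le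
    _ = s := by simp

lemma sum_arcInt (hW : ∀ x, W x ∈ stdSimplex ℝ 𝒴) (c s : ℝ) :
    ∑ y, arcInt p W y c s = s := by
  unfold arcInt
  rw [← intervalIntegral.integral_finsetSum fun y _ => intervalIntegrable_circ p _ _ _]
  simp only [circ, (hW _).2]
  simp

/-- The maximal gain is at least the average gain, which is a relative entropy. -/
lemma sum_arcInt_mul_logGrowth_le (hW : ∀ x, W x ∈ stdSimplex ℝ 𝒴) {c s : ℝ} (hs : 0 < s) {x : 𝒳}
    (hx : OptimalSymbol p W c s x) :
    ∑ y, arcInt p W y c s * logGrowth p W c s y ≤ s * gain p W c s x := by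
  have h1 : ∑ y, arcInt p W y c s * logGrowth p W c s y
      = ∫ z in c..c + s, circ p (gain p W c s) z := by
    unfold arcInt
    simp_rw [← intervalIntegral.integral_mul_const]
    rw [← intervalIntegral.integral_finsetSum fun y _ =>
      (intervalIntegrable_circ p _ _ _).mul_const _]
    rfl
  have h2 : s * gain p W c s x = ∫ z in c..c + s, gain p W c s x := by simp
  rw [h1, h2]
  refine intervalIntegral.integral_mono_ae_restrict (by linarith) (intervalIntegrable_circ p _ _ _)
    intervalIntegrable_const ?_
  rw [← restrict_Ioc_eq_restrict_Icc]
  filter_upwards [ae_compatible (p := p) hW hs.le, ae_restrict_mem measurableSet_Ioc] with z hz hzm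
  exact hx.le z (Set.Ioc_subset_Icc_self hzm) hz

/-- Applying ln t ≥ 1 - 1/t to t = √(a/b) leaves the surplus (√a - √b)², and (a-b)² =
(√a-√b)²(√a+√b)² ≤ 4(√a-√b)². Summed over two distributions this is a Pinsker-type inequality. -/
lemma mul_log_div_ge {a b : ℝ} (ha : 0 ≤ a) (ha1 : a ≤ 1) (hb : 0 ≤ b) (hb1 : b ≤ 1)
    (hab : b = 0 → a = 0) : a - b + (a - b) ^ 2 / 4 ≤ a * Real.log (a / b) := by
  rcases eq_or_lt_of_le hb with hb0 | hb0
  · simp [hab hb0.symm, ← hb0]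
  rcases eq_or_lt_of_le ha with ha0 | ha0
  · rw [← ha0]; simp; nlinarith
  set α := √a
  set β := √b
  have hα : 0 < α := Real.sqrt_pos.2 ha0
  have hβ : 0 < β := Real.sqrt_pos.2 hb0
  have hα2 : a = α ^ 2 := (Real.sq_sqrt ha).symm
  have hβ2 : b = β ^ 2 := (Real.sq_sqrt hb).symm
  have hα1 : α ≤ 1 := Real.sqrt_le_one.2 ha1
  have hβ1 : β ≤ 1 := Real.sqrt_le_one.2 hb1
  have hlog : 2 * (1 - β / α) ≤ Real.log (a / b) := by
    have : a / b = (α / β) ^ 2 := by rw [hα2, hβ2, div_pow]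
    rw [this, Real.log_pow]
    have := Real.one_sub_inv_le_log_of_pos (div_pos hα hβ)
    rw [inv_div] at this
    push_cast; linarith
  have h2 : a * (2 * (1 - β / α)) = 2 * α ^ 2 - 2 * α * β := by rw [hα2]; field_simp
  have h3 := mul_le_mul_of_nonneg_left hlog ha
  rw [h2] at h3
  have h4 : (a - b) ^ 2 / 4 ≤ (α - β) ^ 2 := by
    have : (a - b) ^ 2 = (α - β) ^ 2 * (α + β) ^ 2 := by rw [hα2, hβ2]; ring
    rw [this]
    have : (α + β) ^ 2 ≤ 4 := by nlinarith
    nlinarith [sq_nonneg (α - β)]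
  rw [hα2, hβ2] at h4 ⊢
  rw [hα2, hβ2] at h3
  nlinarith

/-- The squared distance of the average transition probability over the arc from the output pmf. -/
def arcDeviation (p : 𝒳 → ℝ) (W : 𝒳 → 𝒴 → ℝ) (s c : ℝ) : ℝ :=
  ∑ y, (arcInt p W y c s / s - outputPMF p W y) ^ 2

lemma outputPMF_le_one (hp : p ∈ stdSimplex ℝ 𝒳) (hW : ∀ x, W x ∈ stdSimplex ℝ 𝒴) (y : 𝒴) :
    outputPMF p W y ≤ 1 := by
  rw [← sum_outputPMF hp hW]
  exact Finset.single_le_sum (fun y _ => outputPMF_nonneg hp hW y) (Finset.mem_univ y)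

/-- The best symbol does at least as well as a uniform point of the arc, whose gain is the relative
entropy of the arc's average output law to p(y). -/
lemma arcDeviation_le_gain (hp : p ∈ stdSimplex ℝ 𝒳) (hW : ∀ x, W x ∈ stdSimplex ℝ 𝒴) {c s : ℝ}
    (h0 : 0 < s) (hs : s ≤ 1) {x : 𝒳} (hx : OptimalSymbol p W c s x) :
    arcDeviation p W s c / 4 ≤ gain p W c s x := by
  have h1 := sum_arcInt_mul_logGrowth_le hW h0 hx
  have h2 : ∑ y, (arcInt p W y c s / s - outputPMF p W y
      + (arcInt p W y c s / s - outputPMF p W y) ^ 2 / 4)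
      ≤ ∑ y, arcInt p W y c s / s * logGrowth p W c s y := by
    refine Finset.sum_le_sum fun y _ => ?_
    have := mul_log_div_ge (a := arcInt p W y c s / s) (b := outputPMF p W y)
      (div_nonneg (arcInt_nonneg p hW y h0.le) h0.le)
      ((div_le_one h0).2 (arcInt_le_length hW y h0.le)) (outputPMF_nonneg hp hW y)
      (outputPMF_le_one hp hW y) (fun h => by
        have := arcInt_le_outputPMF hp hW y (c := c) hs
        rw [h] at this
        rw [le_antisymm this (arcInt_nonneg p hW y h0.le), zero_div])
    rwa [div_div] at this
  rw [Finset.sum_add_distrib, Finset.sum_sub_distrib, ← Finset.sum_div, sum_arcInt hW,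
    sum_outputPMF hp hW, div_self h0.ne', sub_self, zero_add, ← Finset.sum_div] at h2
  have h3 : ∑ y, arcInt p W y c s / s * logGrowth p W c s y
      = (∑ y, arcInt p W y c s * logGrowth p W c s y) / s := by
    rw [Finset.sum_div]
    exact Finset.sum_congr rfl fun y _ => by ring
  rw [h3] at h2
  refine h2.trans ?_
  rw [div_le_iff₀ h0]; linarith

lemma gain_nonneg (hp : p ∈ stdSimplex ℝ 𝒳) (hW : ∀ x, W x ∈ stdSimplex ℝ 𝒴) {c s : ℝ}
    (h0 : 0 < s) (hs : s ≤ 1) {x : 𝒳} (hx : OptimalSymbol p W c s x) : 0 ≤ gain p W c s x :=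
  le_trans (by unfold arcDeviation; positivity) (arcDeviation_le_gain hp hW h0 hs hx)

end

/-! ### Bounds on the increments, and the gain of long arcs -/

section

variable {p : 𝒳 → ℝ} {W : 𝒳 → 𝒴 → ℝ}

lemma exists_pos_lower_bound {ι : Type*} [Fintype ι] (f : ι → ℝ) :
    ∃ π : ℝ, 0 < π ∧ π ≤ 1 ∧ ∀ i, 0 < f i → π ≤ f i := by
  classical
  by_cases h : (Finset.univ.filter fun i => 0 < f i).Nonempty
  · obtain ⟨i, hi, hmin⟩ := Finset.exists_min_image _ f h
    refine ⟨min (f i) 1, lt_min (by simpa using hi) one_pos, min_le_right _ _, fun j hj => ?_⟩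
    exact (min_le_left _ _).trans (hmin j (by simpa using hj))
  · refine ⟨1, one_pos, le_rfl, fun j hj => ?_⟩
    exact absurd ⟨j, by simpa using hj⟩ h

/-- The increments of the log pseudo posterior are at most proportional to `1 - s`. -/
lemma exists_abs_logGrowth_le (hp : p ∈ stdSimplex ℝ 𝒳) (hW : ∀ x, W x ∈ stdSimplex ℝ 𝒴) :
    ∃ B : ℝ, 1 ≤ B ∧ ∀ c s : ℝ, 0 < s → s ≤ 1 → ∀ x, OptimalSymbol p W c s x →
      ∀ y, 0 < W x y → |logGrowth p W c s y| ≤ B * (1 - s) := by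
  classical
  obtain ⟨π, hπ0, hπ1, hπ⟩ := exists_pos_lower_bound (outputPMF p W)
  obtain ⟨ω, hω0, hω1, hω⟩ := exists_pos_lower_bound fun z : 𝒳 × 𝒴 => W z.1 z.2
  refine ⟨2 / (π * ω), ?_, fun c s h0 hs x hx => ?_⟩
  · rw [le_div_iff₀ (by positivity)]; nlinarith
  have hup : ∀ y, 0 < W x y → logGrowth p W c s y ≤ 2 / π * (1 - s) := by
    intro y hy
    have ha := hx.compatible y hy
    have hb := outputPMF_pos_of_arcInt_pos hp hW hs ha
    have hr : 0 < arcInt p W y c s / (s * outputPMF p W y) := by positivity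
    have h1 : arcInt p W y c s / (s * outputPMF p W y) ≤ s⁻¹ := by
      rw [div_le_iff₀ (by positivity)]
      have := arcInt_le_outputPMF hp hW y (c := c) hs
      field_simp; exact this
    have h2 : arcInt p W y c s / (s * outputPMF p W y) ≤ π⁻¹ := by
      rw [div_le_iff₀ (by positivity)]
      have h3 := arcInt_le_length (p := p) hW y (c := c) h0.le
      have h4 := hπ y hb
      calc _ ≤ s := h3
        _ = π⁻¹ * (s * π) := by field_simp
        _ ≤ _ := by gcongr
    unfold logGrowth
    -- For long arcs the bound 1/s on the growth factor supplies the factor 1 - s; for short ones 1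
    -- - s > 1/2 and the constant bound 1/π is enough.
    by_cases hs2 : 1 / 2 ≤ s
    · have h5 : s⁻¹ - 1 ≤ 2 * (1 - s) := by
        have : s⁻¹ - 1 = (1 - s) / s := by field_simp
        rw [this, div_le_iff₀ h0]; nlinarith
      have h6 : 2 * (1 - s) ≤ 2 / π * (1 - s) := by
        refine mul_le_mul_of_nonneg_right ?_ (by linarith)
        rw [le_div_iff₀ hπ0]; linarith
      linarith [Real.log_le_sub_one_of_pos hr]
    · have h6 : π⁻¹ ≤ 2 / π * (1 - s) := by
        rw [div_mul_eq_mul_div, le_div_iff₀ hπ0, inv_mul_cancel₀ hπ0.ne']; linarith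
      linarith [Real.log_le_sub_one_of_pos hr]
  intro y hy
  have hBπ : 2 / π ≤ 2 / (π * ω) := by
    refine div_le_div_of_nonneg_left (by norm_num) (by positivity) ?_; nlinarith
  have h1s : 0 ≤ 1 - s := by linarith
  rw [abs_le]
  refine ⟨?_, (hup y hy).trans (mul_le_mul_of_nonneg_right hBπ h1s)⟩
  -- A very negative increment at one output, weighted by at least ω, could not be compensated by
  -- the other outputs, and the gain would be negative.
  have hg := gain_nonneg hp hW h0 hs hx
  rw [gain, ← Finset.add_sum_erase _ _ (Finset.mem_univ y)] at hg
  have hsum : ∑ y' ∈ Finset.univ.erase y, W x y' * logGrowth p W c s y' ≤ 2 / π * (1 - s) := by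
    calc _ ≤ ∑ y' ∈ Finset.univ.erase y, W x y' * (2 / π * (1 - s)) := by
          refine Finset.sum_le_sum fun y' _ => ?_
          rcases eq_or_lt_of_le ((hW x).1 y') with h | h
          · simp [← h]
          · exact mul_le_mul_of_nonneg_left (hup y' h) h.le
      _ = (∑ y' ∈ Finset.univ.erase y, W x y') * (2 / π * (1 - s)) := by rw [Finset.sum_mul]
      _ ≤ 1 * (2 / π * (1 - s)) := by
          refine mul_le_mul_of_nonneg_right ?_ (by positivity)
          rw [← (hW x).2]
          exact Finset.sum_le_sum_of_subset_of_nonneg (Finset.erase_subset _ _)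
            fun y _ _ => (hW x).1 y
      _ = _ := one_mul _
  have hwy := hω (x, y) hy
  simp only at hwy
  by_contra hlt
  rw [not_le] at hlt
  have h7 : W x y * logGrowth p W c s y < ω * -(2 / (π * ω) * (1 - s)) := by
    have : logGrowth p W c s y < 0 := hlt.trans_le (by
      have : 0 ≤ 2 / (π * ω) * (1 - s) := by positivity
      linarith)
    nlinarith
  have h8 : ω * -(2 / (π * ω) * (1 - s)) = -(2 / π * (1 - s)) := by field_simp
  linarith

/-- Second-order bound for the exponential moment of the increment at an optimal symbol. -/
lemma sum_mul_exp_logGrowth_le (hW : ∀ x, W x ∈ stdSimplex ℝ 𝒴) {c s B l : ℝ} {x : 𝒳}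
    (hs1 : 0 ≤ 1 - s) (hs : 0 ≤ s) (hB : 0 ≤ B)
    (hlog : ∀ y, 0 < W x y → |logGrowth p W c s y| ≤ B * (1 - s)) (hl : 0 ≤ l) (hlB : l * B ≤ 1) :
    ∑ y, W x y * Real.exp (-l * logGrowth p W c s y)
      ≤ 1 - l * gain p W c s x + l ^ 2 * B ^ 2 * (1 - s) ^ 2 := by
  have h : ∀ y, W x y * Real.exp (-l * logGrowth p W c s y)
      ≤ W x y * 1 - l * (W x y * logGrowth p W c s y)
        + W x y * (l ^ 2 * B ^ 2 * (1 - s) ^ 2) := by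
    intro y
    rcases eq_or_lt_of_le ((hW x).1 y) with h | h
    · simp [← h]
    have hb := hlog y h
    have habs : |-l * logGrowth p W c s y| ≤ l * B * (1 - s) := by
      rw [abs_mul, abs_neg, abs_of_nonneg hl, mul_assoc]
      exact mul_le_mul_of_nonneg_left hb hl
    have h1 : l * B * (1 - s) ≤ 1 := by
      have : 0 ≤ l * B := by positivity
      nlinarith
    have h2 := (abs_le.1 (Real.abs_exp_sub_one_sub_id_le (habs.trans h1))).2
    have h3 : (-l * logGrowth p W c s y) ^ 2 ≤ l ^ 2 * B ^ 2 * (1 - s) ^ 2 := by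
      rw [← sq_abs]
      calc _ ≤ (l * B * (1 - s)) ^ 2 := by gcongr
        _ = _ := by ring
    have h4 : Real.exp (-l * logGrowth p W c s y)
        ≤ 1 - l * logGrowth p W c s y + l ^ 2 * B ^ 2 * (1 - s) ^ 2 := by linarith
    have := mul_le_mul_of_nonneg_left h4 h.le
    linarith
  refine (Finset.sum_le_sum fun y _ => h y).trans (le_of_eq ?_)
  rw [Finset.sum_add_distrib, Finset.sum_sub_distrib, ← Finset.sum_mul, ← Finset.sum_mul,
    ← Finset.mul_sum, (hW x).2]
  simp [gain]

lemma cell_midpoint_mem (hp : p ∈ stdSimplex ℝ 𝒳) {x : 𝒳} (hx : 0 < p x) :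
    ∃ w ∈ Set.Ioo (0 : ℝ) 1, cellLeft p x < w ∧ w < inputCdf p x := by
  have h0 := cellLeft_nonneg hp x
  have h1 := inputCdf_le_one hp x
  have h2 : inputCdf p x = cellLeft p x + p x := by simp [cellLeft]
  exact ⟨cellLeft p x + p x / 2, ⟨by linarith, by linarith⟩, by linarith, by linarith⟩

/-- The log growth of an arc whose complement, of length ε, lies in the cell of `x'`, with ρ =
p(y|x')/p(y) and P = p(x'). Replacing ρ² by ρ/P makes the remainder linear in ρ, so that it can be
summed over the outputs. -/
lemma le_log_one_sub_div {P ε ρ s : ℝ} (hP : 0 < P) (hρ0 : 0 ≤ ρ) (hPρ : P * ρ ≤ 1)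
    (hερ : ε * ρ ≤ 1 / 2) (hsε : s = 1 - ε) (h0 : 0 < s) :
    ε * (1 - ρ) - 2 * ε ^ 2 * (ρ / P) ≤ Real.log ((1 - ε * ρ) / s) := by
  have h1 := Real.one_sub_inv_le_log_of_pos
    (x := (1 - ε * ρ) / s) (div_pos (by linarith) h0)
  refine le_trans ?_ h1
  rw [inv_div]
  have hd : 0 < 1 - ε * ρ := by linarith
  rw [show 1 - s / (1 - ε * ρ) = ε * (1 - ρ) / (1 - ε * ρ) by
    rw [hsε]; field_simp; ring, le_div_iff₀ hd]
  have h2 : ρ ^ 2 ≤ ρ / P := by rw [le_div_iff₀ hP]; nlinarith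
  have h3 := mul_le_mul_of_nonneg_left h2 (show 0 ≤ 2 * ε ^ 2 by positivity)
  have e1 : (ε * (1 - ρ) - 2 * ε ^ 2 * (ρ / P)) * (1 - ε * ρ)
      ≤ (ε * (1 - ρ) - 2 * ε ^ 2 * ρ ^ 2) * (1 - ε * ρ) :=
    mul_le_mul_of_nonneg_right (by linarith) hd.le
  have e2 : 0 ≤ ρ * (1 - 2 * (ε * ρ)) := mul_nonneg hρ0 (by linarith)
  have e3 : 0 ≤ ε ^ 2 * ρ * (1 + ρ * (1 - 2 * (ε * ρ))) :=
    mul_nonneg (by positivity) (by linarith)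
  have e4 : (ε * (1 - ρ) - 2 * ε ^ 2 * ρ ^ 2) * (1 - ε * ρ)
      = ε * (1 - ρ) - ε ^ 2 * ρ * (1 + ρ * (1 - 2 * (ε * ρ))) := by ring
  linarith

/-- The weight b - P a is the output law restricted to inputs other than `x'`. It turns the
first-order growth into the square (a-b)² plus a term in b - a that cancels in the sum over outputs.
-/
lemma weighted_growth_ge {P ε ρ a b : ℝ} (hP : 0 < P) (hb : 0 ≤ b) (hb1 : b ≤ 1) (hε0 : 0 ≤ ε)
    (hρ0 : 0 ≤ ρ) (ha : a = ρ * b) :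
    P * ε * (a - b) ^ 2 + ε * (b - a) * (1 - P) - 2 * ε ^ 2 / P * a
      ≤ (b - P * a) * (ε * (1 - ρ) - 2 * ε ^ 2 * (ρ / P)) := by
  have e6 : (b - P * a) * (ε * (1 - ρ) - 2 * ε ^ 2 * (ρ / P))
      = P * ε * (b * (1 - ρ) ^ 2) + ε * (b - a) * (1 - P) - 2 * ε ^ 2 / P * a
        + 2 * ε ^ 2 * a * ρ := by
    rw [ha]; field_simp; ring
  have e9 : (a - b) ^ 2 ≤ b * (1 - ρ) ^ 2 := by
    rw [ha, show (ρ * b - b) ^ 2 = b * (b * (1 - ρ) ^ 2) by ring]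
    exact mul_le_of_le_one_left (by positivity) hb1
  have e10 : P * ε * (a - b) ^ 2 ≤ P * ε * (b * (1 - ρ) ^ 2) :=
    mul_le_mul_of_nonneg_left e9 (by positivity)
  have e11 : 0 ≤ 2 * ε ^ 2 * a * ρ := by rw [ha]; positivity
  linarith

/-- If the complement of a long arc lies inside a cell of a symbol that is informative, then the
maximal gain is of the order of the length of the complement. -/
lemma gain_ge_of_complement_in_cell (hp : p ∈ stdSimplex ℝ 𝒳) (hW : ∀ x, W x ∈ stdSimplex ℝ 𝒴)
    {x' x : 𝒳} (hx' : 0 < p x') {c s : ℝ} (h0 : 0 < s) (hs : s ≤ 1)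
    (hl : cellLeft p x' < Int.fract (c + s)) (hr : Int.fract (c + s) + (1 - s) < inputCdf p x')
    (he1 : 1 - s ≤ p x' / 2)
    (he2 : 1 - s ≤ p x' ^ 2 * (∑ y, (W x' y - outputPMF p W y) ^ 2) / 4)
    (hx : OptimalSymbol p W c s x) :
    (1 - s) * (p x' * (∑ y, (W x' y - outputPMF p W y) ^ 2) / 2) ≤ gain p W c s x := by
  classical
  set ε := 1 - s with hε
  have hε0 : 0 ≤ ε := by linarith
  have harc : ArcInCell p (c + s) ε := ⟨x', hl, hr⟩
  have hq : inputQuantile p (Int.fract (c + s)) = x' :=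
    inputQuantile_eq_of_mem hp hl (by linarith)
  have hcomp : ∀ y, arcInt p W y c s = outputPMF p W y - ε * W x' y := by
    intro y
    have h := arcInt_add p W y c s ε
    have : arcInt p W y (c + s) ε = ε * W x' y := by
      unfold arcInt
      rw [intervalIntegral.integral_congr (g := fun _ => W x' y)]
      · simp
      · intro z hz
        rw [Set.uIcc_of_le (by linarith)] at hz
        simp only [circ]
        rw [harc.quantile_eq hp hz, hq]
    rw [show s + ε = 1 by rw [hε]; ring, arcInt_one hp, this] at h
    linarith
  have hpW : ∀ x y, p x * W x y ≤ outputPMF p W y := fun x y =>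
    Finset.single_le_sum (f := fun x => p x * W x y)
      (fun x _ => mul_nonneg (hp.1 x) ((hW x).1 y)) (Finset.mem_univ x)
  have hpos : ∀ y, 0 < outputPMF p W y → 0 < arcInt p W y c s := by
    intro y hy
    rw [hcomp]
    have h1 := hpW x' y
    have h2 := (hW x').1 y
    nlinarith
  have hg0 := gain_nonneg hp hW h0 hs hx
  -- The complement lies inside the cell of `x'`, so the arc contains the midpoint of every other
  -- cell of positive length; all those symbols compete in the maximization.
  have hle : ∀ x₂, x₂ ≠ x' → p x₂ * gain p W c s x₂ ≤ p x₂ * gain p W c s x := by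
    intro x₂ hne
    rcases eq_or_lt_of_le (hp.1 x₂) with h | h
    · simp [← h]
    obtain ⟨w, hw, hw1, hw2⟩ := cell_midpoint_mem hp h
    have hqw : inputQuantile p w = x₂ := inputQuantile_eq_of_mem hp hw1 hw2.le
    have hzf : Int.fract (c + Int.fract (w - c)) = w := by
      rw [Int.fract_eq_iff]
      refine ⟨hw.1.le, hw.2, -⌊w - c⌋, ?_⟩
      have := Int.fract_add_floor (w - c)
      push_cast; linarith
    have hz0 := Int.fract_nonneg (w - c)
    have hz1 := Int.fract_lt_one (w - c)
    refine mul_le_mul_of_nonneg_left ?_ h.le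
    have hmem : c + Int.fract (w - c) ∈ Set.Icc c (c + s) := by
      refine ⟨by linarith, ?_⟩
      by_contra hgt
      have := harc.quantile_eq hp (z := c + Int.fract (w - c))
        ⟨by linarith, by rw [hε]; linarith⟩
      rw [hzf, hqw, hq] at this
      exact hne this
    have := hx.le _ hmem
    rw [hzf, hqw] at this
    exact this fun y hy => hpos y (lt_of_lt_of_le (mul_pos h hy) (hpW x₂ y))
  have hsum : ∑ x₂ ∈ Finset.univ.erase x', p x₂ * gain p W c s x₂ ≤ gain p W c s x := by
    calc _ ≤ ∑ x₂ ∈ Finset.univ.erase x', p x₂ * gain p W c s x :=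
          Finset.sum_le_sum fun x₂ h₂ => hle x₂ (Finset.ne_of_mem_erase h₂)
      _ = (∑ x₂ ∈ Finset.univ.erase x', p x₂) * gain p W c s x := by rw [Finset.sum_mul]
      _ ≤ 1 * gain p W c s x := by
          refine mul_le_mul_of_nonneg_right ?_ hg0
          rw [← hp.2]
          exact Finset.sum_le_sum_of_subset_of_nonneg (Finset.erase_subset _ _)
            fun y _ _ => hp.1 y
      _ = _ := one_mul _
  have hident : ∑ x₂ ∈ Finset.univ.erase x', p x₂ * gain p W c s x₂
      = ∑ y, (outputPMF p W y - p x' * W x' y) * logGrowth p W c s y := by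
    have h1 : ∑ x₂, p x₂ * gain p W c s x₂ = ∑ y, outputPMF p W y * logGrowth p W c s y := by
      simp only [gain, outputPMF, Finset.mul_sum, Finset.sum_mul]
      rw [Finset.sum_comm]
      exact Finset.sum_congr rfl fun _ _ => Finset.sum_congr rfl fun _ _ => by ring
    rw [← Finset.add_sum_erase _ _ (Finset.mem_univ x')] at h1
    have h2 : p x' * gain p W c s x' = ∑ y, p x' * W x' y * logGrowth p W c s y := by
      rw [gain, Finset.mul_sum]
      exact Finset.sum_congr rfl fun _ _ => by ring
    simp only [sub_mul, Finset.sum_sub_distrib]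
    linarith
  have hterm : ∀ y, p x' * ε * (W x' y - outputPMF p W y) ^ 2
      + ε * (outputPMF p W y - W x' y) * (1 - p x') - 2 * ε ^ 2 / p x' * W x' y
      ≤ (outputPMF p W y - p x' * W x' y) * logGrowth p W c s y := by
    intro y
    rcases eq_or_lt_of_le (outputPMF_nonneg hp hW y) with h | h
    · have h1 := hpW x' y
      have h2 : W x' y = 0 := by
        rw [← h] at h1
        have := (hW x').1 y
        nlinarith
      simp [← h, h2]
    set b := outputPMF p W y
    set a := W x' y
    have ha0 : 0 ≤ a := (hW x').1 y
    have hb1 : b ≤ 1 := outputPMF_le_one hp hW y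
    have hpa : p x' * a ≤ b := hpW x' y
    set ρ := a / b with hρ
    have haρ : a = ρ * b := by rw [hρ]; field_simp
    have hρ0 : 0 ≤ ρ := by positivity
    have hpρ : p x' * ρ ≤ 1 := by
      rw [hρ, ← mul_div_assoc, div_le_one h]; exact hpa
    have hερ : ε * ρ ≤ 1 / 2 := by nlinarith
    have hlog : ε * (1 - ρ) - 2 * ε ^ 2 * (ρ / p x') ≤ logGrowth p W c s y := by
      have hrat : arcInt p W y c s / (s * b) = (1 - ε * ρ) / s := by
        rw [hcomp, show outputPMF p W y = b from rfl, show W x' y = a from rfl, haρ]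
        field_simp
      rw [logGrowth, show outputPMF p W y = b from rfl, hrat]
      exact le_log_one_sub_div hx' hρ0 hpρ hερ (by rw [hε]; ring) h0
    have h2 := mul_le_mul_of_nonneg_left hlog (show 0 ≤ b - p x' * a by linarith)
    exact (weighted_growth_ge hx' h.le hb1 hε0 hρ0 haρ).trans h2
  have htot := Finset.sum_le_sum fun y (_ : y ∈ Finset.univ) => hterm y
  rw [← hident, Finset.sum_sub_distrib, Finset.sum_add_distrib, ← Finset.mul_sum, ← Finset.mul_sum,
    ← Finset.sum_mul, ← Finset.mul_sum, Finset.sum_sub_distrib, (hW x').2, sum_outputPMF hp hW] at htot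
  set χ := ∑ y, (W x' y - outputPMF p W y) ^ 2
  -- The upper bound on 1 - s in `he2` lets half of the linear term absorb the quadratic remainder.
  have h1 : 2 * ε ^ 2 / p x' ≤ ε * (p x' * χ) / 2 := by
    rw [div_le_iff₀ hx']; nlinarith
  have h2 : p x' * ε * χ = ε * (p x' * χ) := by ring
  rw [h2] at htot
  linarith

end

section

variable {p : 𝒳 → ℝ} {W : 𝒳 → 𝒴 → ℝ}

/-! ### The drift of the pseudo posterior -/

/-- Otherwise every row of the support equals the output law, trivially so when `p` is a point mass,
and the mutual information vanishes. -/
lemma exists_informative_symbol (hp : p ∈ stdSimplex ℝ 𝒳) (hI : 0 < mutualInfo p W) :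
    ∃ x, 0 < p x ∧ p x < 1 ∧ 0 < ∑ y, (W x y - outputPMF p W y) ^ 2 := by
  by_contra hcon
  push Not at hcon
  have heq : ∀ x, 0 < p x → ∀ y, W x y = outputPMF p W y := by
    intro x hx
    by_cases h1 : p x < 1
    · have h2 := hcon x hx h1
      intro y
      have h3 := (Finset.sum_eq_zero_iff_of_nonneg (fun y _ => sq_nonneg _)).1
        (le_antisymm h2 (Finset.sum_nonneg fun y _ => sq_nonneg (W x y - outputPMF p W y)))
        y (Finset.mem_univ y)
      exact sub_eq_zero.1 (pow_eq_zero_iff two_ne_zero |>.1 h3)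
    · have h2 : ∀ x₂, x₂ ≠ x → p x₂ = 0 := by
        classical
        intro x₂ hne
        have h3 := hp.2
        rw [← Finset.add_sum_erase _ _ (Finset.mem_univ x)] at h3
        have h4 : p x₂ ≤ ∑ z ∈ Finset.univ.erase x, p z :=
          Finset.single_le_sum (fun z _ => hp.1 z) (Finset.mem_erase.2 ⟨hne, Finset.mem_univ _⟩)
        have := hp.1 x₂
        linarith
      have h5 : p x = 1 := by
        rw [← hp.2]; symm
        exact Finset.sum_eq_single x (fun b _ hb => h2 b hb) (by simp)
      intro y
      rw [outputPMF, Finset.sum_eq_single x (fun b _ hb => by rw [h2 b hb, zero_mul]) (by simp),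
        h5, one_mul]
  have : mutualInfo p W = 0 := by
    refine Finset.sum_eq_zero fun x _ => Finset.sum_eq_zero fun y _ => ?_
    rcases eq_or_lt_of_le (hp.1 x) with h | h
    · simp [← h]
    · rw [infoDensity, heq x h y]
      by_cases h0 : outputPMF p W y = 0
      · simp [h0]
      · simp [div_self h0]
  linarith

lemma arcInt_eq_of_arcInCell (hp : p ∈ stdSimplex ℝ 𝒳) (W : 𝒳 → 𝒴 → ℝ) (y : 𝒴) {c s : ℝ}
    (hs : 0 ≤ s) (h : ArcInCell p c s) :
    arcInt p W y c s = s * W (inputQuantile p (Int.fract c)) y := by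
  unfold arcInt
  rw [intervalIntegral.integral_congr (g := fun _ => W (inputQuantile p (Int.fract c)) y)]
  · simp
  · intro z hz
    rw [Set.uIcc_of_le (by linarith)] at hz
    simp only [circ]
    rw [h.quantile_eq hp hz]

/-- A rotation by less than a full turn moves part of a cell into another cell. -/
lemma exists_rotation_change (hp : p ∈ stdSimplex ℝ 𝒳) {x : 𝒳} (hx0 : 0 < p x) (hx1 : p x < 1)
    {s : ℝ} (h0 : 0 < s) (h1 : s < 1) :
    ∃ z δ : ℝ, 0 < δ ∧ ArcInCell p z δ ∧ ArcInCell p (z + s) δ ∧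
      inputQuantile p (Int.fract z) ≠ inputQuantile p (Int.fract (z + s)) := by
  set a := cellLeft p x with ha
  set b := inputCdf p x with hb
  have hab : b = a + p x := by simp [ha, hb, cellLeft]
  have ha0 : 0 ≤ a := cellLeft_nonneg hp x
  have hb1 : b ≤ 1 := inputCdf_le_one hp x
  -- A point of this interval lies in the cell (a, b), and after rotation by `s` it has left the
  -- cell on the right without coming round to it again.
  have hJ : max a (b - s) < min b (a + 1 - s) :=
    max_lt (lt_min (by linarith) (by linarith)) (lt_min (by linarith) (by linarith))
  -- Avoiding 1 - s keeps the rotated point away from 0, which lies in no half-open cell.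
  obtain ⟨z₁, hz₁, hz₁'⟩ := (Set.Ioo_infinite hJ).exists_notMem_finset {1 - s}
  obtain ⟨hl, hr⟩ := hz₁
  rw [max_lt_iff] at hl
  rw [lt_min_iff] at hr
  have hne : z₁ + s ≠ 1 := fun h => hz₁' (by simp; linarith)
  set w := Int.fract (z₁ + s) with hw
  have hw1 : w < 1 := Int.fract_lt_one _
  have hcase : (z₁ + s < 1 ∧ w = z₁ + s) ∨ (1 < z₁ + s ∧ w = z₁ + s - 1) := by
    rcases lt_or_gt_of_ne hne with h | h
    · exact Or.inl ⟨h, Int.fract_eq_self.2 ⟨by linarith, h⟩⟩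
    · refine Or.inr ⟨h, ?_⟩
      rw [hw, Int.fract_eq_iff]
      exact ⟨by linarith, by linarith, 1, by push_cast; ring⟩
  have hw0 : 0 < w := by rcases hcase with h | h <;> linarith [h.1, h.2]
  set x₂ := inputQuantile p w with hx₂
  have hcell := (inputQuantile_eq_iff hp hw0 hw1.le x₂).1 rfl
  have hxne : x ≠ x₂ := by
    intro heq
    rw [← heq] at hcell
    have h2 : a < w := hcell.1
    have h3 : w ≤ b := hcell.2
    rcases hcase with h | h <;> linarith [h.1, h.2]
  -- Cells are closed on the right, so the rotated point may be an endpoint; moving both points left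
  -- by δ leaves room on both sides for arcs of length δ/2.
  obtain ⟨δ, hδ0, hδ⟩ := exists_between (lt_min (sub_pos.2 hl.1) (sub_pos.2 hcell.1))
  rw [lt_min_iff] at hδ
  have hL2 := cellLeft_nonneg hp x₂
  have hf1 : Int.fract (z₁ - δ) = z₁ - δ := Int.fract_eq_self.2 ⟨by linarith, by linarith⟩
  have hf2 : Int.fract (z₁ - δ + s) = w - δ := by
    have := Int.fract_add_floor (z₁ + s)
    rw [Int.fract_eq_iff]
    exact ⟨by linarith, by linarith, ⌊z₁ + s⌋, by linarith⟩
  refine ⟨z₁ - δ, δ / 2, by linarith, ⟨x, ?_, ?_⟩, ⟨x₂, ?_, ?_⟩, ?_⟩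
  · rw [hf1]; linarith
  · rw [hf1]; linarith
  · rw [hf2]; linarith
  · rw [hf2]; linarith [hcell.2]
  · rw [hf1, hf2, inputQuantile_eq_of_mem hp (x := x) (by linarith) (by linarith),
      inputQuantile_eq_of_mem hp (x := x₂) (by linarith) (by linarith [hcell.2])]
    exact hxne

/-- `arcDeviation` scaled by the squared length of the arc. -/
def scaledDeviation (p : 𝒳 → ℝ) (W : 𝒳 → 𝒴 → ℝ) (s c : ℝ) : ℝ :=
  ∑ y, (arcInt p W y c s - s * outputPMF p W y) ^ 2

lemma scaledDeviation_nonneg (p : 𝒳 → ℝ) (W : 𝒳 → 𝒴 → ℝ) (s c : ℝ) :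
    0 ≤ scaledDeviation p W s c := Finset.sum_nonneg fun _ _ => sq_nonneg _

lemma continuous_scaledDeviation (p : 𝒳 → ℝ) (W : 𝒳 → 𝒴 → ℝ) :
    Continuous fun z : ℝ × ℝ => scaledDeviation p W z.1 z.2 := by
  refine continuous_finsetSum _ fun y _ => Continuous.pow (Continuous.sub ?_ ?_) 2
  · exact (continuous_arcInt p W y).comp (continuous_snd.prodMk continuous_fst)
  · exact continuous_fst.mul continuous_const

lemma continuous_scaledDeviation_right (p : 𝒳 → ℝ) (W : 𝒳 → 𝒴 → ℝ) (s : ℝ) :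
    Continuous (scaledDeviation p W s) :=
  Continuous.comp (g := fun z : ℝ × ℝ => scaledDeviation p W z.1 z.2) (f := fun c : ℝ => (s, c))
    (continuous_scaledDeviation p W) (by fun_prop)

lemma scaledDeviation_le (p : 𝒳 → ℝ) (W : 𝒳 → 𝒴 → ℝ) {s : ℝ} (h0 : 0 < s) (h1 : s ≤ 1) (c : ℝ) :
    scaledDeviation p W s c ≤ arcDeviation p W s c := by
  refine Finset.sum_le_sum fun y _ => ?_
  have : (arcInt p W y c s - s * outputPMF p W y) ^ 2
      = s ^ 2 * (arcInt p W y c s / s - outputPMF p W y) ^ 2 := by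
    rw [← mul_pow]; congr 1; field_simp
  rw [this]
  exact mul_le_of_le_one_left (sq_nonneg _) (pow_le_one₀ h0.le h1)

/-- If the integral vanished, all arcs of length `s` would have the same output masses. Sliding such
an arc by δ would then remove and add equal masses, so p(y|·) would agree on two cells exchanged by
the rotation, and two distinct rows would coincide. -/
lemma integral_scaledDeviation_pos (hp : p ∈ stdSimplex ℝ 𝒳) (hred : NoRedundantInputs W) {x : 𝒳}
    (hx0 : 0 < p x) (hx1 : p x < 1) {s : ℝ} (h0 : 0 < s) (h1 : s < 1) :
    0 < ∫ c in (0 : ℝ)..1, scaledDeviation p W s c := by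
  have hcont : Continuous (scaledDeviation p W s) :=
    continuous_scaledDeviation_right p W s
  refine intervalIntegral.integral_pos one_pos hcont.continuousOn
    (fun c _ => scaledDeviation_nonneg p W s c) ?_
  by_contra hcon
  push Not at hcon
  have hall : ∀ c y, arcInt p W y c s = s * outputPMF p W y := by
    intro c y
    have h2 := hcon (Int.fract c) ⟨Int.fract_nonneg c, (Int.fract_lt_one c).le⟩
    have h3 := (Finset.sum_eq_zero_iff_of_nonneg (fun y _ => sq_nonneg
      (arcInt p W y (Int.fract c) s - s * outputPMF p W y))).1
        (le_antisymm h2 (scaledDeviation_nonneg p W s _)) y (Finset.mem_univ y)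
    have h4 : arcInt p W y (Int.fract c) s = arcInt p W y c s := by
      have := (periodic_arcInt p W y s).sub_int_mul_eq ⌊c⌋ (x := c)
      simpa [Int.self_sub_floor] using this
    rw [← h4]
    exact sub_eq_zero.1 (pow_eq_zero_iff two_ne_zero |>.1 h3)
  obtain ⟨z, δ, hδ, hc1, hc2, hne⟩ := exists_rotation_change hp hx0 hx1 h0 h1
  obtain ⟨y, hy⟩ := hred _ _ hne
  have e1 := arcInt_add p W y z δ s
  have e2 := arcInt_add p W y z s δ
  rw [add_comm δ s, e2, arcInt_eq_of_arcInCell hp W y hδ.le hc1,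
    arcInt_eq_of_arcInCell hp W y hδ.le hc2, hall, hall] at e1
  exact hy (mul_left_cancel₀ hδ.ne' (by linarith))

/-- The expected increment of the log pseudo posterior is at least of the order of `1 - s`. -/
lemma exists_drift_lower_bound (hp : p ∈ stdSimplex ℝ 𝒳) (hW : ∀ x, W x ∈ stdSimplex ℝ 𝒴)
    (hred : NoRedundantInputs W) (hI : 0 < mutualInfo p W) {η : ℝ} (hη : 0 < η) :
    ∃ κ : ℝ, 0 < κ ∧ ∀ s, η ≤ s → s ≤ 1 → ∃ H : ℝ → ℝ, ∃ C : ℝ, Measurable H ∧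
      Function.Periodic H 1 ∧ (∀ c, |H c| ≤ C) ∧
      (∀ c x, OptimalSymbol p W c s x → H c ≤ gain p W c s x) ∧
      κ * (1 - s) ≤ ∫ c in (0 : ℝ)..1, H c := by
  classical
  obtain ⟨x', hx0, hx1, hχ⟩ := exists_informative_symbol hp hI
  set χ := ∑ y, (W x' y - outputPMF p W y) ^ 2
  -- These are the two smallness conditions on 1 - s in `gain_ge_of_complement_in_cell`.
  set ε₀ := min (p x' / 2) (p x' ^ 2 * χ / 4) with hε₀
  have hε₀pos : 0 < ε₀ := lt_min (by linarith) (by positivity)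
  have hmid : ∃ κ : ℝ, 0 < κ ∧ ∀ s, η ≤ s → s ≤ 1 - ε₀ →
      κ ≤ ∫ c in (0 : ℝ)..1, scaledDeviation p W s c := by
    by_cases hne : η ≤ 1 - ε₀
    · have hcont : Continuous fun s => ∫ c in (0 : ℝ)..1, scaledDeviation p W s c :=
        intervalIntegral.continuous_parametric_intervalIntegral_of_continuous'
          (continuous_scaledDeviation p W) 0 1
      obtain ⟨s₀, hs₀, hmin⟩ := isCompact_Icc.exists_isMinOn (Set.nonempty_Icc.2 hne)
        hcont.continuousOn
      refine ⟨_, integral_scaledDeviation_pos hp hred hx0 hx1 (hη.trans_le hs₀.1)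
        (by linarith [hs₀.2]), fun s hs1 hs2 => hmin ⟨hs1, hs2⟩⟩
    · exact ⟨1, one_pos, fun s h1 h2 => absurd (h1.trans h2) hne⟩
  obtain ⟨κ₁, hκ₁, hmid⟩ := hmid
  -- The 1/4 is that of `arcDeviation_le_gain`. In the other constant, p(x')χ/2 is the gain per unit
  -- of 1 - s, and p(x')/2 bounds from below the measure of the shifts that put the complement
  -- inside the cell of `x'`.
  refine ⟨min (κ₁ / 4) (p x' * χ / 2 * (p x' / 2)), lt_min (by linarith) (by positivity),
    fun s hηs hs1 => ?_⟩
  have hs0 : 0 < s := hη.trans_le hηs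
  have h1s : 0 ≤ 1 - s := by linarith
  by_cases hcase : s ≤ 1 - ε₀
  · have hcont : Continuous (scaledDeviation p W s) :=
      continuous_scaledDeviation_right p W s
    have hper : Function.Periodic (scaledDeviation p W s) 1 := fun c => by
      unfold scaledDeviation
      refine Finset.sum_congr rfl fun y _ => ?_
      have : arcInt p W y (c + 1) s = arcInt p W y c s := periodic_arcInt p W y s c
      rw [this]
    obtain ⟨C, hC⟩ := (hper.isBounded_of_continuous one_ne_zero hcont).exists_norm_le
    refine ⟨fun c => scaledDeviation p W s c / 4, C / 4, hcont.measurable.div_const _,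
      fun c => by simp only [hper c], fun c => ?_, fun c x hx => ?_, ?_⟩
    · have := hC _ (Set.mem_range_self c)
      rw [Real.norm_eq_abs] at this
      rw [abs_div]; norm_num; linarith
    · have h1 := arcDeviation_le_gain hp hW hs0 hs1 hx
      have h2 := scaledDeviation_le p W hs0 hs1 c
      linarith
    · rw [intervalIntegral.integral_div]
      have h1 := hmid s hηs hcase
      calc _ ≤ κ₁ / 4 * 1 := by
            refine mul_le_mul (min_le_left _ _) (by linarith) h1s (by linarith)
        _ ≤ _ := by linarith
  · have hε : 1 - s ≤ ε₀ := by linarith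
    set A : Set ℝ := {c | cellLeft p x' < Int.fract c ∧ Int.fract c + (1 - s) < inputCdf p x'}
      with hA
    have hAm : MeasurableSet A := (measurableSet_lt measurable_const measurable_fract).inter
      (measurableSet_lt (measurable_fract.add_const _) measurable_const)
    set k := (1 - s) * (p x' * χ / 2) with hk
    have hk0 : 0 ≤ k := by positivity
    have hper : Function.Periodic (A.indicator fun _ => k) 1 := fun c => by
      have : c + 1 ∈ A ↔ c ∈ A := by simp [hA]
      by_cases hc : c ∈ A
      · rw [Set.indicator_of_mem hc, Set.indicator_of_mem (this.2 hc)]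
      · rw [Set.indicator_of_notMem hc, Set.indicator_of_notMem (mt this.1 hc)]
    refine ⟨fun c => A.indicator (fun _ => k) (s + c), k,
      (measurable_const.indicator hAm).comp (measurable_const.add measurable_id),
      fun c => by beta_reduce; rw [← hper (s + c), add_assoc], fun c => ?_, fun c x hx => ?_, ?_⟩
    · beta_reduce
      by_cases hc : s + c ∈ A
      · rw [Set.indicator_of_mem hc, abs_of_nonneg hk0]
      · rw [Set.indicator_of_notMem hc, abs_zero]; exact hk0
    · beta_reduce
      by_cases hc : s + c ∈ A
      · rw [Set.indicator_of_mem hc]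
        rw [add_comm] at hc
        exact gain_ge_of_complement_in_cell hp hW hx0 hs0 hs1 hc.1 hc.2
          (hε.trans (min_le_left _ _)) (hε.trans (min_le_right _ _)) hx
      · rw [Set.indicator_of_notMem hc]
        exact gain_nonneg hp hW hs0 hs1 hx
    · rw [integral_shift_of_periodic hper]
      have hab : inputCdf p x' = cellLeft p x' + p x' := by simp [cellLeft]
      have hhalf : 1 - s ≤ p x' / 2 := hε.trans (min_le_left _ _)
      have hsub : Set.Ioo (cellLeft p x') (inputCdf p x' - (1 - s)) ⊆ A ∩ Set.Ioc 0 1 := by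
        intro w hw
        have h2 := cellLeft_nonneg hp x'
        have h3 := inputCdf_le_one hp x'
        have hw0 : 0 < w := by linarith [hw.1]
        have hw1 : w < 1 := by linarith [hw.2]
        refine ⟨?_, hw0, hw1.le⟩
        rw [hA, Set.mem_ofPred_eq, Int.fract_eq_self.2 ⟨hw0.le, hw1⟩]
        exact ⟨hw.1, by linarith [hw.2]⟩
      rw [intervalIntegral.integral_of_le zero_le_one, integral_indicator hAm,
        Measure.restrict_restrict hAm, integral_const, smul_eq_mul, Measure.real,
        Measure.restrict_apply_univ]
      have hvol : p x' / 2 ≤ (volume (A ∩ Set.Ioc 0 1)).toReal := by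
        have h4 : (volume (Set.Ioo (cellLeft p x') (inputCdf p x' - (1 - s)))).toReal
            = p x' - (1 - s) := by
          rw [Real.volume_Ioo, ENNReal.toReal_ofReal (by linarith), hab]; ring
        have h5 := ENNReal.toReal_mono
          ((measure_mono Set.inter_subset_right).trans_lt
            (by rw [Real.volume_Ioc]; exact ENNReal.ofReal_lt_top)).ne (measure_mono hsub)
        rw [h4] at h5
        linarith
      calc _ ≤ p x' * χ / 2 * (p x' / 2) * (1 - s) :=
            mul_le_mul_of_nonneg_right (min_le_right _ _) h1s
        _ = p x' / 2 * k := by rw [hk]; ring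
        _ ≤ _ := mul_le_mul_of_nonneg_right hvol hk0

end

section

variable {p : 𝒳 → ℝ} {W : 𝒳 → 𝒴 → ℝ}

/-! ### Exponential moments of the information density -/

/-- `E[(p(Y|x) / p(Y))^β | X = x]`. -/
def rowMoment (p : 𝒳 → ℝ) (W : 𝒳 → 𝒴 → ℝ) (β : ℝ) (x : 𝒳) : ℝ :=
  ∑ y, W x y * Real.exp (β * infoDensity p W x y)

/-- `E[(p(Y|X) / p(Y))^β]`. -/
def expMoment (p : 𝒳 → ℝ) (W : 𝒳 → 𝒴 → ℝ) (β : ℝ) : ℝ := ∑ x, p x * rowMoment p W β x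

lemma expMoment_eq_sum (p : 𝒳 → ℝ) (W : 𝒳 → 𝒴 → ℝ) (β : ℝ) :
    expMoment p W β = ∑ x, ∑ y, p x * W x y * Real.exp (β * infoDensity p W x y) := by
  unfold expMoment rowMoment
  refine Finset.sum_congr rfl fun x _ => ?_
  rw [Finset.mul_sum]
  exact Finset.sum_congr rfl fun y _ => by ring

lemma sum_joint (hp : p ∈ stdSimplex ℝ 𝒳) (hW : ∀ x, W x ∈ stdSimplex ℝ 𝒴) :
    ∑ x, ∑ y, p x * W x y = 1 := by
  simp_rw [← Finset.mul_sum, (hW _).2, mul_one, hp.2]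

lemma rowMoment_nonneg (hW : ∀ x, W x ∈ stdSimplex ℝ 𝒴) (β : ℝ) (x : 𝒳) :
    0 ≤ rowMoment p W β x :=
  Finset.sum_nonneg fun y _ => mul_nonneg ((hW x).1 y) (Real.exp_pos _).le

lemma one_add_mul_mutualInfo_le (hp : p ∈ stdSimplex ℝ 𝒳) (hW : ∀ x, W x ∈ stdSimplex ℝ 𝒴)
    (β : ℝ) : 1 + β * mutualInfo p W ≤ expMoment p W β := by
  rw [expMoment_eq_sum, ← sum_joint hp hW, mutualInfo, Finset.mul_sum, ← Finset.sum_add_distrib]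
  refine Finset.sum_le_sum fun x _ => ?_
  rw [Finset.mul_sum, ← Finset.sum_add_distrib]
  refine Finset.sum_le_sum fun y _ => ?_
  have h := mul_le_mul_of_nonneg_left (Real.add_one_le_exp (β * infoDensity p W x y))
    (mul_nonneg (hp.1 x) ((hW x).1 y))
  linarith

lemma expMoment_pos (hp : p ∈ stdSimplex ℝ 𝒳) (hW : ∀ x, W x ∈ stdSimplex ℝ 𝒴) (β : ℝ) :
    0 < expMoment p W β := by
  by_contra hcon
  have h0 : ∀ x ∈ Finset.univ, ∀ y ∈ Finset.univ, p x * W x y = 0 := by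
    have hnn : ∀ x y, 0 ≤ p x * W x y := fun x y => mul_nonneg (hp.1 x) ((hW x).1 y)
    rw [expMoment_eq_sum] at hcon
    have h1 := le_antisymm (not_lt.1 hcon) (Finset.sum_nonneg fun x _ => Finset.sum_nonneg
      fun y _ => mul_nonneg (hnn x y) (Real.exp_pos _).le)
    intro x hx y hy
    have h2 := (Finset.sum_eq_zero_iff_of_nonneg (fun x _ => Finset.sum_nonneg
      fun y _ => mul_nonneg (hnn x y) (Real.exp_pos _).le)).1 h1 x hx
    have h3 := (Finset.sum_eq_zero_iff_of_nonneg
      fun y _ => mul_nonneg (hnn x y) (Real.exp_pos _).le).1 h2 y hy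
    exact (mul_eq_zero.1 h3).resolve_right (Real.exp_pos _).ne'
  have := sum_joint hp hW
  rw [Finset.sum_eq_zero fun x hx => Finset.sum_eq_zero fun y hy => h0 x hx y hy] at this
  norm_num at this

/-- A bound on the absolute value of the information density. -/
def infoBound (p : 𝒳 → ℝ) (W : 𝒳 → 𝒴 → ℝ) : ℝ := 1 + ∑ x, ∑ y, |infoDensity p W x y|

lemma one_le_infoBound (p : 𝒳 → ℝ) (W : 𝒳 → 𝒴 → ℝ) : 1 ≤ infoBound p W := by
  have : 0 ≤ ∑ x, ∑ y, |infoDensity p W x y| := by positivity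
  unfold infoBound; linarith

lemma abs_infoDensity_le (p : 𝒳 → ℝ) (W : 𝒳 → 𝒴 → ℝ) (x : 𝒳) (y : 𝒴) :
    |infoDensity p W x y| ≤ infoBound p W := by
  have h1 : |infoDensity p W x y| ≤ ∑ y, |infoDensity p W x y| :=
    Finset.single_le_sum (f := fun y => |infoDensity p W x y|) (fun _ _ => abs_nonneg _)
      (Finset.mem_univ y)
  have h2 : ∑ y, |infoDensity p W x y| ≤ ∑ x, ∑ y, |infoDensity p W x y| :=
    Finset.single_le_sum (f := fun x => ∑ y, |infoDensity p W x y|)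
      (fun _ _ => Finset.sum_nonneg fun _ _ => abs_nonneg _) (Finset.mem_univ x)
  unfold infoBound; linarith

/-- With the tangent bound `one_add_mul_mutualInfo_le` this places 1 - M(-l) between lI/2 and lI for
small `l`. -/
lemma expMoment_neg_le (hp : p ∈ stdSimplex ℝ 𝒳) (hW : ∀ x, W x ∈ stdSimplex ℝ 𝒴) {l : ℝ}
    (hl : 0 ≤ l) (hlD : l * infoBound p W ≤ 1) :
    expMoment p W (-l) ≤ 1 - l * mutualInfo p W + l ^ 2 * infoBound p W ^ 2 := by
  have hD := one_le_infoBound p W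
  have h1 : 1 - l * mutualInfo p W + l ^ 2 * infoBound p W ^ 2
      = ∑ x, ∑ y, p x * W x y * (1 - l * infoDensity p W x y + l ^ 2 * infoBound p W ^ 2) := by
    have e : ∀ x y, p x * W x y * (1 - l * infoDensity p W x y + l ^ 2 * infoBound p W ^ 2)
        = p x * W x y * (1 + l ^ 2 * infoBound p W ^ 2)
          - l * (p x * W x y * infoDensity p W x y) := fun x y => by ring
    simp only [e, Finset.sum_sub_distrib, ← Finset.mul_sum, ← Finset.sum_mul]
    simp only [(hW _).2, mul_one, hp.2]
    rw [mutualInfo]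
    ring
  rw [expMoment_eq_sum, h1]
  refine Finset.sum_le_sum fun x _ => Finset.sum_le_sum fun y _ => ?_
  refine mul_le_mul_of_nonneg_left ?_ (mul_nonneg (hp.1 x) ((hW x).1 y))
  have habs : |-l * infoDensity p W x y| ≤ l * infoBound p W := by
    rw [abs_mul, abs_neg, abs_of_nonneg hl]
    exact mul_le_mul_of_nonneg_left (abs_infoDensity_le p W x y) hl
  have h2 := (abs_le.1 (Real.abs_exp_sub_one_sub_id_le (habs.trans hlD))).2
  have h3 : (-l * infoDensity p W x y) ^ 2 ≤ l ^ 2 * infoBound p W ^ 2 := by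
    rw [← sq_abs, ← mul_pow]
    gcongr
  linarith

/-! ### The one-step contraction -/

lemma logGrowth_eq_of_arcInCell (hp : p ∈ stdSimplex ℝ 𝒳) (W : 𝒳 → 𝒴 → ℝ) (y : 𝒴) {c s : ℝ}
    (hs : 0 < s) (h : ArcInCell p c s) :
    logGrowth p W c s y = infoDensity p W (inputQuantile p (Int.fract c)) y := by
  rw [logGrowth, arcInt_eq_of_arcInCell hp W y hs.le h, mul_div_mul_left _ _ hs.ne', infoDensity]

lemma OptimalSymbol.eq_of_arcInCell (hp : p ∈ stdSimplex ℝ 𝒳) {c s : ℝ} {x : 𝒳}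
    (hx : OptimalSymbol p W c s x) (h : ArcInCell p c s) :
    x = inputQuantile p (Int.fract c) := by
  obtain ⟨z, hz, rfl⟩ := hx.mem
  exact h.quantile_eq hp hz

/-- On an arc that may straddle a cell boundary, the exponential moment of the increment differs
little from the one of the information density. -/
lemma sum_mul_exp_le_rowMoment_add (hp : p ∈ stdSimplex ℝ 𝒳) (hW : ∀ x, W x ∈ stdSimplex ℝ 𝒴)
    {c s B l : ℝ} {x : 𝒳} (hs0 : 0 < s) (hs : s ≤ 1) (hx : OptimalSymbol p W c s x) (hB : 0 ≤ B)
    (hlog : ∀ y, 0 < W x y → |logGrowth p W c s y| ≤ B * (1 - s)) (hl : 0 ≤ l) (hlB : l * B ≤ 1) :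
    ∑ y, W x y * Real.exp (-l * logGrowth p W c s y)
      ≤ circ p (rowMoment p W (-l)) c + l * (B + infoBound p W) * straddle p s c := by
  by_cases h : ArcInCell p c s
  · have : straddle p s c = 0 := if_pos h
    rw [this, mul_zero, add_zero, circ, rowMoment, ← hx.eq_of_arcInCell hp h]
    refine le_of_eq (Finset.sum_congr rfl fun y _ => ?_)
    rw [logGrowth_eq_of_arcInCell hp W y hs0 h, ← hx.eq_of_arcInCell hp h]
  · have : straddle p s c = 1 := if_neg h
    rw [this, mul_one]
    have h1 := sum_mul_exp_logGrowth_le hW (by linarith) hs0.le hB hlog hl hlB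
    have h2 := mul_nonneg hl (gain_nonneg hp hW hs0 hs hx)
    have h3 : l ^ 2 * B ^ 2 * (1 - s) ^ 2 ≤ l * B := by
      have e : l ^ 2 * B ^ 2 * (1 - s) ^ 2 = (l * B) * ((l * B) * (1 - s) ^ 2) := by ring
      rw [e]
      refine mul_le_of_le_one_right (by positivity) ?_
      have : (1 - s) ^ 2 ≤ 1 := pow_le_one₀ (by linarith) (by linarith)
      have : 0 ≤ l * B := by positivity
      nlinarith [sq_nonneg (1 - s)]
    have h4 : 1 - l * infoBound p W ≤ circ p (rowMoment p W (-l)) c := by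
      unfold circ rowMoment
      set x₂ := inputQuantile p (Int.fract c)
      have e : ∀ y, W x₂ y * (1 - l * infoBound p W)
          ≤ W x₂ y * Real.exp (-l * infoDensity p W x₂ y) := fun y => by
        refine mul_le_mul_of_nonneg_left ?_ ((hW x₂).1 y)
        have e1 := Real.add_one_le_exp (-l * infoDensity p W x₂ y)
        have e2 := mul_le_mul_of_nonneg_left
          ((le_abs_self _).trans (abs_infoDensity_le p W x₂ y)) hl
        linarith
      have := Finset.sum_le_sum fun y (_ : y ∈ Finset.univ) => e y
      rwa [← Finset.sum_mul, (hW x₂).2, one_mul] at this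
    linarith

/-- The one-step contraction: the next value of `s ^ (-l) - 1` is at most the exponential moment of
the information density times the present one, in expectation. -/
lemma exists_one_step_bound (hp : p ∈ stdSimplex ℝ 𝒳) (hW : ∀ x, W x ∈ stdSimplex ℝ 𝒴)
    (hred : NoRedundantInputs W) (hI : 0 < mutualInfo p W) :
    ∃ l₀ : ℝ, 0 < l₀ ∧ ∀ l, 0 < l → l ≤ l₀ → ∀ s, 0 < s → s ≤ 1 →
      ∃ H : ℝ → ℝ, ∃ C : ℝ, Measurable H ∧ Function.Periodic H 1 ∧ (∀ c, |H c| ≤ C) ∧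
      (∀ c x, OptimalSymbol p W c s x →
        ∑ y, W x y * Real.exp (-l * logGrowth p W c s y) ≤ H c) ∧
      s ^ (-l) * (∫ c in (0 : ℝ)..1, H c) - 1 ≤ expMoment p W (-l) * (s ^ (-l) - 1) := by
  obtain ⟨B, hB1, hB⟩ := exists_abs_logGrowth_le hp hW
  set I := mutualInfo p W
  set D := infoBound p W
  have hD : 1 ≤ D := one_le_infoBound p W
  set K : ℝ := (B + D) * Fintype.card 𝒳 with hK
  have hK0 : 0 ≤ K := by positivity
  -- For s ≤ η the straddling loss is at most l K s^(1-l) ≤ l K √η, which has to stay below lI/2 ≤ 1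
  -- - M(-l).
  obtain ⟨η, hη0, hη⟩ : ∃ η : ℝ, 0 < η ∧ K * √η ≤ I / 2 := by
    refine ⟨(I / (2 * (K + 1))) ^ 2, by positivity, ?_⟩
    rw [Real.sqrt_sq (by positivity), ← mul_div_assoc, div_le_div_iff₀ (by positivity) two_pos]
    nlinarith
  obtain ⟨κ, hκ, hdrift⟩ := exists_drift_lower_bound hp hW hred hI hη0
  -- 1/2 makes s^(1-l) ≤ √s, 1/B and 1/D validate the Taylor bounds, I/(2D²) gives 1 - M(-l) ≥ lI/2,
  -- and the last entry lets the drift lκ(1-s) dominate all terms of order l²(1-s).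
  refine ⟨min (min (1 / 2) (min (1 / B) (1 / D))) (min (I / (2 * D ^ 2)) (κ / (I / η + B ^ 2))), by
    have : 0 < I / η + B ^ 2 := by positivity
    positivity, fun l hl hl₀ s hs0 hs1 => ?_⟩
  simp only [le_min_iff] at hl₀
  obtain ⟨⟨hl1, hlB, hlD⟩, hlI, hlκ⟩ := hl₀
  rw [le_div_iff₀ (by positivity)] at hlB hlD hlI hlκ
  have hm_up := expMoment_neg_le hp hW hl.le hlD
  have hm_lo := one_add_mul_mutualInfo_le hp hW (-l)
  set M := expMoment p W (-l)
  change M ≤ 1 - l * I + l ^ 2 * D ^ 2 at hm_up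
  change 1 + -l * I ≤ M at hm_lo
  have hM1 : l * (I / 2) ≤ 1 - M := by nlinarith
  have hrp : 0 < s ^ (-l) := Real.rpow_pos_of_pos hs0 _
  by_cases hcase : s ≤ η
  · refine ⟨fun c => circ p (rowMoment p W (-l)) c + l * (B + D) * straddle p s c,
      (∑ x, |rowMoment p W (-l) x|) + l * (B + D), ?_, fun c => ?_, fun c => ?_,
      fun c x hx => sum_mul_exp_le_rowMoment_add hp hW hs0 hs1 hx (by linarith)
        (hB c s hs0 hs1 x hx) hl.le hlB, ?_⟩
    · exact (measurable_circ p _).add ((measurable_straddle p s).const_mul _)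
    · beta_reduce
      rw [periodic_circ p _ c, periodic_straddle p s c]
    · refine (abs_add_le _ _).trans (add_le_add (abs_circ_le p _ c) ?_)
      rw [abs_mul, abs_of_nonneg (by positivity : 0 ≤ l * (B + D))]
      exact mul_le_of_le_one_right (by positivity) (abs_straddle_le p s c)
    · rw [intervalIntegral.integral_add (intervalIntegrable_circ p _ _ _)
        ((intervalIntegrable_of_bounded (measurable_straddle p s) (abs_straddle_le p s) _ _).const_mul
          _), intervalIntegral.integral_const_mul]
      have h1 := integral_circ_period hp (rowMoment p W (-l)) 0
      rw [zero_add] at h1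
      have h2 := integral_straddle_le hp hs0.le 0
      simp only [zero_add] at h2
      rw [h1, show ∑ x, p x * rowMoment p W (-l) x = M from rfl]
      have h3 : s ^ (-l) * s ≤ √η := by
        rw [← Real.rpow_add_one hs0.ne', Real.sqrt_eq_rpow]
        calc s ^ (-l + 1) ≤ s ^ (1 / 2 : ℝ) :=
              Real.rpow_le_rpow_of_exponent_ge hs0 hs1 (by linarith)
          _ ≤ η ^ (1 / 2 : ℝ) := Real.rpow_le_rpow hs0.le hcase (by norm_num)
      have h4 : l * (B + D) * (∫ c in (0 : ℝ)..1, straddle p s c) ≤ l * K * s := by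
        rw [hK]
        calc _ ≤ l * (B + D) * (Fintype.card 𝒳 * s) :=
              mul_le_mul_of_nonneg_left h2 (by positivity)
          _ = _ := by ring
      have h5 : s ^ (-l) * (l * K * s) ≤ l * (I / 2) := by
        calc _ = l * (K * (s ^ (-l) * s)) := by ring
          _ ≤ l * (K * √η) := by gcongr
          _ ≤ _ := by gcongr
      have h6 := mul_le_mul_of_nonneg_left h4 hrp.le
      nlinarith
  · rw [not_le] at hcase
    obtain ⟨H, C, hHm, hHp, hHC, hHg, hHi⟩ := hdrift s hcase.le hs1
    refine ⟨fun c => 1 - l * H c + l ^ 2 * B ^ 2 * (1 - s) ^ 2,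
      1 + l * C + l ^ 2 * B ^ 2 * (1 - s) ^ 2, ?_, fun c => ?_, fun c => ?_, fun c x hx => ?_, ?_⟩
    · exact ((hHm.const_mul l).const_sub 1).add_const _
    · beta_reduce; rw [hHp c]
    · have h1 := abs_le.1 (hHC c)
      have h0 : 0 ≤ l ^ 2 * B ^ 2 * (1 - s) ^ 2 := by positivity
      rw [abs_le]
      constructor <;> nlinarith
    · have h1 := sum_mul_exp_logGrowth_le hW (by linarith) hs0.le (by linarith : 0 ≤ B)
        (hB c s hs0 hs1 x hx) hl.le hlB
      have h2 := mul_le_mul_of_nonneg_left (hHg c x hx) hl.le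
      linarith
    · have hHint := intervalIntegrable_of_bounded hHm hHC 0 1
      rw [intervalIntegral.integral_add (intervalIntegrable_const.sub (hHint.const_mul l))
        intervalIntegrable_const, intervalIntegral.integral_sub intervalIntegrable_const
        (hHint.const_mul l), intervalIntegral.integral_const_mul]
      simp only [intervalIntegral.integral_const, sub_zero, one_smul]
      have h1s : 0 ≤ 1 - s := by linarith
      have h1 : 1 - s ^ l ≤ l * ((1 - s) / η) := by
        have e1 : 1 + l * Real.log s ≤ s ^ l := by
          rw [Real.rpow_def_of_pos hs0, mul_comm l]
          linarith [Real.add_one_le_exp (Real.log s * l)]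
        have e2 := Real.one_sub_inv_le_log_of_pos hs0
        have e3 : s⁻¹ - 1 ≤ (1 - s) / η := by
          rw [show s⁻¹ - 1 = (1 - s) / s by field_simp]
          exact div_le_div_of_nonneg_left h1s hη0 hcase.le
        nlinarith
      have h2 : 0 ≤ 1 - s ^ l := by
        linarith [Real.rpow_le_one hs0.le hs1 hl.le]
      have h3 : (1 - M) * (1 - s ^ l) ≤ l * I * (l * ((1 - s) / η)) := by
        calc _ ≤ l * I * (1 - s ^ l) := mul_le_mul_of_nonneg_right (by linarith) h2
          _ ≤ _ := mul_le_mul_of_nonneg_left h1 (by positivity)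
      have h4 : l * (κ * (1 - s)) ≤ l * ∫ c in (0 : ℝ)..1, H c :=
        mul_le_mul_of_nonneg_left hHi hl.le
      have h5 : l ^ 2 * B ^ 2 * (1 - s) ^ 2 ≤ l ^ 2 * B ^ 2 * (1 - s) := by
        refine mul_le_mul_of_nonneg_left ?_ (by positivity)
        nlinarith
      have h6 : l * (1 - s) * (l * (I / η + B ^ 2)) ≤ l * (1 - s) * κ :=
        mul_le_mul_of_nonneg_left hlκ (by positivity)
      have h7 : l * (1 - s) * (l * (I / η + B ^ 2))
          = l * I * (l * ((1 - s) / η)) + l ^ 2 * B ^ 2 * (1 - s) := by ring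
      set J := ∫ c in (0 : ℝ)..1, H c
      -- This is the goal multiplied by s^l. The required slack (1-M)(1-s^l) is of order l²(1-s),
      -- while the drift has order l(1-s).
      have h8 : 1 - l * J + l ^ 2 * B ^ 2 * (1 - s) ^ 2 - M ≤ (1 - M) * s ^ l := by nlinarith
      have h9 := mul_le_mul_of_nonneg_left h8 hrp.le
      have h10 : s ^ (-l) * ((1 - M) * s ^ l) = 1 - M := by
        rw [mul_left_comm, ← Real.rpow_add hs0]; simp
      rw [h10] at h9
      linarith

end

section

/-! ### Integrals over the outputs and shifts -/

section Paths

variable (step : (k : ℕ) → (Fin k → 𝒴) → (Fin (k + 1) → ℝ) → 𝒴 → ℝ≥0∞)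

/-- The product of the weights of the steps along a path of outputs and shifts. -/
def pathWeight : (k : ℕ) → (Fin k → 𝒴) → (Fin k → ℝ) → ℝ≥0∞
  | 0, _, _ => 1
  | k + 1, y, u => pathWeight k (fun j => y j.castSucc) (fun j => u j.castSucc)
      * step k (fun j => y j.castSucc) u (y (Fin.last k))

/-- The sum over outputs and the integral over shifts of a function on paths with weights. -/
def pathInt (k : ℕ) (f : (Fin k → 𝒴) → (Fin k → ℝ) → ℝ≥0∞) : ℝ≥0∞ :=
  ∫⁻ u in Set.Icc (0 : Fin k → ℝ) 1, ∑ y, pathWeight step k y u * f y u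

variable {step}

lemma measurable_init {k : ℕ} :
    Measurable fun (u : Fin (k + 1) → ℝ) => fun j : Fin k => u j.castSucc :=
  measurable_pi_lambda _ fun _ => measurable_pi_apply _

lemma measurable_snoc {k : ℕ} :
    Measurable fun z : (Fin k → ℝ) × ℝ => (Fin.snoc (α := fun _ => ℝ) z.1 z.2 : Fin (k + 1) → ℝ) := by
  refine measurable_pi_lambda _ fun j => ?_
  refine Fin.lastCases ?_ (fun i => ?_) j
  · simp only [Fin.snoc_last]; exact measurable_snd
  · simp only [Fin.snoc_castSucc]; exact (measurable_pi_apply i).comp measurable_fst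

lemma measurable_pathWeight (hstep : ∀ k y y', Measurable fun u => step k y u y') :
    ∀ (k : ℕ) (y : Fin k → 𝒴), Measurable (pathWeight step k y)
  | 0, _ => measurable_const
  | k + 1, _ => ((measurable_pathWeight hstep k _).comp measurable_init).mul (hstep k _ _)

lemma measurable_pathIntegrand (hstep : ∀ k y y', Measurable fun u => step k y u y') {k : ℕ}
    {f : (Fin k → 𝒴) → (Fin k → ℝ) → ℝ≥0∞} (hf : ∀ y, Measurable (f y)) :
    Measurable fun u => ∑ y, pathWeight step k y u * f y u :=
  Finset.measurable_fun_sum _ fun y _ => (measurable_pathWeight hstep k y).mul (hf y)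

lemma volume_restrict_Icc_pi (k : ℕ) :
    (volume : Measure (Fin k → ℝ)).restrict (Set.Icc 0 1)
      = Measure.pi fun _ => (volume : Measure ℝ).restrict (Set.Icc 0 1) := by
  rw [← Measure.restrict_pi_pi, Set.pi_univ_Icc]
  rfl

lemma lintegral_Icc_snoc {k : ℕ} {F : (Fin (k + 1) → ℝ) → ℝ≥0∞} (hF : Measurable F) :
    ∫⁻ u in Set.Icc (0 : Fin (k + 1) → ℝ) 1, F u
      = ∫⁻ u in Set.Icc (0 : Fin k → ℝ) 1, ∫⁻ a in Set.Icc (0 : ℝ) 1,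
          F (Fin.snoc (α := fun _ => ℝ) u a) := by
  rw [volume_restrict_Icc_pi, volume_restrict_Icc_pi]
  have hmp := (measurePreserving_piFinSuccAbove
    (fun _ : Fin (k + 1) => (volume : Measure ℝ).restrict (Set.Icc 0 1)) (Fin.last k)).symm
  rw [← hmp.lintegral_comp hF, lintegral_prod_symm]
  · refine lintegral_congr fun u => lintegral_congr fun a => ?_
    congr 1
    simp [MeasurableEquiv.piFinSuccAbove]
    rfl
  · exact (hF.comp hmp.measurable).aemeasurable

lemma sum_snoc {M : Type*} [AddCommMonoid M] {k : ℕ} (G : (Fin (k + 1) → 𝒴) → M) :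
    ∑ y, G y = ∑ y : Fin k → 𝒴, ∑ y', G (Fin.snoc (α := fun _ => 𝒴) y y') := by
  rw [← (Fin.snocEquiv fun _ : Fin (k + 1) => 𝒴).sum_comp, Fintype.sum_prod_type, Finset.sum_comm]
  rfl

/-- The tower property: the last shift and the last output are integrated first, for a fixed past.
-/
lemma pathInt_succ (hstep : ∀ k y y', Measurable fun u => step k y u y') {k : ℕ}
    {f : (Fin (k + 1) → 𝒴) → (Fin (k + 1) → ℝ) → ℝ≥0∞} (hf : ∀ y, Measurable (f y)) :
    pathInt step (k + 1) f
      = pathInt step k fun y u => ∫⁻ a in Set.Icc (0 : ℝ) 1, ∑ y',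
          step k y (Fin.snoc (α := fun _ => ℝ) u a) y'
            * f (Fin.snoc (α := fun _ => 𝒴) y y') (Fin.snoc (α := fun _ => ℝ) u a) := by
  unfold pathInt
  rw [lintegral_Icc_snoc (measurable_pathIntegrand hstep hf)]
  refine lintegral_congr fun u => ?_
  have hsn : Measurable fun a : ℝ => (Fin.snoc (α := fun _ => ℝ) u a : Fin (k + 1) → ℝ) :=
    measurable_snoc.comp (measurable_const.prodMk measurable_id)
  simp_rw [sum_snoc (M := ℝ≥0∞)]
  have hinner : ∀ y : Fin k → 𝒴, Measurable fun a => ∑ y',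
      step k y (Fin.snoc (α := fun _ => ℝ) u a) y'
        * f (Fin.snoc (α := fun _ => 𝒴) y y') (Fin.snoc (α := fun _ => ℝ) u a) := fun y =>
    Finset.measurable_fun_sum _ fun y' _ => ((hstep k y y').comp hsn).mul ((hf _).comp hsn)
  have hsplit : ∀ (a : ℝ) (y : Fin k → 𝒴), ∑ y',
      pathWeight step (k + 1) (Fin.snoc (α := fun _ => 𝒴) y y') (Fin.snoc (α := fun _ => ℝ) u a)
        * f (Fin.snoc (α := fun _ => 𝒴) y y') (Fin.snoc (α := fun _ => ℝ) u a)
      = pathWeight step k y u * ∑ y', step k y (Fin.snoc (α := fun _ => ℝ) u a) y'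
        * f (Fin.snoc (α := fun _ => 𝒴) y y') (Fin.snoc (α := fun _ => ℝ) u a) := by
    intro a y
    rw [Finset.mul_sum]
    refine Finset.sum_congr rfl fun y' _ => ?_
    simp only [pathWeight, Fin.snoc_castSucc, Fin.snoc_last]
    ring
  simp_rw [hsplit]
  rw [lintegral_finsetSum _ fun y _ => (hinner y).const_mul _]
  exact Finset.sum_congr rfl fun y _ => lintegral_const_mul _ (hinner y)

lemma pathInt_mono {k : ℕ} {f g : (Fin k → 𝒴) → (Fin k → ℝ) → ℝ≥0∞} (h : ∀ y u, f y u ≤ g y u) :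
    pathInt step k f ≤ pathInt step k g :=
  lintegral_mono fun u => Finset.sum_le_sum fun y _ => by gcongr; exact h y u

lemma pathInt_const_mul (hstep : ∀ k y y', Measurable fun u => step k y u y') {k : ℕ}
    {f : (Fin k → 𝒴) → (Fin k → ℝ) → ℝ≥0∞} (hf : ∀ y, Measurable (f y)) (r : ℝ≥0∞) :
    pathInt step k (fun y u => r * f y u) = r * pathInt step k f := by
  unfold pathInt
  rw [← lintegral_const_mul _ (measurable_pathIntegrand hstep hf)]
  refine lintegral_congr fun u => ?_
  rw [Finset.mul_sum]
  exact Finset.sum_congr rfl fun y _ => by ring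

lemma pathInt_add (hstep : ∀ k y y', Measurable fun u => step k y u y') {k : ℕ}
    {f g : (Fin k → 𝒴) → (Fin k → ℝ) → ℝ≥0∞} (hf : ∀ y, Measurable (f y)) :
    pathInt step k (fun y u => f y u + g y u) = pathInt step k f + pathInt step k g := by
  unfold pathInt
  rw [← lintegral_add_left (measurable_pathIntegrand hstep hf)]
  refine lintegral_congr fun u => ?_
  rw [← Finset.sum_add_distrib]
  exact Finset.sum_congr rfl fun y _ => by ring

lemma pathInt_zero_const (r : ℝ≥0∞) : pathInt step 0 (fun _ _ => r) = r := by
  unfold pathInt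
  rw [volume_restrict_Icc_pi]
  simp [pathWeight]

end Paths

/-! ### Transition weights of the scheme -/

variable {p : 𝒳 → ℝ} {W : 𝒳 → 𝒴 → ℝ} {N : ℕ}

/-- The left end of the shifted interval of message `m`. -/
def arcStart (p : 𝒳 → ℝ) (W : 𝒳 → 𝒴 → ℝ) (m : Fin N) {k : ℕ} (y : Fin k → 𝒴)
    (u : Fin (k + 1) → ℝ) : ℝ :=
  leftEdge (pseudoPost p W N k y (fun j => u j.castSucc)) m + u (Fin.last k)

/-- The transition probability to output `y'` of the input sent for message `m`. -/
def channelStep (p : 𝒳 → ℝ) (W : 𝒳 → 𝒴 → ℝ)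
    (sel : (i : ℕ) → Fin N → (Fin i → 𝒴) → (Fin (i + 1) → ℝ) → ℝ) (m : Fin N)
    (k : ℕ) (y : Fin k → 𝒴) (u : Fin (k + 1) → ℝ) (y' : 𝒴) : ℝ≥0∞ :=
  ENNReal.ofReal (W (inputSymbol p W m y u (sel k m y u)) y')

open Classical in
/-- The transition probability, restricted to arcs inside a cell. -/
def cellStep (p : 𝒳 → ℝ) (W : 𝒳 → 𝒴 → ℝ)
    (sel : (i : ℕ) → Fin N → (Fin i → 𝒴) → (Fin (i + 1) → ℝ) → ℝ) (m : Fin N)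
    (k : ℕ) (y : Fin k → 𝒴) (u : Fin (k + 1) → ℝ) (y' : 𝒴) : ℝ≥0∞ :=
  if ArcInCell p (arcStart p W m y u) (pseudoPost p W N k y (fun j => u j.castSucc) m) then
    channelStep p W sel m k y u y' else 0

lemma measurable_arcStart (hp : p ∈ stdSimplex ℝ 𝒳) (hW : ∀ x, W x ∈ stdSimplex ℝ 𝒴) (m : Fin N)
    {k : ℕ} (y : Fin k → 𝒴) : Measurable (arcStart p W m y) :=
  (measurable_leftEdge (fun m => (measurable_pseudoPost hp hW k y m).comp measurable_init) m).add
    (measurable_pi_apply _)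

lemma measurable_channelStep (hp : p ∈ stdSimplex ℝ 𝒳) (hW : ∀ x, W x ∈ stdSimplex ℝ 𝒴)
    {sel : (i : ℕ) → Fin N → (Fin i → 𝒴) → (Fin (i + 1) → ℝ) → ℝ}
    (hsel : ∀ i m y, Measurable (sel i m y)) (m : Fin N) (k : ℕ) (y : Fin k → 𝒴) (y' : 𝒴) :
    Measurable fun u => channelStep p W sel m k y u y' := by
  have hs : ∀ m, Measurable fun u : Fin (k + 1) → ℝ =>
      pseudoPost p W N k y (fun j => u j.castSucc) m := fun m =>
    (measurable_pseudoPost hp hW k y m).comp measurable_init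
  have hpt : Measurable fun u => point p W m y u (sel k m y u) :=
    measurable_fract.comp ((((hsel k m y).mul (hs m)).add (measurable_leftEdge hs m)).add
      (measurable_pi_apply _))
  exact ((measurable_comp_inputQuantile p fun x => W x y').comp hpt).ennreal_ofReal

lemma measurable_cellStep (hp : p ∈ stdSimplex ℝ 𝒳) (hW : ∀ x, W x ∈ stdSimplex ℝ 𝒴)
    {sel : (i : ℕ) → Fin N → (Fin i → 𝒴) → (Fin (i + 1) → ℝ) → ℝ}
    (hsel : ∀ i m y, Measurable (sel i m y)) (m : Fin N) (k : ℕ) (y : Fin k → 𝒴) (y' : 𝒴) :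
    Measurable fun u => cellStep p W sel m k y u y' := by
  classical
  exact Measurable.ite (measurableSet_arcInCell p (measurable_arcStart hp hW m y)
    ((measurable_pseudoPost hp hW k y m).comp measurable_init))
    (measurable_channelStep hp hW hsel m k y y') measurable_const

lemma prod_eq_pathWeight (sel : (i : ℕ) → Fin N → (Fin i → 𝒴) → (Fin (i + 1) → ℝ) → ℝ)
    (m : Fin N) : ∀ (k : ℕ) (y : Fin k → 𝒴) (u : Fin k → ℝ),
    ∏ i : Fin k, ENNReal.ofReal (W (inputSymbol p W m (fun j => y (Fin.castLE i.isLt.le j))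
      (fun j => u (Fin.castLE i.isLt j)) (sel i m (fun j => y (Fin.castLE i.isLt.le j))
      (fun j => u (Fin.castLE i.isLt j)))) (y i))
      = pathWeight (channelStep p W sel m) k y u
  | 0, y, u => by simp [pathWeight]
  | k + 1, y, u => by
    rw [Fin.prod_univ_castSucc, pathWeight, ← prod_eq_pathWeight sel m k]
    rfl

open Classical in
lemma errorProb_eq {n : ℕ} (S : MaxInfoGainScheme p W N n) :
    S.errorProb = (N : ℝ≥0∞)⁻¹ * ∑ m : Fin N, pathInt (channelStep p W S.select m) n
      fun y u => if S.decode y u = m then 0 else 1 := by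
  unfold MaxInfoGainScheme.errorProb pathInt
  congr 1
  refine Finset.sum_congr rfl fun m _ => lintegral_congr fun u => Finset.sum_congr rfl fun y _ => ?_
  rw [← prod_eq_pathWeight]
  beta_reduce
  split_ifs with h
  · rw [mul_zero]
  · rw [mul_one]; rfl

end

section

variable {p : 𝒳 → ℝ} {W : 𝒳 → 𝒴 → ℝ} {N : ℕ}

/-! ### The upper bound on the error probability -/

lemma MaxInfoGainScheme.optimalSymbol (hp : p ∈ stdSimplex ℝ 𝒳) (hW : ∀ x, W x ∈ stdSimplex ℝ 𝒴)
    {n : ℕ} (S : MaxInfoGainScheme p W N n) (m : Fin N) {k : ℕ} (y : Fin k → 𝒴)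
    (u : Fin (k + 1) → ℝ) (hs : 0 < pseudoPost p W N k y (fun j => u j.castSucc) m) :
    OptimalSymbol p W (arcStart p W m y u) (pseudoPost p W N k y (fun j => u j.castSucc) m)
      (inputSymbol p W m y u (S.select k m y u)) :=
  optimalSymbol_of_forall_le hp hW m y u (S.select_mem k m y u) (S.select_max k m y u) hs

/-- The next interval length in terms of the present arc. -/
lemma pseudoPost_snoc (hp : p ∈ stdSimplex ℝ 𝒳) (hW : ∀ x, W x ∈ stdSimplex ℝ 𝒴) (m : Fin N)
    {k : ℕ} (y : Fin k → 𝒴) (u : Fin k → ℝ) (a : ℝ) (y' : 𝒴) :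
    pseudoPost p W N (k + 1) (Fin.snoc (α := fun _ => 𝒴) y y') (Fin.snoc (α := fun _ => ℝ) u a) m
      = arcInt p W y' (leftEdge (pseudoPost p W N k y u) m + a) (pseudoPost p W N k y u m)
        / outputPMF p W y' := by
  rw [pseudoPost_succ hp hW]
  simp only [Fin.snoc_castSucc, Fin.snoc_last]

lemma arcInt_div_eq_mul_exp (hp : p ∈ stdSimplex ℝ 𝒳) (hW : ∀ x, W x ∈ stdSimplex ℝ 𝒴) {c s : ℝ}
    {y : 𝒴} (hs0 : 0 < s) (hs : s ≤ 1) (h : 0 < arcInt p W y c s) :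
    arcInt p W y c s / outputPMF p W y = s * Real.exp (logGrowth p W c s y) := by
  have hb := outputPMF_pos_of_arcInt_pos hp hW hs h
  rw [logGrowth, Real.exp_log (by positivity)]
  field_simp

/-- The function `s ^ (-l) - 1` with the value `∞` at `0`. -/
def excess (l s : ℝ) : ℝ≥0∞ := ENNReal.ofReal s ^ (-l) - 1

lemma measurable_excess (l : ℝ) : Measurable (excess l) :=
  (ENNReal.measurable_ofReal.pow_const _).sub_const _

lemma excess_of_pos {l s : ℝ} (hs : 0 < s) : excess l s = ENNReal.ofReal (s ^ (-l) - 1) := by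
  rw [excess, ENNReal.ofReal_rpow_of_pos hs, ENNReal.ofReal_sub _ zero_le_one, ENNReal.ofReal_one]

lemma excess_zero {l : ℝ} (hl : 0 < l) : excess l 0 = ⊤ := by
  rw [excess, ENNReal.ofReal_zero, ENNReal.zero_rpow_of_neg (by linarith)]
  simp

/-- Compatibility of the optimal symbol keeps the next interval positive for every possible output,
so the expected excess is finite and can be computed over the reals. The nonnegativity is what
allows `ENNReal.ofReal` to pass through the integral over the shift. -/
lemma excess_step (hp : p ∈ stdSimplex ℝ 𝒳) (hW : ∀ x, W x ∈ stdSimplex ℝ 𝒴) {c s l : ℝ}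
    (hl : 0 < l) (hs0 : 0 < s) (hs : s ≤ 1) {x : 𝒳} (hx : OptimalSymbol p W c s x) :
    ∑ y, ENNReal.ofReal (W x y) * excess l (arcInt p W y c s / outputPMF p W y)
      = ENNReal.ofReal (s ^ (-l) * ∑ y, W x y * Real.exp (-l * logGrowth p W c s y) - 1) ∧
    0 ≤ s ^ (-l) * ∑ y, W x y * Real.exp (-l * logGrowth p W c s y) - 1 := by
  have hterm : ∀ y, ENNReal.ofReal (W x y) * excess l (arcInt p W y c s / outputPMF p W y)
      = ENNReal.ofReal (W x y * (s ^ (-l) * Real.exp (-l * logGrowth p W c s y) - 1)) ∧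
      0 ≤ W x y * (s ^ (-l) * Real.exp (-l * logGrowth p W c s y) - 1) := by
    intro y
    rcases eq_or_lt_of_le ((hW x).1 y) with h | h
    · simp [← h]
    have ha := hx.compatible y h
    have hb := outputPMF_pos_of_arcInt_pos hp hW hs ha
    have hpos : 0 < arcInt p W y c s / outputPMF p W y := div_pos ha hb
    have hpow : (arcInt p W y c s / outputPMF p W y) ^ (-l)
        = s ^ (-l) * Real.exp (-l * logGrowth p W c s y) := by
      rw [arcInt_div_eq_mul_exp hp hW hs0 hs ha, Real.mul_rpow hs0.le (Real.exp_pos _).le,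
        ← Real.exp_mul, mul_comm (logGrowth p W c s y)]
    have hge : 1 ≤ (arcInt p W y c s / outputPMF p W y) ^ (-l) :=
      Real.one_le_rpow_of_pos_of_le_one_of_nonpos hpos
        ((div_le_one hb).2 (arcInt_le_outputPMF hp hW y hs)) (by linarith)
    rw [excess_of_pos hpos, ← ENNReal.ofReal_mul h.le, hpow]
    rw [hpow] at hge
    exact ⟨rfl, mul_nonneg h.le (by linarith)⟩
  have hsum : ∑ y, W x y * (s ^ (-l) * Real.exp (-l * logGrowth p W c s y) - 1)
      = s ^ (-l) * ∑ y, W x y * Real.exp (-l * logGrowth p W c s y) - 1 := by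
    simp only [mul_sub, mul_one, Finset.sum_sub_distrib, (hW x).2, Finset.mul_sum]
    congr 1
    exact Finset.sum_congr rfl fun y _ => by ring
  rw [← hsum]
  refine ⟨?_, Finset.sum_nonneg fun y _ => (hterm y).2⟩
  rw [ENNReal.ofReal_sum_of_nonneg fun y _ => (hterm y).2]
  exact Finset.sum_congr rfl fun y _ => (hterm y).1

lemma lintegral_Icc_ofReal {f : ℝ → ℝ} (hf : Measurable f) {C : ℝ} (hC : ∀ z, |f z| ≤ C)
    (h0 : ∀ a, 0 ≤ f a) :
    ∫⁻ a in Set.Icc (0 : ℝ) 1, ENNReal.ofReal (f a)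
      = ENNReal.ofReal (∫ a in (0 : ℝ)..1, f a) := by
  rw [← restrict_Ioc_eq_restrict_Icc, intervalIntegral.integral_of_le zero_le_one,
    ofReal_integral_eq_lintegral_ofReal
      ((intervalIntegrable_iff_integrableOn_Ioc_of_le zero_le_one).1
        (intervalIntegrable_of_bounded hf hC 0 1)) (Eventually.of_forall h0)]

/-- For small `l`, the expected excess contracts at the rate given by the exponential moment of the
information density. -/
lemma exists_pathInt_excess_le (hp : p ∈ stdSimplex ℝ 𝒳) (hW : ∀ x, W x ∈ stdSimplex ℝ 𝒴)
    (hred : NoRedundantInputs W) (hI : 0 < mutualInfo p W) :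
    ∃ l₀ : ℝ, 0 < l₀ ∧ ∀ l, 0 < l → l ≤ l₀ → ∀ (N n : ℕ) (S : MaxInfoGainScheme p W N n)
      (m : Fin N) (k : ℕ), pathInt (channelStep p W S.select m) k
        (fun y u => excess l (pseudoPost p W N k y u m))
        ≤ ENNReal.ofReal (expMoment p W (-l)) ^ k * excess l (N : ℝ)⁻¹ := by
  obtain ⟨l₀, hl₀, hstep⟩ := exists_one_step_bound hp hW hred hI
  refine ⟨l₀, hl₀, fun l hl hle N n S m k => ?_⟩
  have hM : 0 < expMoment p W (-l) := expMoment_pos hp hW _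
  have hmeas := measurable_channelStep hp hW S.measurable_select m
  have hex : ∀ k (y : Fin k → 𝒴), Measurable fun u => excess l (pseudoPost p W N k y u m) :=
    fun k y => (measurable_excess l).comp (measurable_pseudoPost hp hW k y m)
  induction k with
  | zero =>
    simp only [pseudoPost]
    rw [pathInt_zero_const, pow_zero, one_mul]
  | succ k ih =>
    rw [pathInt_succ hmeas (hex (k + 1)), pow_succ', mul_assoc]
    refine le_trans ?_ (mul_le_mul_right ih _)
    rw [← pathInt_const_mul hmeas (hex k)]
    refine pathInt_mono fun y u => ?_
    simp only [pseudoPost_snoc hp hW, channelStep]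
    set s := pseudoPost p W N k y u m with hs
    set t := leftEdge (pseudoPost p W N k y u) m with ht
    -- For a vanished interval the right-hand side is M(-l) times ∞, and M(-l) > 0.
    rcases eq_or_lt_of_le (pseudoPost_nonneg hp hW y u m) with h0 | h0
    · rw [← hs] at h0
      rw [← h0, excess_zero hl, ENNReal.mul_top (by simpa using hM)]
      exact le_top
    have hs1 : s ≤ 1 := pseudoPost_le_one hp hW y u m
    obtain ⟨H, C, hHm, hHp, hHC, hHF, hHi⟩ := hstep l hl hle s h0 hs1
    have hrp : 0 < s ^ (-l) := Real.rpow_pos_of_pos h0 _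
    have hopt : ∀ a, OptimalSymbol p W (t + a) s (inputSymbol p W m y
        (Fin.snoc (α := fun _ => ℝ) u a) (S.select k m y (Fin.snoc (α := fun _ => ℝ) u a))) := by
      intro a
      have := S.optimalSymbol hp hW m y (Fin.snoc (α := fun _ => ℝ) u a)
        (by simpa only [Fin.snoc_castSucc] using h0)
      simpa only [arcStart, Fin.snoc_castSucc, Fin.snoc_last] using this
    have hpt : ∀ a, ∑ y', ENNReal.ofReal (W (inputSymbol p W m y
        (Fin.snoc (α := fun _ => ℝ) u a) (S.select k m y (Fin.snoc (α := fun _ => ℝ) u a))) y')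
          * excess l (arcInt p W y' (t + a) s / outputPMF p W y')
        ≤ ENNReal.ofReal (s ^ (-l) * H (t + a) - 1) ∧ 0 ≤ s ^ (-l) * H (t + a) - 1 := by
      intro a
      obtain ⟨h1, h2⟩ := excess_step hp hW hl h0 hs1 (hopt a)
      have h3 := mul_le_mul_of_nonneg_left (hHF _ _ (hopt a)) hrp.le
      exact ⟨h1.le.trans (ENNReal.ofReal_le_ofReal (by linarith)), by linarith⟩
    have hHt : Measurable fun a => H (t + a) := hHm.comp (measurable_const_add t)
    refine (lintegral_mono fun a => (hpt a).1).trans ?_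
    rw [lintegral_Icc_ofReal (C := s ^ (-l) * C + 1)
      ((hHt.const_mul _).sub_const 1)
      (fun z => (abs_sub _ _).trans (by
        rw [abs_mul, abs_of_pos hrp, abs_one]
        gcongr
        exact hHC _)) (fun a => (hpt a).2), excess_of_pos h0, ← ENNReal.ofReal_mul hM.le]
    refine ENNReal.ofReal_le_ofReal ?_
    rw [intervalIntegral.integral_sub
      (((intervalIntegrable_of_bounded hHt (fun z => hHC _)
        0 1).const_mul _)) intervalIntegrable_const, intervalIntegral.integral_const_mul]
    have := integral_shift_of_periodic hHp t
    rw [this]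
    simpa using hHi

/-- The decoded message has an interval at least as long, and the two lengths sum to at most 1. -/
lemma pseudoPost_le_half_of_decode_ne (hp : p ∈ stdSimplex ℝ 𝒳) (hW : ∀ x, W x ∈ stdSimplex ℝ 𝒴)
    {n : ℕ} (S : MaxInfoGainScheme p W N n) {m : Fin N} {y : Fin n → 𝒴} {u : Fin n → ℝ}
    (h : S.decode y u ≠ m) : pseudoPost p W N n y u m ≤ 1 / 2 := by
  obtain ⟨h0, h1⟩ := pseudoPost_nonneg_and_sum_le hp hW N n y u
  have h2 := S.decode_max y u m
  have h3 : pseudoPost p W N n y u (S.decode y u) + pseudoPost p W N n y u m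
      ≤ ∑ m, pseudoPost p W N n y u m := by
    rw [← Finset.sum_pair h]
    exact Finset.sum_le_sum_of_subset_of_nonneg (Finset.subset_univ _) fun m _ _ => h0 m
  linarith

/-- The exponential upper bound on the error probability. -/
theorem exists_errorProb_le (hp : p ∈ stdSimplex ℝ 𝒳) (hW : ∀ x, W x ∈ stdSimplex ℝ 𝒴)
    (hred : NoRedundantInputs W) (hI : 0 < mutualInfo p W) :
    ∃ l₀ : ℝ, 0 < l₀ ∧ ∀ l, 0 < l → l ≤ l₀ → ∀ (N n : ℕ) (S : MaxInfoGainScheme p W N n),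
      S.errorProb ≤ ENNReal.ofReal ((2 ^ l - 1)⁻¹ * (expMoment p W (-l) ^ n * (N : ℝ) ^ l)) := by
  classical
  obtain ⟨l₀, hl₀, hmain⟩ := exists_pathInt_excess_le hp hW hred hI
  refine ⟨l₀, hl₀, fun l hl hle N n S => ?_⟩
  have hM : 0 < expMoment p W (-l) := expMoment_pos hp hW _
  rw [errorProb_eq]
  rcases Nat.eq_zero_or_pos N with hN | hN
  · subst hN; simp
  have h2 : (0 : ℝ) < 2 ^ l - 1 := by
    have := Real.one_lt_rpow (x := 2) (by norm_num) hl
    linarith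
  set r : ℝ≥0∞ := ENNReal.ofReal ((2 ^ l - 1)⁻¹ * (expMoment p W (-l) ^ n * (N : ℝ) ^ l)) with hr
  have hm : ∀ m : Fin N, pathInt (channelStep p W S.select m) n
      (fun y u => if S.decode y u = m then 0 else 1) ≤ r := by
    intro m
    calc _ ≤ pathInt (channelStep p W S.select m) n (fun y u => ENNReal.ofReal (2 ^ l - 1)⁻¹
            * excess l (pseudoPost p W N n y u m)) := by
          refine pathInt_mono fun y u => ?_
          split_ifs with hd
          · exact zero_le
          have hhalf := pseudoPost_le_half_of_decode_ne hp hW S hd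
          -- Markov's inequality: an error means s ≤ 1/2, hence s^(-l) - 1 ≥ 2^l - 1.
          have : ENNReal.ofReal (2 ^ l - 1) ≤ excess l (pseudoPost p W N n y u m) := by
            rcases eq_or_lt_of_le (pseudoPost_nonneg hp hW y u m) with h0 | h0
            · rw [← h0, excess_zero hl]; exact le_top
            · rw [excess_of_pos h0]
              refine ENNReal.ofReal_le_ofReal (sub_le_sub_right ?_ 1)
              calc (2 : ℝ) ^ l = (1 / 2 : ℝ) ^ (-l) := by
                    rw [one_div, Real.inv_rpow (by norm_num), Real.rpow_neg (by norm_num), inv_inv]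
                _ ≤ _ := Real.rpow_le_rpow_of_nonpos h0 hhalf (by linarith)
          calc (1 : ℝ≥0∞) = ENNReal.ofReal (2 ^ l - 1)⁻¹ * ENNReal.ofReal (2 ^ l - 1) := by
                rw [← ENNReal.ofReal_mul (by positivity), inv_mul_cancel₀ h2.ne',
                  ENNReal.ofReal_one]
            _ ≤ _ := by gcongr
      _ = ENNReal.ofReal (2 ^ l - 1)⁻¹ * pathInt (channelStep p W S.select m) n
            (fun y u => excess l (pseudoPost p W N n y u m)) :=
          pathInt_const_mul (measurable_channelStep hp hW S.measurable_select m)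
            (fun y => (measurable_excess l).comp (measurable_pseudoPost hp hW n y m)) _
      _ ≤ ENNReal.ofReal (2 ^ l - 1)⁻¹ * (ENNReal.ofReal (expMoment p W (-l)) ^ n
            * ENNReal.ofReal ((N : ℝ) ^ l)) := by
          gcongr
          refine (hmain l hl hle N n S m n).trans ?_
          gcongr
          have hN' : (0 : ℝ) < (N : ℝ)⁻¹ := by positivity
          rw [excess_of_pos hN']
          refine ENNReal.ofReal_le_ofReal ?_
          rw [Real.inv_rpow (by positivity), Real.rpow_neg (by positivity), inv_inv]
          linarith
      _ = r := by
          rw [← ENNReal.ofReal_pow hM.le, ← ENNReal.ofReal_mul (by positivity),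
            ← ENNReal.ofReal_mul (by positivity)]
  calc _ ≤ (N : ℝ≥0∞)⁻¹ * ∑ m : Fin N, r := by
        gcongr with m
        exact hm m
    _ = r := by
        rw [Finset.sum_const, Finset.card_univ, Fintype.card_fin, nsmul_eq_mul, ← mul_assoc,
          ENNReal.inv_mul_cancel (by exact_mod_cast hN.ne') (ENNReal.natCast_ne_top N), one_mul]

end

section

variable {p : 𝒳 → ℝ} {W : 𝒳 → 𝒴 → ℝ} {N n : ℕ}

/-! ### The lower bound on the error probability -/

lemma pathWeight_mono {step step' : (k : ℕ) → (Fin k → 𝒴) → (Fin (k + 1) → ℝ) → 𝒴 → ℝ≥0∞}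
    (h : ∀ k y u y', step k y u y' ≤ step' k y u y') :
    ∀ (k : ℕ) (y : Fin k → 𝒴) (u : Fin k → ℝ), pathWeight step k y u ≤ pathWeight step' k y u
  | 0, _, _ => le_rfl
  | k + 1, _, _ => mul_le_mul' (pathWeight_mono h k _ _) (h _ _ _ _)

lemma cellStep_le_channelStep (sel : (i : ℕ) → Fin N → (Fin i → 𝒴) → (Fin (i + 1) → ℝ) → ℝ)
    (m : Fin N) (k : ℕ) (y : Fin k → 𝒴) (u : Fin (k + 1) → ℝ) (y' : 𝒴) :
    cellStep p W sel m k y u y' ≤ channelStep p W sel m k y u y' := by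
  unfold cellStep; split_ifs
  · exact le_rfl
  · exact zero_le

lemma inputSymbol_eq_of_arcInCell (hp : p ∈ stdSimplex ℝ 𝒳) (hW : ∀ x, W x ∈ stdSimplex ℝ 𝒴)
    (m : Fin N) {k : ℕ} (y : Fin k → 𝒴) (u : Fin (k + 1) → ℝ) {v : ℝ} (hv : v ∈ Set.Icc (0 : ℝ) 1)
    (h : ArcInCell p (arcStart p W m y u) (pseudoPost p W N k y (fun j => u j.castSucc) m)) :
    inputSymbol p W m y u v = inputQuantile p (Int.fract (arcStart p W m y u)) := by
  have h0 := pseudoPost_nonneg hp hW y (fun j => u j.castSucc) m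
  rw [← h.quantile_eq hp (z := v * pseudoPost p W N k y (fun j => u j.castSucc) m
    + arcStart p W m y u)]
  · simp only [inputSymbol, point, arcStart]
    congr 2; ring
  · have h1 := mul_nonneg hv.1 h0
    have h2 := mul_le_mul_of_nonneg_right hv.2 h0
    constructor <;> linarith

/-- Along paths whose arcs are inside cells, the path weights are likelihoods that can be expressed
through the pseudo posterior. -/
lemma inv_mul_pathWeight_le (hp : p ∈ stdSimplex ℝ 𝒳) (hW : ∀ x, W x ∈ stdSimplex ℝ 𝒴)
    (S : MaxInfoGainScheme p W N n) (m : Fin N) :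
    ∀ (k : ℕ) (y : Fin k → 𝒴) (u : Fin k → ℝ),
    (N : ℝ≥0∞)⁻¹ * pathWeight (cellStep p W S.select m) k y u
      ≤ ENNReal.ofReal (pseudoPost p W N k y u m)
        * pathWeight (fun _ _ _ y' => ENNReal.ofReal (outputPMF p W y')) k y u
  | 0, y, u => by
    have hN : (0 : ℝ) < N := by exact_mod_cast (Fin.pos m)
    simp only [pathWeight, pseudoPost, mul_one]
    rw [ENNReal.ofReal_inv_of_pos hN, ENNReal.ofReal_natCast]
  | k + 1, y, u => by
    have ih := inv_mul_pathWeight_le hp hW S m k (fun j => y j.castSucc) (fun j => u j.castSucc)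
    simp only [pathWeight]
    set s := pseudoPost p W N k (fun j => y j.castSucc) (fun j => u j.castSucc) m with hs
    set y' := y (Fin.last k)
    have hs0 : 0 ≤ s := pseudoPost_nonneg hp hW _ _ m
    have hs1 : s ≤ 1 := pseudoPost_le_one hp hW _ _ m
    by_cases h : ArcInCell p (arcStart p W m (fun j => y j.castSucc) u) s
    · have hstep : cellStep p W S.select m k (fun j => y j.castSucc) u y'
          = ENNReal.ofReal (W (inputQuantile p (Int.fract
            (arcStart p W m (fun j => y j.castSucc) u))) y') := by
        rw [cellStep, if_pos h, channelStep, inputSymbol_eq_of_arcInCell hp hW m _ u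
          (S.select_mem _ _ _ _) h]
      have hnext : pseudoPost p W N (k + 1) y u m * outputPMF p W y'
          = s * W (inputQuantile p (Int.fract (arcStart p W m (fun j => y j.castSucc) u))) y' := by
        rw [pseudoPost_succ hp hW, ← arcInt_eq_of_arcInCell hp W y' hs0 h]
        change arcInt p W y' (arcStart p W m (fun j => y j.castSucc) u) s / outputPMF p W y'
          * outputPMF p W y' = _
        by_cases hb : outputPMF p W y' = 0
        · have h1 := arcInt_le_outputPMF hp hW y' (c := arcStart p W m (fun j => y j.castSucc) u) hs1
          have h2 := arcInt_nonneg p hW y' (c := arcStart p W m (fun j => y j.castSucc) u) hs0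
          rw [hb, mul_zero]
          linarith
        · exact div_mul_cancel₀ _ hb
      calc (N : ℝ≥0∞)⁻¹ * (pathWeight (cellStep p W S.select m) k (fun j => y j.castSucc)
              (fun j => u j.castSucc) * cellStep p W S.select m k (fun j => y j.castSucc) u y')
          ≤ ENNReal.ofReal s * pathWeight (fun _ _ _ y' => ENNReal.ofReal (outputPMF p W y')) k
              (fun j => y j.castSucc) (fun j => u j.castSucc)
              * cellStep p W S.select m k (fun j => y j.castSucc) u y' := by
            rw [← mul_assoc]; gcongr
        _ = ENNReal.ofReal (s * W (inputQuantile p (Int.fract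
              (arcStart p W m (fun j => y j.castSucc) u))) y')
              * pathWeight (fun _ _ _ y' => ENNReal.ofReal (outputPMF p W y')) k
              (fun j => y j.castSucc) (fun j => u j.castSucc) := by
            rw [hstep, ENNReal.ofReal_mul hs0]; ring
        _ = _ := by
            rw [← hnext, ENNReal.ofReal_mul (pseudoPost_nonneg hp hW _ _ m)]; ring
    · have hstep : cellStep p W S.select m k (fun j => y j.castSucc) u y' = 0 := if_neg h
      rw [hstep]; simp

lemma sum_pathWeight_outputPMF (hp : p ∈ stdSimplex ℝ 𝒳) (hW : ∀ x, W x ∈ stdSimplex ℝ 𝒴) :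
    ∀ (k : ℕ) (u : Fin k → ℝ), ∑ y : Fin k → 𝒴,
      pathWeight (fun _ _ _ y' => ENNReal.ofReal (outputPMF p W y')) k y u = 1
  | 0, u => by simp [pathWeight]
  | k + 1, u => by
    rw [sum_snoc]
    simp only [pathWeight, Fin.snoc_castSucc, Fin.snoc_last, ← Finset.mul_sum]
    rw [← ENNReal.ofReal_sum_of_nonneg fun y _ => outputPMF_nonneg hp hW y, sum_outputPMF hp hW,
      ENNReal.ofReal_one]
    simp only [mul_one]
    exact sum_pathWeight_outputPMF hp hW k _

open Classical in
/-- Small pseudo posteriors lead to errors up to a small probability. -/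
lemma sum_pathInt_le_errorProb_add (hp : p ∈ stdSimplex ℝ 𝒳) (hW : ∀ x, W x ∈ stdSimplex ℝ 𝒴)
    (S : MaxInfoGainScheme p W N n) (b : ℝ) :
    (N : ℝ≥0∞)⁻¹ * ∑ m : Fin N, pathInt (cellStep p W S.select m) n
      (fun y u => if pseudoPost p W N n y u m ≤ b then 1 else 0) ≤ S.errorProb + ENNReal.ofReal b := by
  have hdec : ∀ (m : Fin N) (y : Fin n → 𝒴), MeasurableSet {u | S.decode y u = m} := fun m y =>
    S.measurable_decode y (measurableSet_singleton m)
  have hpost : ∀ (m : Fin N) (y : Fin n → 𝒴), MeasurableSet {u | pseudoPost p W N n y u m ≤ b} :=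
    fun m y => measurableSet_le (measurable_pseudoPost hp hW n y m) measurable_const
  set F : Fin N → (Fin n → 𝒴) → (Fin n → ℝ) → ℝ≥0∞ := fun m y u =>
    if S.decode y u = m ∧ pseudoPost p W N n y u m ≤ b then 1 else 0 with hF
  have hFm : ∀ m y, Measurable (F m y) := fun m y =>
    Measurable.ite ((hdec m y).inter (hpost m y)) measurable_const measurable_const
  have hmeas := fun m => measurable_cellStep hp hW S.measurable_select m
  have h1 : ∀ m, pathInt (cellStep p W S.select m) n
      (fun y u => if pseudoPost p W N n y u m ≤ b then 1 else 0)
      ≤ pathInt (channelStep p W S.select m) n (fun y u => if S.decode y u = m then 0 else 1)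
        + pathInt (cellStep p W S.select m) n (F m) := by
    intro m
    calc _ ≤ pathInt (cellStep p W S.select m) n
            (fun y u => (if S.decode y u = m then 0 else 1) + F m y u) := by
          refine pathInt_mono fun y u => ?_
          simp only [hF]
          by_cases h1 : S.decode y u = m <;> by_cases h2 : pseudoPost p W N n y u m ≤ b <;>
            simp [h1, h2]
      _ = pathInt (cellStep p W S.select m) n (fun y u => if S.decode y u = m then 0 else 1)
          + pathInt (cellStep p W S.select m) n (F m) :=
          pathInt_add (hmeas m) fun y => Measurable.ite (hdec m y) measurable_const measurable_const
      _ ≤ _ := by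
          refine add_le_add (lintegral_mono fun u => Finset.sum_le_sum fun y _ => ?_) le_rfl
          exact mul_le_mul' (pathWeight_mono (cellStep_le_channelStep S.select m) n y u) le_rfl
  -- For given outputs and shifts only the decoded message contributes, with at most `b` times the
  -- product of the p(y_i), and these products sum to 1.
  have h2 : (N : ℝ≥0∞)⁻¹ * ∑ m : Fin N, pathInt (cellStep p W S.select m) n (F m)
      ≤ ENNReal.ofReal b := by
    unfold pathInt
    rw [← lintegral_finsetSum _ fun m _ => measurable_pathIntegrand (hmeas m) (hFm m),
      ← lintegral_const_mul _ (Finset.measurable_fun_sum _ fun m _ =>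
        measurable_pathIntegrand (hmeas m) (hFm m))]
    calc _ ≤ ∫⁻ _u in Set.Icc (0 : Fin n → ℝ) 1, ENNReal.ofReal b := by
          refine lintegral_mono fun u => ?_
          calc _ = ∑ y : Fin n → 𝒴, ∑ m : Fin N,
                (N : ℝ≥0∞)⁻¹ * pathWeight (cellStep p W S.select m) n y u * F m y u := by
                rw [Finset.sum_comm, Finset.mul_sum]
                refine Finset.sum_congr rfl fun y _ => ?_
                rw [Finset.mul_sum]
                exact Finset.sum_congr rfl fun y _ => (mul_assoc _ _ _).symm
            _ ≤ ∑ y : Fin n → 𝒴, ∑ m : Fin N,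
                (if S.decode y u = m then ENNReal.ofReal b else 0)
                * pathWeight (fun _ _ _ y' => ENNReal.ofReal (outputPMF p W y')) n y u := by
                refine Finset.sum_le_sum fun y _ => Finset.sum_le_sum fun m _ => ?_
                simp only [hF]
                by_cases h : S.decode y u = m ∧ pseudoPost p W N n y u m ≤ b
                · rw [if_pos h, if_pos h.1, mul_one]
                  refine (inv_mul_pathWeight_le hp hW S m n y u).trans ?_
                  gcongr
                  exact h.2
                · rw [if_neg h, mul_zero]; exact zero_le
            _ = ENNReal.ofReal b := by
                simp_rw [← Finset.sum_mul, Finset.sum_ite_eq, Finset.mem_univ, if_true,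
                  ← Finset.mul_sum, sum_pathWeight_outputPMF hp hW, mul_one]
      _ = ENNReal.ofReal b := by
          rw [lintegral_const, Measure.restrict_apply_univ, Real.volume_Icc_pi]
          simp
  calc _ ≤ (N : ℝ≥0∞)⁻¹ * ∑ m : Fin N, (pathInt (channelStep p W S.select m) n
            (fun y u => if S.decode y u = m then 0 else 1)
          + pathInt (cellStep p W S.select m) n (F m)) := by
        gcongr with m
        exact h1 m
    _ = S.errorProb + (N : ℝ≥0∞)⁻¹ * ∑ m : Fin N, pathInt (cellStep p W S.select m) n (F m) := by
        rw [Finset.sum_add_distrib, mul_add, errorProb_eq]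
    _ ≤ _ := by gcongr

/-- The part of the exponential moment that comes from arcs inside cells. -/
lemma cellStep_moment (hp : p ∈ stdSimplex ℝ 𝒳) (hW : ∀ x, W x ∈ stdSimplex ℝ 𝒴)
    (S : MaxInfoGainScheme p W N n) (m : Fin N) {β : ℝ} (hβ : β ≠ 0) {k : ℕ} (y : Fin k → 𝒴)
    (u : Fin k → ℝ) (a : ℝ) :
    ∑ y', cellStep p W S.select m k y (Fin.snoc (α := fun _ => ℝ) u a) y'
      * ENNReal.ofReal (pseudoPost p W N (k + 1) (Fin.snoc (α := fun _ => 𝒴) y y')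
        (Fin.snoc (α := fun _ => ℝ) u a) m ^ β)
      = ENNReal.ofReal (pseudoPost p W N k y u m ^ β *
        (circ p (rowMoment p W β) (leftEdge (pseudoPost p W N k y u) m + a)
          * (1 - straddle p (pseudoPost p W N k y u m)
            (leftEdge (pseudoPost p W N k y u) m + a)))) := by
  simp only [pseudoPost_snoc hp hW]
  set s := pseudoPost p W N k y u m with hs
  set c := leftEdge (pseudoPost p W N k y u) m + a with hc
  have hs0 : 0 ≤ s := pseudoPost_nonneg hp hW _ _ m
  have hs1 : s ≤ 1 := pseudoPost_le_one hp hW _ _ m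
  have hcs : arcStart p W m y (Fin.snoc (α := fun _ => ℝ) u a) = c := by
    simp only [arcStart, Fin.snoc_castSucc, Fin.snoc_last, hc]
  -- As β ≠ 0, `0 ^ β = 0` also for negative β, so vanished intervals count as 0 on both sides.
  rcases eq_or_lt_of_le hs0 with h0 | h0
  · rw [← h0, Real.zero_rpow hβ, zero_mul, ENNReal.ofReal_zero]
    refine Finset.sum_eq_zero fun y' _ => ?_
    have : arcInt p W y' c 0 = 0 := by simp [arcInt]
    rw [this, zero_div, Real.zero_rpow hβ, ENNReal.ofReal_zero, mul_zero]
  by_cases h : ArcInCell p c s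
  · have h' : ArcInCell p (arcStart p W m y (Fin.snoc (α := fun _ => ℝ) u a))
        (pseudoPost p W N k y
          (fun j => (Fin.snoc (α := fun _ => ℝ) u a : Fin (k + 1) → ℝ) j.castSucc) m) := by
      simpa only [hcs, Fin.snoc_castSucc] using h
    have hst : straddle p s c = 0 := if_pos h
    rw [hst, sub_zero, mul_one, circ]
    set x := inputQuantile p (Int.fract c) with hx
    rw [rowMoment, Finset.mul_sum, ENNReal.ofReal_sum_of_nonneg fun y' _ => mul_nonneg
      (Real.rpow_nonneg hs0 _) (mul_nonneg ((hW x).1 y') (Real.exp_pos _).le)]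
    refine Finset.sum_congr rfl fun y' _ => ?_
    rw [cellStep, if_pos h', channelStep, inputSymbol_eq_of_arcInCell hp hW m _ _
      (S.select_mem _ _ _ _) h', hcs, ← hx, ← ENNReal.ofReal_mul ((hW x).1 y')]
    congr 1
    rcases eq_or_lt_of_le ((hW x).1 y') with hw | hw
    · rw [← hw]; ring
    have ha : 0 < arcInt p W y' c s := by
      rw [arcInt_eq_of_arcInCell hp W y' hs0 h]; exact mul_pos h0 hw
    rw [arcInt_div_eq_mul_exp hp hW h0 hs1 ha, Real.mul_rpow hs0 (Real.exp_pos _).le,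
      ← Real.exp_mul, logGrowth_eq_of_arcInCell hp W y' h0 h, ← hx, mul_comm (infoDensity p W x y')]
    ring
  · have hst : straddle p s c = 1 := if_neg h
    rw [hst, sub_self, mul_zero, mul_zero, ENNReal.ofReal_zero]
    refine Finset.sum_eq_zero fun y' _ => ?_
    have h' : ¬ ArcInCell p (arcStart p W m y (Fin.snoc (α := fun _ => ℝ) u a))
        (pseudoPost p W N k y
          (fun j => (Fin.snoc (α := fun _ => ℝ) u a : Fin (k + 1) → ℝ) j.castSucc) m) := by
      simpa only [hcs, Fin.snoc_castSucc] using h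
    rw [cellStep, if_neg h', zero_mul]

/-- The circle integral of the row moments over the arcs inside cells. -/
lemma integral_circ_mul_one_sub_straddle (hp : p ∈ stdSimplex ℝ 𝒳)
    (hW : ∀ x, W x ∈ stdSimplex ℝ 𝒴) (β : ℝ) {s : ℝ} (hs : 0 ≤ s) (t : ℝ) :
    ∫ a in (0 : ℝ)..1, circ p (rowMoment p W β) (t + a) * (1 - straddle p s (t + a))
        ≤ expMoment p W β ∧
    expMoment p W β - (∑ x, |rowMoment p W β x|) * (Fintype.card 𝒳 * s)
      ≤ ∫ a in (0 : ℝ)..1, circ p (rowMoment p W β) (t + a) * (1 - straddle p s (t + a)) := by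
  have hM : ∫ a in (0 : ℝ)..1, circ p (rowMoment p W β) (t + a) = expMoment p W β := by
    rw [integral_shift_of_periodic (periodic_circ p _)]
    have := integral_circ_period hp (rowMoment p W β) 0
    rwa [zero_add] at this
  have hc0 : ∀ z, 0 ≤ circ p (rowMoment p W β) z := fun z => rowMoment_nonneg hW β _
  set R := ∑ x, |rowMoment p W β x|
  have hcR : ∀ z, circ p (rowMoment p W β) z ≤ R := fun z =>
    (le_abs_self _).trans (abs_circ_le p _ z)
  have hi1 : IntervalIntegrable (fun a => circ p (rowMoment p W β) (t + a)) volume 0 1 :=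
    intervalIntegrable_of_bounded ((measurable_circ p _).comp (measurable_const_add t))
      (fun z => abs_circ_le p _ _) 0 1
  have hms : Measurable fun a => straddle p s (t + a) :=
    (measurable_straddle p s).comp (measurable_const_add t)
  have hi2 : IntervalIntegrable (fun a => straddle p s (t + a)) volume 0 1 :=
    intervalIntegrable_of_bounded hms (fun z => abs_straddle_le p s _) 0 1
  have hi3 : IntervalIntegrable
      (fun a => circ p (rowMoment p W β) (t + a) * (1 - straddle p s (t + a))) volume 0 1 :=
    intervalIntegrable_of_bounded (C := R)
      (((measurable_circ p _).comp (measurable_const_add t)).mul (hms.const_sub 1)) (fun z => by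
        simp only [Pi.mul_apply, Function.comp_apply]
        rw [abs_mul, abs_of_nonneg (hc0 _), abs_of_nonneg (sub_nonneg.2 (straddle_le_one p s _))]
        exact (mul_le_of_le_one_right (hc0 _) (by linarith [straddle_nonneg p s (t + z)])).trans
          (hcR _)) 0 1
  constructor
  · rw [← hM]
    refine intervalIntegral.integral_mono_on zero_le_one hi3 hi1 fun a _ => ?_
    exact mul_le_of_le_one_right (hc0 _) (by linarith [straddle_nonneg p s (t + a)])
  · have hR0 : 0 ≤ R := Finset.sum_nonneg fun _ _ => abs_nonneg _
    have h1 := mul_le_mul_of_nonneg_left (integral_straddle_le hp hs t) hR0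
    rw [← intervalIntegral.integral_const_mul] at h1
    have h2 : ∫ a in (0 : ℝ)..1, (circ p (rowMoment p W β) (t + a) - R * straddle p s (t + a))
        ≤ ∫ a in (0 : ℝ)..1, circ p (rowMoment p W β) (t + a) * (1 - straddle p s (t + a)) := by
      refine intervalIntegral.integral_mono_on zero_le_one (hi1.sub (hi2.const_mul R)) hi3
        fun a _ => ?_
      have := mul_le_mul_of_nonneg_right (hcR (t + a)) (straddle_nonneg p s (t + a))
      linarith
    rw [intervalIntegral.integral_sub hi1 (hi2.const_mul R), hM] at h2
    linarith

end

/-! ### Moment recursions and the finite-blocklength lower bound -/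

section

variable {p : 𝒳 → ℝ} {W : 𝒳 → 𝒴 → ℝ} {N n : ℕ}

/-- The moment of order `β` of the pseudo posterior of `m` over paths with arcs inside cells. -/
def cellMoment (S : MaxInfoGainScheme p W N n) (m : Fin N) (β : ℝ) (k : ℕ) : ℝ≥0∞ :=
  pathInt (cellStep p W S.select m) k fun y u => ENNReal.ofReal (pseudoPost p W N k y u m ^ β)

lemma measurable_ofReal_pseudoPost_rpow (hp : p ∈ stdSimplex ℝ 𝒳)
    (hW : ∀ x, W x ∈ stdSimplex ℝ 𝒴) (m : Fin N) (β : ℝ) (k : ℕ) (y : Fin k → 𝒴) :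
    Measurable fun u => ENNReal.ofReal (pseudoPost p W N k y u m ^ β) :=
  ((measurable_pseudoPost hp hW k y m).pow_const β).ennreal_ofReal

lemma cellMoment_zero (S : MaxInfoGainScheme p W N n) (m : Fin N) (β : ℝ) :
    cellMoment S m β 0 = ENNReal.ofReal ((N : ℝ)⁻¹ ^ β) := by
  simp only [cellMoment, pseudoPost]
  rw [pathInt_zero_const]

lemma lintegral_cellStep_moment (hp : p ∈ stdSimplex ℝ 𝒳) (hW : ∀ x, W x ∈ stdSimplex ℝ 𝒴)
    (S : MaxInfoGainScheme p W N n) (m : Fin N) {β : ℝ} (hβ : β ≠ 0) {k : ℕ} (y : Fin k → 𝒴)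
    (u : Fin k → ℝ) :
    ∫⁻ a in Set.Icc (0 : ℝ) 1, ∑ y', cellStep p W S.select m k y (Fin.snoc (α := fun _ => ℝ) u a) y'
      * ENNReal.ofReal (pseudoPost p W N (k + 1) (Fin.snoc (α := fun _ => 𝒴) y y')
        (Fin.snoc (α := fun _ => ℝ) u a) m ^ β)
      = ENNReal.ofReal (pseudoPost p W N k y u m ^ β) * ENNReal.ofReal (∫ a in (0 : ℝ)..1,
        circ p (rowMoment p W β) (leftEdge (pseudoPost p W N k y u) m + a)
          * (1 - straddle p (pseudoPost p W N k y u m)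
            (leftEdge (pseudoPost p W N k y u) m + a))) := by
  simp only [cellStep_moment hp hW S m hβ]
  set s := pseudoPost p W N k y u m
  set t := leftEdge (pseudoPost p W N k y u) m
  have hs0 : 0 ≤ s := pseudoPost_nonneg hp hW _ _ m
  have hc0 : ∀ z, 0 ≤ circ p (rowMoment p W β) z := fun z => rowMoment_nonneg hW β _
  have hst : ∀ z, 0 ≤ 1 - straddle p s z := fun z => sub_nonneg.2 (straddle_le_one p s z)
  have hmeas : Measurable fun a => circ p (rowMoment p W β) (t + a) * (1 - straddle p s (t + a)) :=
    ((measurable_circ p _).comp (measurable_const_add t)).mul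
      (((measurable_straddle p s).comp (measurable_const_add t)).const_sub 1)
  simp_rw [ENNReal.ofReal_mul (Real.rpow_nonneg hs0 β)]
  rw [lintegral_const_mul _ hmeas.ennreal_ofReal]
  congr 1
  refine lintegral_Icc_ofReal hmeas (C := ∑ x, |rowMoment p W β x|) (fun z => ?_)
    fun a => mul_nonneg (hc0 _) (hst _)
  rw [abs_of_nonneg (mul_nonneg (hc0 _) (hst _))]
  exact (mul_le_of_le_one_right (hc0 _) (by linarith [straddle_nonneg p s (t + z)])).trans
    ((le_abs_self _).trans (abs_circ_le p _ _))

lemma cellMoment_succ_le (hp : p ∈ stdSimplex ℝ 𝒳) (hW : ∀ x, W x ∈ stdSimplex ℝ 𝒴)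
    (S : MaxInfoGainScheme p W N n) (m : Fin N) {β : ℝ} (hβ : β ≠ 0) (k : ℕ) :
    cellMoment S m β (k + 1) ≤ ENNReal.ofReal (expMoment p W β) * cellMoment S m β k := by
  have hmeas := measurable_cellStep hp hW S.measurable_select m
  have hpow := measurable_ofReal_pseudoPost_rpow hp hW m β
  unfold cellMoment
  rw [pathInt_succ hmeas (hpow (k + 1)), ← pathInt_const_mul hmeas (hpow k)]
  refine pathInt_mono fun y u => ?_
  rw [lintegral_cellStep_moment hp hW S m hβ, mul_comm]
  gcongr
  exact (integral_circ_mul_one_sub_straddle hp hW β (pseudoPost_nonneg hp hW y u m) _).1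

/-- Discarding straddling arcs costs at most a constant times s^β · s, and s^β · s ≤ s^(β+θ) since θ
≤ 1. The loss is thus a moment of a higher order, already controlled by `cellMoment_le`. -/
lemma le_cellMoment_succ (hp : p ∈ stdSimplex ℝ 𝒳) (hW : ∀ x, W x ∈ stdSimplex ℝ 𝒴)
    (S : MaxInfoGainScheme p W N n) (m : Fin N) {β θ : ℝ} (hβ : β ≠ 0) (hθ : θ ≤ 1)
    (k : ℕ) :
    ENNReal.ofReal (expMoment p W β) * cellMoment S m β k ≤ cellMoment S m β (k + 1)
      + ENNReal.ofReal ((∑ x, |rowMoment p W β x|) * Fintype.card 𝒳) * cellMoment S m (β + θ) k := by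
  have hmeas := measurable_cellStep hp hW S.measurable_select m
  have hpow := fun β => measurable_ofReal_pseudoPost_rpow hp hW m β
  have hM := expMoment_pos hp hW β
  set R := ∑ x, |rowMoment p W β x| with hR
  have hR0 : 0 ≤ R := Finset.sum_nonneg fun _ _ => abs_nonneg _
  unfold cellMoment
  rw [pathInt_succ hmeas (hpow β (k + 1)), ← pathInt_const_mul hmeas (hpow β k),
    ← pathInt_const_mul hmeas (hpow (β + θ) k), add_comm, ← pathInt_add hmeas fun y =>
      (hpow (β + θ) k y).const_mul _]
  refine pathInt_mono fun y u => ?_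
  rw [lintegral_cellStep_moment hp hW S m hβ]
  have hs0 := pseudoPost_nonneg hp hW y u m
  have hs1 := pseudoPost_le_one hp hW y u m
  have hJ := (integral_circ_mul_one_sub_straddle hp hW β hs0
    (leftEdge (pseudoPost p W N k y u) m)).2
  have hJ0 : 0 ≤ ∫ a in (0 : ℝ)..1,
        circ p (rowMoment p W β) (leftEdge (pseudoPost p W N k y u) m + a)
          * (1 - straddle p (pseudoPost p W N k y u m)
            (leftEdge (pseudoPost p W N k y u) m + a)) :=
    intervalIntegral.integral_nonneg zero_le_one fun a _ =>
      mul_nonneg (rowMoment_nonneg hW β _) (sub_nonneg.2 (straddle_le_one p _ _))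
  set J := ∫ a in (0 : ℝ)..1,
        circ p (rowMoment p W β) (leftEdge (pseudoPost p W N k y u) m + a)
          * (1 - straddle p (pseudoPost p W N k y u m)
            (leftEdge (pseudoPost p W N k y u) m + a))
  set s := pseudoPost p W N k y u m
  rcases eq_or_lt_of_le hs0 with h0 | h0
  · rw [← h0, Real.zero_rpow hβ, ENNReal.ofReal_zero, mul_zero]; exact zero_le
  have hsβ := Real.rpow_pos_of_pos h0 β
  have hsβθ := Real.rpow_pos_of_pos h0 (β + θ)
  rw [← ENNReal.ofReal_mul hM.le, ← ENNReal.ofReal_mul hsβ.le,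
    ← ENNReal.ofReal_mul (by positivity), ← ENNReal.ofReal_add (by positivity) (by positivity)]
  refine ENNReal.ofReal_le_ofReal ?_
  have h1 : s ^ β * s ≤ s ^ (β + θ) := by
    rw [← Real.rpow_add_one h0.ne']
    exact Real.rpow_le_rpow_of_exponent_ge h0 hs1 (by linarith)
  have h2 := mul_le_mul_of_nonneg_left hJ hsβ.le
  have h3 := mul_le_mul_of_nonneg_left h1 (show 0 ≤ R * Fintype.card 𝒳 by positivity)
  linarith

lemma cellMoment_le (hp : p ∈ stdSimplex ℝ 𝒳) (hW : ∀ x, W x ∈ stdSimplex ℝ 𝒴)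
    (S : MaxInfoGainScheme p W N n) (m : Fin N) {β : ℝ} (hβ : β ≠ 0) (k : ℕ) :
    cellMoment S m β k ≤ ENNReal.ofReal (expMoment p W β ^ k * (N : ℝ)⁻¹ ^ β) := by
  have hM := expMoment_pos hp hW β
  induction k with
  | zero => rw [cellMoment_zero, pow_zero, one_mul]
  | succ k ih =>
    refine (cellMoment_succ_le hp hW S m hβ k).trans ?_
    rw [pow_succ', mul_assoc, ENNReal.ofReal_mul hM.le]
    gcongr

/-- The recursion unrolled: each of the `k` losses is propagated by powers of M(β) and M(β+θ), hence
by their maximum. M(β) ≥ 1/2 allows one missing factor to be supplied at the price of 2. -/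
lemma le_cellMoment_add (hp : p ∈ stdSimplex ℝ 𝒳) (hW : ∀ x, W x ∈ stdSimplex ℝ 𝒴)
    (S : MaxInfoGainScheme p W N n) (m : Fin N) {β θ : ℝ} (hβ : β ≠ 0) (hβθ : β + θ ≠ 0)
    (hθ : θ ≤ 1) (hM2 : 1 / 2 ≤ expMoment p W β) (k : ℕ) :
    ENNReal.ofReal (expMoment p W β ^ k * (N : ℝ)⁻¹ ^ β) ≤ cellMoment S m β k
      + ENNReal.ofReal ((∑ x, |rowMoment p W β x|) * Fintype.card 𝒳 * (N : ℝ)⁻¹ ^ (β + θ)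
        * (2 * k * max (expMoment p W β) (expMoment p W (β + θ)) ^ k)) := by
  have hM := expMoment_pos hp hW β
  have hq := expMoment_pos hp hW (β + θ)
  set M := expMoment p W β
  set q := expMoment p W (β + θ)
  set R := (∑ x, |rowMoment p W β x|) * Fintype.card 𝒳 with hR
  have hR0 : 0 ≤ R := mul_nonneg (Finset.sum_nonneg fun _ _ => abs_nonneg _) (by positivity)
  have hX : 0 ≤ max M q := hM.le.trans (le_max_left _ _)
  have hNp : 0 ≤ (N : ℝ)⁻¹ ^ (β + θ) := Real.rpow_nonneg (by positivity) _
  induction k with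
  | zero => rw [cellMoment_zero, pow_zero, one_mul]; exact le_self_add
  | succ k ih =>
    rw [pow_succ', mul_assoc, ENNReal.ofReal_mul hM.le]
    refine (mul_le_mul_right ih _).trans ?_
    rw [mul_add]
    refine (add_le_add (le_cellMoment_succ hp hW S m hβ hθ k) le_rfl).trans ?_
    rw [add_assoc]
    refine add_le_add le_rfl ?_
    refine (add_le_add (mul_le_mul_right (cellMoment_le hp hW S m hβθ k) _) le_rfl).trans ?_
    rw [← ENNReal.ofReal_mul hR0, ← ENNReal.ofReal_mul hM.le,
      ← ENNReal.ofReal_add (by positivity) (by positivity)]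
    refine ENNReal.ofReal_le_ofReal ?_
    have h1 : q ^ k ≤ max M q ^ k := pow_le_pow_left₀ hq.le (le_max_right _ _) _
    have h2 : max M q ^ k ≤ 2 * max M q ^ (k + 1) := by
      rw [pow_succ]
      have : 1 / 2 ≤ max M q := hM2.trans (le_max_left _ _)
      have : 0 ≤ max M q ^ k := by positivity
      nlinarith
    have h3 : M * (2 * k * max M q ^ k) ≤ 2 * k * max M q ^ (k + 1) := by
      rw [pow_succ]
      have : M * (2 * k * max M q ^ k) ≤ max M q * (2 * k * max M q ^ k) :=
        mul_le_mul_of_nonneg_right (le_max_left _ _) (by positivity)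
      linarith
    have h4 : q ^ k + M * (2 * k * max M q ^ k) ≤ 2 * ((k + 1 : ℕ) : ℝ) * max M q ^ (k + 1) := by
      push_cast; linarith
    have h5 := mul_le_mul_of_nonneg_left h4 (mul_nonneg hR0 hNp)
    linarith

/-- The part of the moment of order -l from s > b is controlled by the order -l + θ, the part from s
< a by the order -l - θ, and in between s^(-l) ≤ a^(-l). This is the localization step of Cramér's
lower bound without a change of measure. -/
lemma rpow_le_window {s a b l θ : ℝ} (hs : 0 ≤ s) (ha : 0 < a) (hb : 0 < b) (hl : 0 < l)
    (hθ : 0 < θ) :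
    s ^ (-l) ≤ a ^ (-l) * (if s ≤ b then 1 else 0) + b ^ (-θ) * s ^ (-l + θ)
      + a ^ θ * s ^ (-l - θ) := by
  have h1 : 0 ≤ b ^ (-θ) * s ^ (-l + θ) :=
    mul_nonneg (Real.rpow_nonneg hb.le _) (Real.rpow_nonneg hs _)
  have h2 : 0 ≤ a ^ θ * s ^ (-l - θ) :=
    mul_nonneg (Real.rpow_nonneg ha.le _) (Real.rpow_nonneg hs _)
  have h3 : 0 ≤ a ^ (-l) := Real.rpow_nonneg ha.le _
  rcases eq_or_lt_of_le hs with h0 | h0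
  · rw [← h0] at h1 h2 ⊢
    rw [Real.zero_rpow (by linarith : -l ≠ 0)]
    split_ifs <;> linarith
  by_cases hsb : s ≤ b
  · rw [if_pos hsb]
    by_cases hsa : s < a
    · have : s ^ (-l) ≤ a ^ θ * s ^ (-l - θ) := by
        calc s ^ (-l) = s ^ θ * s ^ (-l - θ) := by rw [← Real.rpow_add h0]; congr 1; ring
          _ ≤ _ := by gcongr
      linarith
    · have : s ^ (-l) ≤ a ^ (-l) :=
        Real.rpow_le_rpow_of_nonpos ha (not_lt.1 hsa) (by linarith)
      linarith
  · rw [if_neg hsb]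
    have : s ^ (-l) ≤ b ^ (-θ) * s ^ (-l + θ) := by
      calc s ^ (-l) = s ^ (-θ) * s ^ (-l + θ) := by rw [← Real.rpow_add h0]; congr 1; ring
        _ ≤ _ := mul_le_mul_of_nonneg_right
          (Real.rpow_le_rpow_of_nonpos hb (not_le.1 hsb).le (by linarith)) (Real.rpow_nonneg hs _)
    linarith

/-- The lower bound on the error probability for finite blocklength. -/
theorem le_errorProb (hp : p ∈ stdSimplex ℝ 𝒳) (hW : ∀ x, W x ∈ stdSimplex ℝ 𝒴)
    (S : MaxInfoGainScheme p W N n) (hN : 0 < N) {l θ a b : ℝ} (hl : 0 < l) (hθ : 0 < θ)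
    (hθl : θ < l) (hθ1 : θ ≤ 1) (ha : 0 < a) (hb : 0 < b) (hM2 : 1 / 2 ≤ expMoment p W (-l)) :
    ENNReal.ofReal (a ^ l * (expMoment p W (-l) ^ n * (N : ℝ)⁻¹ ^ (-l)
      - (∑ x, |rowMoment p W (-l) x|) * Fintype.card 𝒳 * (N : ℝ)⁻¹ ^ (-l + θ)
        * (2 * n * max (expMoment p W (-l)) (expMoment p W (-l + θ)) ^ n)
      - b ^ (-θ) * (expMoment p W (-l + θ) ^ n * (N : ℝ)⁻¹ ^ (-l + θ))
      - a ^ θ * (expMoment p W (-l - θ) ^ n * (N : ℝ)⁻¹ ^ (-l - θ))) - b) ≤ S.errorProb := by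
  classical
  have hM := fun β => expMoment_pos hp hW (W := W) β
  set A0 := expMoment p W (-l) ^ n * (N : ℝ)⁻¹ ^ (-l)
  set A1 := (∑ x, |rowMoment p W (-l) x|) * Fintype.card 𝒳 * (N : ℝ)⁻¹ ^ (-l + θ)
        * (2 * n * max (expMoment p W (-l)) (expMoment p W (-l + θ)) ^ n) with hA1
  set A2 := expMoment p W (-l + θ) ^ n * (N : ℝ)⁻¹ ^ (-l + θ) with hA2
  set A3 := expMoment p W (-l - θ) ^ n * (N : ℝ)⁻¹ ^ (-l - θ) with hA3
  have hNr : ∀ β : ℝ, 0 ≤ (N : ℝ)⁻¹ ^ β := fun β => Real.rpow_nonneg (by positivity) _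
  have hA1n : 0 ≤ A1 := mul_nonneg (mul_nonneg (mul_nonneg
    (Finset.sum_nonneg fun _ _ => abs_nonneg _) (by positivity)) (hNr _))
    (mul_nonneg (by positivity) (pow_nonneg ((hM _).le.trans (le_max_left _ _)) _))
  have hA2n : 0 ≤ A2 := mul_nonneg (pow_nonneg (hM _).le _) (hNr _)
  have hA3n : 0 ≤ A3 := mul_nonneg (pow_nonneg (hM _).le _) (hNr _)
  have hbθ : 0 ≤ b ^ (-θ) := Real.rpow_nonneg hb.le _
  have haθ : 0 ≤ a ^ θ := Real.rpow_nonneg ha.le _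
  have hal : 0 < a ^ (-l) := Real.rpow_pos_of_pos ha _
  have hal' : 0 < a ^ l := Real.rpow_pos_of_pos ha _
  have hm : ∀ m : Fin N, ENNReal.ofReal (a ^ l * (A0 - A1 - b ^ (-θ) * A2 - a ^ θ * A3))
      ≤ pathInt (cellStep p W S.select m) n
        (fun y u => if pseudoPost p W N n y u m ≤ b then 1 else 0) := by
    intro m
    have hmeas := measurable_cellStep hp hW S.measurable_select m
    have hpow := fun β => measurable_ofReal_pseudoPost_rpow hp hW m β n
    set G := pathInt (cellStep p W S.select m) n
        (fun y u => if pseudoPost p W N n y u m ≤ b then 1 else 0) with hG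
    have hGm : ∀ y : Fin n → 𝒴, Measurable fun u =>
        if pseudoPost p W N n y u m ≤ b then (1 : ℝ≥0∞) else 0 := fun y =>
      Measurable.ite (measurableSet_le (measurable_pseudoPost hp hW n y m) measurable_const)
        measurable_const measurable_const
    -- The window inequality, integrated; solved for `G` it bounds the weight of s_n ≤ b from below.
    have hwin : cellMoment S m (-l) n ≤ ENNReal.ofReal (a ^ (-l)) * G
        + ENNReal.ofReal (b ^ (-θ)) * cellMoment S m (-l + θ) n
        + ENNReal.ofReal (a ^ θ) * cellMoment S m (-l - θ) n := by
      unfold cellMoment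
      rw [hG, ← pathInt_const_mul hmeas hGm, ← pathInt_const_mul hmeas (hpow _),
        ← pathInt_const_mul hmeas (hpow _), ← pathInt_add hmeas fun y => (hGm y).const_mul _,
        ← pathInt_add hmeas fun y => ((hGm y).const_mul _).fun_add ((hpow _ y).const_mul _)]
      refine pathInt_mono fun y u => ?_
      have hs0 := pseudoPost_nonneg hp hW y u m
      have h1 := rpow_le_window hs0 ha hb hl hθ
      refine (ENNReal.ofReal_le_ofReal h1).trans ?_
      refine (ENNReal.ofReal_add_le.trans (add_le_add ENNReal.ofReal_add_le le_rfl)).trans ?_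
      rw [ENNReal.ofReal_mul hal.le, ENNReal.ofReal_mul hbθ, ENNReal.ofReal_mul haθ]
      gcongr
      split_ifs <;> simp
    have hlow := le_cellMoment_add hp hW S m (by linarith : -l ≠ 0) (by linarith : -l + θ ≠ 0)
      hθ1 hM2 n
    have h2 := cellMoment_le hp hW S m (by linarith : -l + θ ≠ 0) n
    have h3 := cellMoment_le hp hW S m (by linarith : -l - θ ≠ 0) n
    have htot : ENNReal.ofReal A0 ≤ ENNReal.ofReal (a ^ (-l)) * G
        + ENNReal.ofReal (A1 + b ^ (-θ) * A2 + a ^ θ * A3) := by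
      calc _ ≤ cellMoment S m (-l) n + ENNReal.ofReal A1 := hlow
        _ ≤ (ENNReal.ofReal (a ^ (-l)) * G
            + ENNReal.ofReal (b ^ (-θ)) * ENNReal.ofReal A2
            + ENNReal.ofReal (a ^ θ) * ENNReal.ofReal A3) + ENNReal.ofReal A1 := by
            gcongr
            refine hwin.trans ?_
            gcongr
        _ = _ := by
            rw [← ENNReal.ofReal_mul hbθ, ← ENNReal.ofReal_mul haθ, add_assoc, add_assoc,
              ← ENNReal.ofReal_add (by positivity) hA1n,
              ← ENNReal.ofReal_add (by positivity) (by positivity)]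
            congr 2; ring
    have hsub : ENNReal.ofReal (A0 - A1 - b ^ (-θ) * A2 - a ^ θ * A3)
        ≤ ENNReal.ofReal (a ^ (-l)) * G := by
      rw [show A0 - A1 - b ^ (-θ) * A2 - a ^ θ * A3 = A0 - (A1 + b ^ (-θ) * A2 + a ^ θ * A3) by ring,
        ENNReal.ofReal_sub _ (by positivity)]
      exact tsub_le_iff_right.2 htot
    calc _ = ENNReal.ofReal (a ^ l) * ENNReal.ofReal (A0 - A1 - b ^ (-θ) * A2 - a ^ θ * A3) :=
          ENNReal.ofReal_mul hal'.le
      _ ≤ ENNReal.ofReal (a ^ l) * (ENNReal.ofReal (a ^ (-l)) * G) := by gcongr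
      _ = G := by
          rw [← mul_assoc, ← ENNReal.ofReal_mul hal'.le, ← Real.rpow_add ha]
          simp
  have hfin := sum_pathInt_le_errorProb_add hp hW S b
  have hsum : ENNReal.ofReal (a ^ l * (A0 - A1 - b ^ (-θ) * A2 - a ^ θ * A3))
      ≤ S.errorProb + ENNReal.ofReal b := by
    refine le_trans ?_ hfin
    generalize ENNReal.ofReal (a ^ l * (A0 - A1 - b ^ (-θ) * A2 - a ^ θ * A3)) = r at hm ⊢
    calc _ = (N : ℝ≥0∞)⁻¹ * ∑ _m : Fin N, r := by
          rw [Finset.sum_const, Finset.card_univ, Fintype.card_fin, nsmul_eq_mul, ← mul_assoc,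
            ENNReal.inv_mul_cancel (by exact_mod_cast hN.ne') (ENNReal.natCast_ne_top N), one_mul]
      _ ≤ _ := by
          gcongr with m
          exact hm m
  rw [ENNReal.ofReal_sub _ hb.le]
  exact tsub_le_iff_right.2 hsum

end

section

variable {p : 𝒳 → ℝ} {W : 𝒳 → 𝒴 → ℝ}

/-! ### The cumulant generating function of the information density -/

lemma dispersion_nonneg (hp : p ∈ stdSimplex ℝ 𝒳) (hW : ∀ x, W x ∈ stdSimplex ℝ 𝒴) :
    0 ≤ dispersion p W :=
  Finset.sum_nonneg fun x _ => Finset.sum_nonneg fun y _ =>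
    mul_nonneg (mul_nonneg (hp.1 x) ((hW x).1 y)) (sq_nonneg _)

lemma abs_exp_sub_quadratic_le {x : ℝ} (hx : |x| ≤ 1) :
    |Real.exp x - (1 + x + x ^ 2 / 2)| ≤ |x| ^ 3 := by
  have h := Real.exp_bound hx (n := 3) (by norm_num)
  have h1 : ∑ m ∈ Finset.range 3, x ^ m / (m.factorial : ℝ) = 1 + x + x ^ 2 / 2 := by
    simp [Finset.sum_range_succ, Nat.factorial]
  rw [h1] at h
  refine h.trans ?_
  have : (0 : ℝ) ≤ |x| ^ 3 := by positivity
  norm_num [Nat.factorial]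
  linarith

/-- The exponential moments of the centred information density. -/
lemma abs_expMoment_sub_le (hp : p ∈ stdSimplex ℝ 𝒳) (hW : ∀ x, W x ∈ stdSimplex ℝ 𝒴) {β : ℝ}
    {D : ℝ} (hD : ∀ x y, |infoDensity p W x y - mutualInfo p W| ≤ D) (hβ : |β| * D ≤ 1) :
    |Real.exp (-(β * mutualInfo p W)) * expMoment p W β - (1 + β ^ 2 * dispersion p W / 2)|
      ≤ |β| ^ 3 * D ^ 3 := by
  set I := mutualInfo p W with hI
  have hj : ∀ x y, 0 ≤ p x * W x y := fun x y => mul_nonneg (hp.1 x) ((hW x).1 y)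
  have h1 : Real.exp (-(β * I)) * expMoment p W β - (1 + β ^ 2 * dispersion p W / 2)
      = ∑ x, ∑ y, p x * W x y * (Real.exp (β * (infoDensity p W x y - I))
        - (1 + β * (infoDensity p W x y - I) + (β * (infoDensity p W x y - I)) ^ 2 / 2)) := by
    have e1 : Real.exp (-(β * I)) * expMoment p W β
        = ∑ x, ∑ y, p x * W x y * Real.exp (β * (infoDensity p W x y - I)) := by
      rw [expMoment_eq_sum, Finset.mul_sum]
      refine Finset.sum_congr rfl fun x _ => ?_
      rw [Finset.mul_sum]
      refine Finset.sum_congr rfl fun y _ => ?_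
      rw [show β * (infoDensity p W x y - I) = -(β * I) + β * infoDensity p W x y by ring,
        Real.exp_add]
      ring
    have e2 : ∑ x, ∑ y, p x * W x y * (β * (infoDensity p W x y - I)) = 0 := by
      have : ∀ x y, p x * W x y * (β * (infoDensity p W x y - I))
          = β * (p x * W x y * infoDensity p W x y) - β * I * (p x * W x y) := fun x y => by ring
      simp only [this, Finset.sum_sub_distrib, ← Finset.mul_sum]
      simp only [(hW _).2, mul_one, hp.2]
      rw [hI, mutualInfo]
      simp only [sub_self]
    have e3 : ∑ x, ∑ y, p x * W x y * ((β * (infoDensity p W x y - I)) ^ 2 / 2)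
        = β ^ 2 * dispersion p W / 2 := by
      rw [dispersion, Finset.mul_sum, Finset.sum_div]
      refine Finset.sum_congr rfl fun x _ => ?_
      rw [Finset.mul_sum, Finset.sum_div]
      exact Finset.sum_congr rfl fun y _ => by ring
    have e0 : ∀ x y, p x * W x y * (Real.exp (β * (infoDensity p W x y - I))
        - (1 + β * (infoDensity p W x y - I) + (β * (infoDensity p W x y - I)) ^ 2 / 2))
        = p x * W x y * Real.exp (β * (infoDensity p W x y - I)) - p x * W x y
          - p x * W x y * (β * (infoDensity p W x y - I))
          - p x * W x y * ((β * (infoDensity p W x y - I)) ^ 2 / 2) := fun x y => by ring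
    simp only [e0, Finset.sum_sub_distrib]
    rw [e1, e2, e3, sum_joint hp hW]
    ring
  rw [h1]
  calc _ ≤ ∑ x, ∑ y, p x * W x y * (|β| ^ 3 * D ^ 3) := by
        refine (Finset.abs_sum_le_sum_abs _ _).trans (Finset.sum_le_sum fun x _ => ?_)
        refine (Finset.abs_sum_le_sum_abs _ _).trans (Finset.sum_le_sum fun y _ => ?_)
        rw [abs_mul, abs_of_nonneg (hj x y)]
        refine mul_le_mul_of_nonneg_left ?_ (hj x y)
        have h2 : |β * (infoDensity p W x y - I)| ≤ |β| * D := by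
          rw [abs_mul]; exact mul_le_mul_of_nonneg_left (hD x y) (abs_nonneg _)
        refine (abs_exp_sub_quadratic_le (h2.trans hβ)).trans ?_
        rw [← mul_pow]
        exact pow_le_pow_left₀ (abs_nonneg _) h2 3
    _ = |β| ^ 3 * D ^ 3 := by
        simp only [← Finset.sum_mul]
        rw [sum_joint hp hW, one_mul]

/-- The only information about M(β) used near R = I, where all tilting parameters are of order I - R
and a cubic remainder is negligible. -/
lemma exists_log_expMoment_bound (hp : p ∈ stdSimplex ℝ 𝒳) (hW : ∀ x, W x ∈ stdSimplex ℝ 𝒴) :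
    ∃ β₀ C : ℝ, 0 < β₀ ∧ 0 < C ∧ ∀ β : ℝ, |β| ≤ β₀ →
      |Real.log (expMoment p W β) - (β * mutualInfo p W + β ^ 2 * dispersion p W / 2)|
        ≤ C * |β| ^ 3 := by
  set I := mutualInfo p W
  set V := dispersion p W
  have hV : 0 ≤ V := dispersion_nonneg hp hW
  set D := infoBound p W + |I| with hDdef
  have hD1 : 1 ≤ D := by
    have := one_le_infoBound p W
    have := abs_nonneg I
    rw [hDdef]; linarith
  have hD : ∀ x y, |infoDensity p W x y - I| ≤ D := fun x y =>
    (abs_sub _ _).trans (by rw [hDdef]; gcongr; exact abs_infoDensity_le p W x y)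
  refine ⟨1 / D, D ^ 3 + (V / 2 + D ^ 3) ^ 2, by positivity, by positivity, fun β hβ => ?_⟩
  have hβD : |β| * D ≤ 1 := by rwa [le_div_iff₀ (by positivity)] at hβ
  have hβ1 : |β| ≤ 1 := by
    have := abs_nonneg β
    nlinarith
  have h := abs_expMoment_sub_le hp hW hD hβD
  have hM := expMoment_pos hp hW β
  have hlog : Real.log (expMoment p W β)
      = β * I + Real.log (Real.exp (-(β * I)) * expMoment p W β) := by
    rw [Real.log_mul (Real.exp_pos _).ne' hM.ne', Real.log_exp]; ring
  set Q := Real.exp (-(β * I)) * expMoment p W β with hQ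
  have hQpos : 0 < Q := mul_pos (Real.exp_pos _) hM
  -- The centred density has mean 0, so e^t ≥ 1 + t suffices. This makes (Q-1)³ nonnegative, as the
  -- lower bound on ln Q requires.
  have hQ1 : 1 ≤ Q := by
    have e1 : ∑ x, ∑ y, p x * W x y * (1 + β * (infoDensity p W x y - I)) = 1 := by
      have : ∀ x y, p x * W x y * (1 + β * (infoDensity p W x y - I))
          = p x * W x y * (1 - β * I) + β * (p x * W x y * infoDensity p W x y) :=
        fun x y => by ring
      simp only [this, Finset.sum_add_distrib, ← Finset.mul_sum, ← Finset.sum_mul, (hW _).2,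
        mul_one, hp.2]
      rw [show I = ∑ x, ∑ y, p x * W x y * infoDensity p W x y from rfl]
      simp only [one_mul]
      ring
    rw [hQ, expMoment_eq_sum, ← e1, Finset.mul_sum]
    refine Finset.sum_le_sum fun x _ => ?_
    rw [Finset.mul_sum]
    refine Finset.sum_le_sum fun y _ => ?_
    have e2 := mul_le_mul_of_nonneg_left (Real.add_one_le_exp (β * (infoDensity p W x y - I)))
      (mul_nonneg (hp.1 x) ((hW x).1 y))
    have e3 : Real.exp (-(β * I)) * (p x * W x y * Real.exp (β * infoDensity p W x y))
        = p x * W x y * Real.exp (β * (infoDensity p W x y - I)) := by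
      rw [show β * (infoDensity p W x y - I) = -(β * I) + β * infoDensity p W x y by ring,
        Real.exp_add]
      ring
    rw [e3]; linarith
  obtain ⟨h1, h2⟩ := abs_le.1 h
  have hup : Real.log Q ≤ Q - 1 := Real.log_le_sub_one_of_pos hQpos
  have hlo : (Q - 1) - (Q - 1) ^ 2 ≤ Real.log Q := by
    refine le_trans ?_ (Real.one_sub_inv_le_log_of_pos hQpos)
    have : 1 - Q⁻¹ = (Q - 1) / Q := by field_simp
    rw [this, le_div_iff₀ hQpos]
    nlinarith [pow_nonneg (sub_nonneg.2 hQ1) 3]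
  have hβ3 : |β| ^ 3 ≤ β ^ 2 := by
    rw [← sq_abs β, pow_succ]
    exact mul_le_of_le_one_right (by positivity) hβ1
  have hβ4 : (β ^ 2) ^ 2 ≤ |β| ^ 3 := by
    rw [← sq_abs β, ← pow_mul]
    exact pow_le_pow_of_le_one (abs_nonneg _) hβ1 (by norm_num)
  have hD3 : 0 ≤ D ^ 3 := by positivity
  have hsq : (Q - 1) ^ 2 ≤ (V / 2 + D ^ 3) ^ 2 * |β| ^ 3 := by
    have e1 : Q - 1 ≤ β ^ 2 * (V / 2 + D ^ 3) := by nlinarith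
    calc (Q - 1) ^ 2 ≤ (β ^ 2 * (V / 2 + D ^ 3)) ^ 2 :=
          pow_le_pow_left₀ (by linarith) e1 2
      _ = (V / 2 + D ^ 3) ^ 2 * (β ^ 2) ^ 2 := by ring
      _ ≤ _ := mul_le_mul_of_nonneg_left hβ4 (by positivity)
  have hsq0 : 0 ≤ (V / 2 + D ^ 3) ^ 2 * |β| ^ 3 := by positivity
  rw [hlog, abs_le]
  constructor <;> nlinarith

/-! ### Error exponents -/

lemma le_errorExponent {Pe : ℕ → ℝ≥0∞} {c X : ℝ} (hc : 0 < c)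
    (h : ∀ n : ℕ, Pe n ≤ ENNReal.ofReal (c * Real.exp (-(n * X)))) : (X : EReal) ≤ errorExponent Pe := by
  have hlim : Tendsto (fun n : ℕ => (n : ℝ)⁻¹ * -Real.log c + X) atTop (𝓝 (0 * -Real.log c + X)) :=
    ((tendsto_inv_atTop_zero.comp tendsto_natCast_atTop_atTop).mul_const _).add_const _
  rw [zero_mul, zero_add] at hlim
  have hlim' := (EReal.tendsto_coe.2 hlim).limsup_eq
  rw [← hlim']
  refine limsup_le_limsup ?_
  filter_upwards [eventually_gt_atTop 0] with n hn
  have hn' : (0 : ℝ) < n := by exact_mod_cast hn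
  have h1 : ENNReal.log (Pe n) ≤ ((Real.log c - n * X : ℝ) : EReal) := by
    refine (ENNReal.log_monotone (h n)).trans (le_of_eq ?_)
    rw [ENNReal.log_ofReal_of_pos (by positivity), Real.log_mul hc.ne' (Real.exp_pos _).ne',
      Real.log_exp, sub_eq_add_neg]
  have h2 : (((n : ℝ)⁻¹ : ℝ) : EReal) * ENNReal.log (Pe n)
      ≤ (((n : ℝ)⁻¹ : ℝ) : EReal) * ((Real.log c - n * X : ℝ) : EReal) :=
    mul_le_mul_of_nonneg_left h1 (EReal.coe_nonneg.2 (by positivity))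
  rw [← EReal.coe_mul] at h2
  have h3 := EReal.neg_le_neg_iff.2 h2
  refine le_trans (le_of_eq ?_) h3
  rw [← EReal.coe_neg]
  congr 1
  field_simp
  ring

lemma errorExponent_le {Pe : ℕ → ℝ≥0∞} {X : ℝ}
    (h : ∀ᶠ n : ℕ in atTop, ENNReal.ofReal (Real.exp (-(n * X))) ≤ Pe n) :
    errorExponent Pe ≤ (X : EReal) := by
  refine limsup_le_of_le (h := ?_)
  filter_upwards [h, eventually_gt_atTop 0] with n h hn
  have hn' : (0 : ℝ) < n := by exact_mod_cast hn
  have h1 : ((-(n * X) : ℝ) : EReal) ≤ ENNReal.log (Pe n) := by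
    refine le_trans (le_of_eq ?_) (ENNReal.log_monotone h)
    rw [ENNReal.log_ofReal_of_pos (Real.exp_pos _), Real.log_exp]
  have h2 : (((n : ℝ)⁻¹ : ℝ) : EReal) * ((-(n * X) : ℝ) : EReal)
      ≤ (((n : ℝ)⁻¹ : ℝ) : EReal) * ENNReal.log (Pe n) :=
    mul_le_mul_of_nonneg_left h1 (EReal.coe_nonneg.2 (by positivity))
  rw [← EReal.coe_mul] at h2
  refine (EReal.neg_le_neg_iff.2 h2).trans (le_of_eq ?_)
  rw [← EReal.coe_neg]
  congr 1
  field_simp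

lemma exp_le_numMessages (R : ℝ) (n : ℕ) : Real.exp (n * R) ≤ numMessages R n := Nat.le_ceil _

lemma numMessages_le {R : ℝ} (hR : 0 ≤ R) (n : ℕ) :
    (numMessages R n : ℝ) ≤ 2 * Real.exp (n * R) := by
  have h1 := (Nat.ceil_lt_add_one (Real.exp_pos (n * R)).le).le
  have h2 : 1 ≤ Real.exp (n * R) := Real.one_le_exp (by positivity)
  unfold numMessages
  linarith

lemma numMessages_pos (R : ℝ) (n : ℕ) : 0 < numMessages R n := Nat.ceil_pos.2 (Real.exp_pos _)

/-- The achievability part: a lower bound on the error exponent. -/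
lemma exists_le_errorExponent (hp : p ∈ stdSimplex ℝ 𝒳) (hW : ∀ x, W x ∈ stdSimplex ℝ 𝒴)
    (hred : NoRedundantInputs W) (hI : 0 < mutualInfo p W) :
    ∃ l₀ : ℝ, 0 < l₀ ∧ ∀ l, 0 < l → l ≤ l₀ → ∀ R : ℝ, 0 ≤ R →
      ∀ S : ∀ n : ℕ, MaxInfoGainScheme p W (numMessages R n) n,
      ((-Real.log (expMoment p W (-l)) - l * R : ℝ) : EReal)
        ≤ errorExponent fun n => (S n).errorProb := by
  obtain ⟨l₀, hl₀, h⟩ := exists_errorProb_le hp hW hred hI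
  refine ⟨l₀, hl₀, fun l hl hle R hR S => ?_⟩
  have hM := expMoment_pos hp hW (-l)
  have h2 : (0 : ℝ) < 2 ^ l - 1 := by
    have := Real.one_lt_rpow (x := 2) (by norm_num) hl
    linarith
  refine le_errorExponent (c := (2 ^ l - 1)⁻¹ * 2 ^ l) (by positivity) fun n => ?_
  refine (h l hl hle _ n (S n)).trans (ENNReal.ofReal_le_ofReal ?_)
  rw [mul_assoc]
  refine mul_le_mul_of_nonneg_left ?_ (by positivity)
  have e1 : ((numMessages R n : ℕ) : ℝ) ^ l ≤ 2 ^ l * Real.exp (n * R * l) := by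
    calc _ ≤ (2 * Real.exp (n * R)) ^ l :=
          Real.rpow_le_rpow (by positivity) (numMessages_le hR n) hl.le
      _ = _ := by rw [Real.mul_rpow (by norm_num) (Real.exp_pos _).le, ← Real.exp_mul]
  have e2 : expMoment p W (-l) ^ n = Real.exp (n * Real.log (expMoment p W (-l))) := by
    rw [Real.exp_nat_mul, Real.exp_log hM]
  rw [e2]
  calc _ ≤ Real.exp (n * Real.log (expMoment p W (-l))) * (2 ^ l * Real.exp (n * R * l)) := by
        gcongr
    _ = 2 ^ l * Real.exp (n * Real.log (expMoment p W (-l)) + n * R * l) := by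
        rw [Real.exp_add]; ring
    _ = _ := by congr 2; ring

end

/-! ### Asymptotics of the lower bound on the error probability -/

section

variable {p : 𝒳 → ℝ} {W : 𝒳 → 𝒴 → ℝ}

lemma tendsto_nat_mul_exp_neg {γ : ℝ} (hγ : 0 < γ) (c d : ℝ) :
    Tendsto (fun n : ℕ => (c * n + d) * Real.exp (-(n * γ))) atTop (𝓝 0) := by
  have hn : Tendsto (fun n : ℕ => (n : ℝ) * γ) atTop atTop :=
    tendsto_natCast_atTop_atTop.atTop_mul_const hγ
  have h1 := (Real.tendsto_pow_mul_exp_neg_atTop_nhds_zero 1).comp hn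
  have h0 := (Real.tendsto_pow_mul_exp_neg_atTop_nhds_zero 0).comp hn
  have h := (h1.const_mul (c / γ)).add (h0.const_mul d)
  rw [mul_zero, mul_zero, add_zero] at h
  refine h.congr fun n => ?_
  simp only [Function.comp, pow_one, pow_zero, one_mul]
  field_simp

/-- The terms of the finite-blocklength lower bound, compared with the leading one. -/
lemma tilted_terms_le {ν L R l θ c δ α κ₀ κ₁ κ₂ γ : ℝ} (hν : 0 ≤ ν) (hc : 0 ≤ c) (hθ : 0 < θ)
    (hθ1 : θ ≤ 1) (hδ : 0 ≤ δ) (hL : ν * R ≤ L) (hL2 : L ≤ ν * R + Real.log 2)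
    (h1 : γ ≤ R * θ) (h2 : γ ≤ -(δ * θ - R * θ + κ₁ - κ₀))
    (h3 : γ ≤ -(-(α * θ) + R * θ + κ₂ - κ₀)) :
    Real.exp (ν * κ₀ + l * L) * (1 - (4 * c * ν + 3) * Real.exp (-(ν * γ)))
      ≤ Real.exp (ν * κ₀ + l * L)
        - c * Real.exp ((l - θ) * L) * (2 * ν * max (Real.exp (ν * κ₀)) (Real.exp (ν * κ₁)))
        - Real.exp (ν * δ * θ) * (Real.exp (ν * κ₁) * Real.exp ((l - θ) * L))
        - Real.exp (-(ν * α * θ)) * (Real.exp (ν * κ₂) * Real.exp ((l + θ) * L)) := by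
  set A := Real.exp (ν * κ₀ + l * L) with hA
  have hA0 : 0 < A := Real.exp_pos _
  set e := Real.exp (-(ν * γ)) with he
  have hθL : ν * (R * θ) ≤ θ * L := by nlinarith
  have i1 : Real.exp ((l - θ) * L) * Real.exp (ν * κ₀) ≤ A * e := by
    rw [hA, he, ← Real.exp_add, ← Real.exp_add]
    refine Real.exp_le_exp.2 ?_
    nlinarith [mul_le_mul_of_nonneg_left h1 hν]
  have i3 : Real.exp (ν * δ * θ) * (Real.exp (ν * κ₁) * Real.exp ((l - θ) * L)) ≤ A * e := by
    rw [hA, he, ← Real.exp_add, ← Real.exp_add, ← Real.exp_add]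
    refine Real.exp_le_exp.2 ?_
    nlinarith [mul_le_mul_of_nonneg_left h2 hν]
  -- The term in `i3` carries the additional factor exp(νδθ) ≥ 1.
  have i2 : Real.exp ((l - θ) * L) * Real.exp (ν * κ₁) ≤ A * e := by
    refine le_trans ?_ i3
    rw [mul_comm (Real.exp (ν * κ₁))]
    exact le_mul_of_one_le_left (by positivity) (Real.one_le_exp (by positivity))
  -- The 2 pays for rounding up the number of messages: `L` exceeds νR by at most ln 2, and θ ≤ 1.
  have i4 : Real.exp (-(ν * α * θ)) * (Real.exp (ν * κ₂) * Real.exp ((l + θ) * L)) ≤ 2 * (A * e) := by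
    have : (2 : ℝ) = Real.exp (Real.log 2) := (Real.exp_log (by norm_num)).symm
    rw [hA, he, this, ← Real.exp_add, ← Real.exp_add, ← Real.exp_add, ← Real.exp_add]
    refine Real.exp_le_exp.2 ?_
    have hlog : 0 ≤ Real.log 2 := Real.log_nonneg (by norm_num)
    have := mul_le_mul_of_nonneg_left hL2 hθ.le
    nlinarith [mul_le_mul_of_nonneg_left h3 hν]
  have i5 : c * Real.exp ((l - θ) * L) * (2 * ν * max (Real.exp (ν * κ₀)) (Real.exp (ν * κ₁)))
      ≤ 4 * c * ν * (A * e) := by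
    have j : Real.exp ((l - θ) * L) * max (Real.exp (ν * κ₀)) (Real.exp (ν * κ₁)) ≤ A * e := by
      rcases max_cases (Real.exp (ν * κ₀)) (Real.exp (ν * κ₁)) with h | h <;> rw [h.1]
      · exact i1
      · exact i2
    have j' := mul_le_mul_of_nonneg_left j (show 0 ≤ 2 * c * ν by positivity)
    have : 0 ≤ 2 * c * ν * (A * e) := by positivity
    linarith
  linarith

lemma rpow_natCast_inv_eq {N : ℕ} (hN : 0 < N) (β : ℝ) :
    (N : ℝ)⁻¹ ^ β = Real.exp (-β * Real.log N) := by
  have : (0 : ℝ) < N := by exact_mod_cast hN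
  rw [Real.inv_rpow this.le, ← Real.rpow_neg this.le, Real.rpow_def_of_pos this, mul_comm]

/-- The converse part: an upper bound on the error exponent for suitable tilting parameters. -/
lemma errorExponent_le_of_tilt (hp : p ∈ stdSimplex ℝ 𝒳) (hW : ∀ x, W x ∈ stdSimplex ℝ 𝒴)
    {R l θ α δ X : ℝ} (hR : 0 < R) (hl : 0 < l) (hθ : 0 < θ) (hθl : θ < l) (hθ1 : θ ≤ 1)
    (hδ : 0 ≤ δ) (hM2 : 1 / 2 ≤ expMoment p W (-l))
    (h2 : δ * θ - R * θ + Real.log (expMoment p W (-l + θ)) - Real.log (expMoment p W (-l)) < 0)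
    (h3 : -(α * θ) + R * θ + Real.log (expMoment p W (-l - θ)) - Real.log (expMoment p W (-l)) < 0)
    (h4 : α * l - Real.log (expMoment p W (-l)) - l * R < δ)
    (hX : α * l - Real.log (expMoment p W (-l)) - l * R < X)
    (S : ∀ n : ℕ, MaxInfoGainScheme p W (numMessages R n) n) :
    errorExponent (fun n => (S n).errorProb) ≤ (X : EReal) := by
  have hM := fun β => expMoment_pos hp hW (W := W) β
  set κ₀ := Real.log (expMoment p W (-l)) with hκ₀
  set κ₁ := Real.log (expMoment p W (-l + θ)) with hκ₁
  set κ₂ := Real.log (expMoment p W (-l - θ)) with hκ₂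
  set c := (∑ x, |rowMoment p W (-l) x|) * Fintype.card 𝒳 with hc
  have hc0 : 0 ≤ c := mul_nonneg (Finset.sum_nonneg fun _ _ => abs_nonneg _) (by positivity)
  set X₀ := α * l - κ₀ - l * R with hX₀
  -- One rate at which all error terms decay relative to the leading one.
  obtain ⟨γ, hγ0, hγ⟩ : ∃ γ : ℝ, 0 < γ ∧ γ ≤ R * θ ∧ γ ≤ -(δ * θ - R * θ + κ₁ - κ₀) ∧
      γ ≤ -(-(α * θ) + R * θ + κ₂ - κ₀) := by
    refine ⟨min (R * θ) (min (-(δ * θ - R * θ + κ₁ - κ₀)) (-(-(α * θ) + R * θ + κ₂ - κ₀))), ?_,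
      min_le_left _ _, (min_le_right _ _).trans (min_le_left _ _),
      (min_le_right _ _).trans (min_le_right _ _)⟩
    exact lt_min (by positivity) (lt_min (by linarith) (by linarith))
  have hpow : ∀ (β : ℝ) (n : ℕ), expMoment p W β ^ n
      = Real.exp (n * Real.log (expMoment p W β)) := fun β n => by
    rw [Real.exp_nat_mul, Real.exp_log (hM β)]
  have ev1 := (tendsto_nat_mul_exp_neg hγ0 (4 * c) 3).eventually (gt_mem_nhds one_half_pos)
  have ev2 := ((tendsto_nat_mul_exp_neg (sub_pos.2 hX) 0 1).add
    (tendsto_nat_mul_exp_neg (sub_pos.2 h4) 0 1)).eventually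
    (gt_mem_nhds (show (0 : ℝ) + 0 < 1 / 2 by norm_num))
  refine errorExponent_le ?_
  filter_upwards [ev1, ev2] with n hn1 hn2
  have hN := numMessages_pos R n
  have hbound := le_errorProb hp hW (S n) hN hl hθ hθl hθ1
    (Real.exp_pos (-(n * α))) (Real.exp_pos (-(n * δ))) hM2
  refine le_trans (ENNReal.ofReal_le_ofReal ?_) hbound
  have hNR : (0 : ℝ) < numMessages R n := by exact_mod_cast hN
  set L := Real.log (numMessages R n) with hL
  have hL1 : n * R ≤ L := (Real.le_log_iff_exp_le hNR).2 (exp_le_numMessages R n)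
  have hL2 : L ≤ n * R + Real.log 2 := by
    rw [hL, Real.log_le_iff_le_exp hNR, Real.exp_add, Real.exp_log (by norm_num), mul_comm]
    exact numMessages_le hR.le n
  have hmain := tilted_terms_le (l := l) (Nat.cast_nonneg n) hc0 hθ hθ1 hδ hL1 hL2 hγ.1 hγ.2.1 hγ.2.2
  have hmax : max (expMoment p W (-l)) (expMoment p W (-l + θ)) ^ n
      = max (Real.exp (n * κ₀)) (Real.exp (n * κ₁)) := by
    rw [← hpow, ← hpow]
    rcases max_cases (expMoment p W (-l)) (expMoment p W (-l + θ)) with h | h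
    · rw [h.1, max_eq_left (pow_le_pow_left₀ (hM _).le h.2 n)]
    · rw [h.1, max_eq_right (pow_le_pow_left₀ (hM _).le h.2.le n)]
  rw [rpow_natCast_inv_eq hN, rpow_natCast_inv_eq hN, rpow_natCast_inv_eq hN, hmax, hpow, hpow, hpow,
    ← hL, ← hκ₀, ← hκ₁, ← hκ₂, ← Real.exp_mul, ← Real.exp_mul, ← Real.exp_mul,
    show -(-l) * L = l * L by ring, show -(-l + θ) * L = (l - θ) * L by ring,
    show -(-l - θ) * L = (l + θ) * L by ring, show -(n * δ) * -θ = n * δ * θ by ring,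
    show -(n * α) * θ = -(n * α * θ) by ring, ← Real.exp_add (n * κ₀)]
  have hhalf : Real.exp (n * κ₀ + l * L) * (1 / 2) ≤ Real.exp (n * κ₀ + l * L)
      * (1 - (4 * c * n + 3) * Real.exp (-(n * γ))) :=
    mul_le_mul_of_nonneg_left (by linarith) (Real.exp_pos _).le
  have hlead : Real.exp (-(n * X₀)) ≤ Real.exp (-(n * α) * l) * Real.exp (n * κ₀ + l * L) := by
    rw [← Real.exp_add]
    refine Real.exp_le_exp.2 ?_
    have := mul_le_mul_of_nonneg_left hL1 hl.le
    rw [hX₀]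
    nlinarith
  have h5 := mul_le_mul_of_nonneg_left (hhalf.trans hmain) (Real.exp_pos (-(n * α) * l)).le
  -- The subtracted b = e^(-nδ) is negligible because `h4` says X₀ < δ.
  have h6 : Real.exp (-(n * X)) + Real.exp (-(n * δ)) ≤ Real.exp (-(n * X₀)) * (1 / 2) := by
    have e1 : Real.exp (-(n * X)) = Real.exp (-(n * X₀)) * Real.exp (-(n * (X - X₀))) := by
      rw [← Real.exp_add]; congr 1; ring
    have e2 : Real.exp (-(n * δ)) = Real.exp (-(n * X₀)) * Real.exp (-(n * (δ - X₀))) := by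
      rw [← Real.exp_add]; congr 1; ring
    rw [e1, e2, ← mul_add]
    refine mul_le_mul_of_nonneg_left ?_ (Real.exp_pos _).le
    simp only [zero_mul, zero_add, one_mul] at hn2
    exact hn2.le
  linarith

end

/-! ### The limit as the rate approaches the mutual information -/

section

variable {p : 𝒳 → ℝ} {W : 𝒳 → 𝒴 → ℝ}

/-- With d = (I-R)/V and l = (1+ε)d the tilted drift of -(ln s_n)/n is about R - I + lV = εVd. The
window runs from δ = εVd/2 to α = 2εVd around it, and θ = εd/2 is small enough for the second-order
term not to spoil the two tail conditions. The exponent αl - ln M(-l) - lR is then Vd²(1/2 + O(ε)).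
-/
lemma errorExponent_le_near_capacity (hp : p ∈ stdSimplex ℝ 𝒳) (hW : ∀ x, W x ∈ stdSimplex ℝ 𝒴)
    {β₀ C : ℝ} (hC : 0 < C)
    (hM : ∀ β, |β| ≤ β₀ → |Real.log (expMoment p W β) -
      (β * mutualInfo p W + β ^ 2 * dispersion p W / 2)| ≤ C * |β| ^ 3)
    {ε d R : ℝ} (hV : 0 < dispersion p W) (hε : 0 < ε) (hε1 : ε ≤ 1) (hd : 0 < d)
    (hR : R = mutualInfo p W - dispersion p W * d) (hR0 : 0 < R)
    (hd1 : 432 * C * d < dispersion p W * ε ^ 2) (hd2 : d ≤ ε / 20) (hd3 : 3 * d ≤ β₀)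
    (hd4 : 2 * d * mutualInfo p W ≤ 1 / 2)
    (S : ∀ n, MaxInfoGainScheme p W (numMessages R n) n) :
    errorExponent (fun n => (S n).errorProb)
      ≤ ((dispersion p W * d ^ 2 * (1 / 2 + 4 * ε) : ℝ) : EReal) := by
  set V := dispersion p W with hVdef
  set I := mutualInfo p W with hIdef
  have hεd : ε * d ≤ d := by nlinarith
  have hεd0 : 0 < ε * d := by positivity
  have hb : ∀ β, 0 ≤ β → β ≤ 3 * d → -(27 * C * d ^ 3) ≤
      Real.log (expMoment p W (-β)) - (-β * I + β ^ 2 * V / 2) ∧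
      Real.log (expMoment p W (-β)) - (-β * I + β ^ 2 * V / 2) ≤ 27 * C * d ^ 3 := by
    intro β h0 h1
    have h := hM (-β) (by rw [abs_neg, abs_of_nonneg h0]; linarith)
    rw [abs_neg, abs_of_nonneg h0, neg_sq] at h
    have h3 : β ^ 3 ≤ (3 * d) ^ 3 := by gcongr
    have h4 : C * β ^ 3 ≤ 27 * C * d ^ 3 := by nlinarith
    exact abs_le.1 (h.trans h4)
  have hl := hb ((1 + ε) * d) (by positivity) (by linarith)
  have hl1 := hb ((1 + ε) * d - ε * d / 2) (by linarith) (by linarith)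
  have hl2 := hb ((1 + ε) * d + ε * d / 2) (by linarith) (by linarith)
  -- The two cubic remainders, 27Cd³ each, must fit into the margin Vε²d²/8 of the tighter tail
  -- condition; this explains 432 = 54 · 8.
  have herr : 54 * C * d ^ 3 < V * ε ^ 2 * d ^ 2 / 8 := by
    have := mul_lt_mul_of_pos_right hd1 (show 0 < d ^ 2 by positivity)
    nlinarith
  have hVd : 0 < V * ε ^ 2 * d ^ 2 := by positivity
  have hε2 : V * ε ^ 2 * d ^ 2 ≤ V * ε * d ^ 2 := by
    have : 0 ≤ V * ε * d ^ 2 := by positivity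
    nlinarith
  have hX : 2 * ε * V * d * ((1 + ε) * d) - Real.log (expMoment p W (-((1 + ε) * d)))
      - (1 + ε) * d * R < V * d ^ 2 * (1 / 2 + 4 * ε) := by
    rw [hR]
    linarith [hl.1]
  -- The exponent is quadratic in `d` and δ only linear, so a small `d` puts the exponent below δ.
  have hXδ : V * d ^ 2 * (1 / 2 + 4 * ε) ≤ ε * V * d / 2 := by
    have h1 : V * d * (d * (1 / 2 + 4 * ε)) ≤ V * d * (ε / 2) := by
      have : d * (1 / 2 + 4 * ε) ≤ d * 5 := by gcongr; linarith
      gcongr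
      linarith
    linarith
  refine errorExponent_le_of_tilt (l := (1 + ε) * d) (θ := ε * d / 2) (α := 2 * ε * V * d)
    (δ := ε * V * d / 2) hp hW hR0 (by positivity) (by positivity) (by linarith) (by linarith)
    (by positivity) ?_ ?_ ?_ (hX.trans_le hXδ) hX S
  · have := one_add_mul_mutualInfo_le hp hW (-((1 + ε) * d))
    have h2 : (1 + ε) * d * I ≤ 2 * d * I := by
      have h3 : 0 < I := by linarith [mul_pos hV hd]
      gcongr
      linarith
    linarith
  · rw [show -((1 + ε) * d) + ε * d / 2 = -((1 + ε) * d - ε * d / 2) by ring, hR]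
    linarith [hl.1, hl1.2]
  · rw [show -((1 + ε) * d) - ε * d / 2 = -((1 + ε) * d + ε * d / 2) by ring, hR]
    linarith [hl.1, hl2.2]

/-- Achievability with l = K(I-R) has exponent at least (K - K²V/2)(I-R)² - CK³(I-R)³. Leaving `K`
free serves both V > 0, where 1/V is optimal, and V = 0, where `K` can be arbitrarily large. -/
lemma eventually_le_quotient (hp : p ∈ stdSimplex ℝ 𝒳) (hW : ∀ x, W x ∈ stdSimplex ℝ 𝒴)
    (S : ∀ (R : ℝ) (n : ℕ), MaxInfoGainScheme p W (numMessages R n) n)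
    (hred : NoRedundantInputs W) (hI : 0 < mutualInfo p W) {K x : ℝ}
    (hK : 0 < K) (hx : x < K - K ^ 2 * dispersion p W / 2) :
    ∀ᶠ R in 𝓝[<] mutualInfo p W, (x : EReal) ≤
      errorExponent (fun n => (S R n).errorProb) / (((mutualInfo p W - R) ^ 2 : ℝ) : EReal) := by
  obtain ⟨β₀, C, hβ₀, hC, hM⟩ := exists_log_expMoment_bound hp hW
  obtain ⟨l₀, hl₀, hE⟩ := exists_le_errorExponent hp hW hred hI
  set V := dispersion p W
  set I := mutualInfo p W
  have hmem : ∀ c : ℝ, 0 < c → ∀ᶠ R in 𝓝[<] I, I - R < c := fun c hc => by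
    filter_upwards [Ioo_mem_nhdsLT (show I - c < I by linarith)] with R hR
    linarith [hR.1]
  filter_upwards [hmem I hI, hmem (l₀ / K) (by positivity), hmem (β₀ / K) (by positivity),
    hmem ((K - K ^ 2 * V / 2 - x) / (C * K ^ 3)) (div_pos (by linarith) (by positivity)),
    self_mem_nhdsWithin] with R h0 h1 h2 h3 hR
  have hD : 0 < I - R := sub_pos.2 hR
  rw [lt_div_iff₀ (by positivity)] at h1 h2 h3
  have hl : 0 < K * (I - R) := by positivity
  refine (EReal.le_div_iff_mul_le (by exact_mod_cast pow_pos hD 2) (EReal.coe_ne_top _)).2 ?_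
  refine le_trans ?_ (hE (K * (I - R)) hl (by linarith) R (by linarith) (S R))
  rw [← EReal.coe_mul, EReal.coe_le_coe_iff]
  have h := (abs_le.1 (hM (-(K * (I - R))) (by rw [abs_neg, abs_of_pos hl]; linarith))).2
  rw [abs_neg, abs_of_pos hl] at h
  have h4 := mul_lt_mul_of_pos_right h3 (pow_pos hD 2)
  nlinarith

lemma eventually_quotient_le (hp : p ∈ stdSimplex ℝ 𝒳) (hW : ∀ x, W x ∈ stdSimplex ℝ 𝒴)
    (S : ∀ (R : ℝ) (n : ℕ), MaxInfoGainScheme p W (numMessages R n) n)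
    (hI : 0 < mutualInfo p W) (hV : 0 < dispersion p W) {x : ℝ}
    (hx : 1 / (2 * dispersion p W) < x) :
    ∀ᶠ R in 𝓝[<] mutualInfo p W,
      errorExponent (fun n => (S R n).errorProb) / (((mutualInfo p W - R) ^ 2 : ℝ) : EReal)
        ≤ (x : EReal) := by
  obtain ⟨β₀, C, hβ₀, hC, hM⟩ := exists_log_expMoment_bound hp hW
  have hxV : 0 < x * dispersion p W - 1 / 2 := by
    rw [div_lt_iff₀ (by positivity)] at hx
    linarith
  obtain ⟨ε, hε, hε1, hεx⟩ : ∃ ε : ℝ, 0 < ε ∧ ε ≤ 1 ∧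
      1 / 2 + 4 * ε ≤ x * dispersion p W :=
    ⟨min 1 ((x * dispersion p W - 1 / 2) / 4), lt_min one_pos (by positivity), min_le_left _ _,
      by linarith [min_le_right 1 ((x * dispersion p W - 1 / 2) / 4)]⟩
  have hmem : ∀ c : ℝ, 0 < c → ∀ᶠ R in 𝓝[<] mutualInfo p W,
      (mutualInfo p W - R) / dispersion p W < c := fun c hc => by
    filter_upwards [Ioo_mem_nhdsLT (show mutualInfo p W - c * dispersion p W < mutualInfo p W by
      nlinarith [mul_pos hc hV])] with R hR
    rw [div_lt_iff₀ hV]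
    linarith [hR.1]
  filter_upwards [hmem (mutualInfo p W / dispersion p W) (by positivity),
    hmem (dispersion p W * ε ^ 2 / (432 * C)) (by positivity), hmem (ε / 20) (by positivity),
    hmem (β₀ / 3) (by positivity), hmem (1 / (4 * mutualInfo p W)) (by positivity),
    self_mem_nhdsWithin] with R h0 h1 h2 h3 h4 hR
  have hD : 0 < mutualInfo p W - R := sub_pos.2 hR
  set d := (mutualInfo p W - R) / dispersion p W with hd
  have hVd : dispersion p W * d = mutualInfo p W - R := by rw [hd]; field_simp
  rw [lt_div_iff₀ (by positivity)] at h0 h1 h4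
  have hd0 : 0 < d := div_pos hD hV
  clear_value d
  refine (EReal.div_le_iff_le_mul (by exact_mod_cast pow_pos hD 2) (EReal.coe_ne_top _)).2 ?_
  refine (errorExponent_le_near_capacity hp hW hC hM hV hε hε1 hd0 (by linarith)
    (by linarith) (by linarith) h2.le (by linarith) (by linarith) (S R)).trans ?_
  rw [← EReal.coe_mul, EReal.coe_le_coe_iff, ← hVd]
  calc dispersion p W * d ^ 2 * (1 / 2 + 4 * ε)
      ≤ dispersion p W * d ^ 2 * (x * dispersion p W) := by gcongr
    _ = (dispersion p W * d) ^ 2 * x := by ring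

lemma tendsto_quotient (hp : p ∈ stdSimplex ℝ 𝒳) (hW : ∀ x, W x ∈ stdSimplex ℝ 𝒴)
    (S : ∀ (R : ℝ) (n : ℕ), MaxInfoGainScheme p W (numMessages R n) n)
    (hred : NoRedundantInputs W) (hI : 0 < mutualInfo p W) :
    Tendsto (fun R : ℝ => errorExponent (fun n => (S R n).errorProb) /
        (((mutualInfo p W - R) ^ 2 : ℝ) : EReal)) (𝓝[<] mutualInfo p W)
      (𝓝 ((1 / (2 * ENNReal.ofReal (dispersion p W)) : ℝ≥0∞) : EReal)) := by
  rcases (dispersion_nonneg hp hW).eq_or_lt with hV | hV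
  · have htop : ((1 / (2 * ENNReal.ofReal (dispersion p W)) : ℝ≥0∞) : EReal) = ⊤ := by
      simp [← hV]
    rw [htop, EReal.tendsto_nhds_top_iff_real]
    intro x
    -- The quadratic term vanishes with the variance, so K = |x| + 2 exceeds any prescribed level.
    have hK : x + 1 < |x| + 2 - (|x| + 2) ^ 2 * dispersion p W / 2 := by
      rw [← hV]
      linarith [le_abs_self x]
    filter_upwards [eventually_le_quotient hp hW S hred hI (by positivity) hK] with R hR
    exact (EReal.coe_lt_coe_iff.2 (lt_add_one x)).trans_le hR
  · have hreal : ((1 / (2 * ENNReal.ofReal (dispersion p W)) : ℝ≥0∞) : EReal)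
        = ((1 / (2 * dispersion p W) : ℝ) : EReal) := by
      have : (1 / (2 * ENNReal.ofReal (dispersion p W)) : ℝ≥0∞)
          = ENNReal.ofReal (1 / (2 * dispersion p W)) := by
        rw [ENNReal.ofReal_div_of_pos (by positivity), ENNReal.ofReal_mul zero_le_two]
        simp
      rw [this, EReal.coe_ennreal_ofReal, max_eq_left (by positivity)]
    rw [hreal]
    refine tendsto_order.2 ⟨fun a ha => ?_, fun b hb => ?_⟩
    · obtain ⟨x, hax, hx⟩ := EReal.lt_iff_exists_real_btwn.1 ha
      -- K = 1/V maximizes K - K²V/2, with value 1/(2V).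
      have hK : x < 1 / dispersion p W - (1 / dispersion p W) ^ 2 * dispersion p W / 2 := by
        have := EReal.coe_lt_coe_iff.1 hx
        convert this using 1
        field_simp
        norm_num
      filter_upwards [eventually_le_quotient hp hW S hred hI (by positivity) hK] with R hR
      exact hax.trans_le hR
    · obtain ⟨x, hx, hxb⟩ := EReal.lt_iff_exists_real_btwn.1 hb
      filter_upwards [eventually_quotient_le hp hW S hI hV (EReal.coe_lt_coe_iff.1 hx)] with R hR
      exact hR.trans_lt hxb

end

end FeedbackScheme

end

theorem corollary1 {𝒳 𝒴 : Type*} [Fintype 𝒳] [LinearOrder 𝒳] [Nonempty 𝒳] [Fintype 𝒴]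
    (p : 𝒳 → ℝ) (W : 𝒳 → 𝒴 → ℝ)
    (hp : p ∈ stdSimplex ℝ 𝒳) (hW : ∀ x, W x ∈ stdSimplex ℝ 𝒴)
    (hred : NoRedundantInputs W) (hI : 0 < mutualInfo p W)
    (scheme : ∀ (R : ℝ) (n : ℕ), MaxInfoGainScheme p W (numMessages R n) n)
    (E : ℝ → EReal) (hE : ∀ R, E R = errorExponent (fun n => (scheme R n).errorProb)) :
    liminf (fun R : ℝ => E R / (((mutualInfo p W - R) ^ 2 : ℝ) : EReal)) (𝓝[<] mutualInfo p W)
        = ((1 / (2 * ENNReal.ofReal (dispersion p W)) : ℝ≥0∞) : EReal) ∧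
      Tendsto (fun R : ℝ => E R / (((mutualInfo p W - R) ^ 2 : ℝ) : EReal)) (𝓝[<] mutualInfo p W)
        (𝓝 ((1 / (2 * ENNReal.ofReal (dispersion p W)) : ℝ≥0∞) : EReal)) := by
  obtain rfl : E = fun R => errorExponent (fun n => (scheme R n).errorProb) := funext hE
  have h := tendsto_quotient hp hW scheme hred hI
  exact ⟨h.liminf_eq, h⟩
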